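/- Let $\kappa>0$, $\lambda=2\pi/\kappa$, $\theta\in(-\frac{\pi}{2},\frac{\pi}{2})$, $\epsilon,d>0$, and put $\mathbb R^2_+=\{x_2>0\}$, $\Gamma_0=\{x_2=0\}$, $D_\epsilon=(0,\epsilon)\times(-d,0)$, $\Gamma_\epsilon^+=(0,\epsilon)\times\{0\}$, $\Gamma_\epsilon^-=(0,\epsilon)\times\{-d\}$, $\phi_0=1/\sqrt{\epsilon}$, $u^{\rm inc}(x)=e^{i\kappa(x_1\sin\theta-x_2\cos\theta)}$, $u^{\rm ref}(x)=e^{i\kappa(x_1\sin\theta+x_2\cos\theta)}$. A solution of the single-mode approximate PEC-PMC cavity problem is a function $v_\epsilon$ that is $C^2$ in $\mathbb R^2_+$, belongs to $H^1$ of every bounded part of $\mathbb R^2_+$, is continuous up to $\Gamma_0$ except possibly at the two end points $(0,0),(\epsilon,0)$ of the aperture, and satisfies, with $v_0^+=\int_0^\epsilon v_\epsilon(x_1,0^+)\phi_0\,dx_1$ and $v_0^-=\int_0^\epsilon v_\epsilon(x_1,-d)\phi_0\,dx_1$, $$ \begin{cases} \Delta v_\epsilon+\kappa^2v_\epsilon=0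 & \text{in }\mathbb R^2_+,\\ \partial_{x_2}v_\epsilon=0 & \text{on }\Gamma_0\setminus\overline{\Gamma_\epsilon^+},\\ \partial_{x_2}v_\epsilon=i\kappa\,\dfrac{e^{2i\kappa d}+1}{e^{2i\kappa d}-1}\,v_0^+\phi_0 & \text{on }\Gamma_\epsilon^+,\\ \sqrt r\,(\partial_r v^{\rm sc}-i\kappa v^{\rm sc})\to0 & \text{as } r=|x|\to\infty,\ x\in\mathbb R^2_+, \text{ uniformly in the direction } x/|x|, \end{cases} \qquad v^{\rm sc}=v_\epsilon-u^{\rm inc}-u^{\rm ref}, $$ where the boundary values of $\partial_{x_2}v_\epsilon$ are limits from $\mathbb R^2_+$, while $v_\epsilon=0$ on $\Gamma_\epsilon^-$ and, in the cavity $D_\epsilon$, $$ v_\epsilon(x)=\bigl(\alpha^+e^{-i\kappa x_2}+\alpha^-e^{i\kappa(x_2+d)}\bigr)\phi_0,\qquad \alpha^{+}=\frac{e^{i\kappa d}v_0^{-}-v_0^{+}}{e^{2i\kappa d}-1},\quad \alpha^{-}=\frac{e^{i\kappa d}v_0^{+}-v_0^{-}}{e^{2i\kappa d}-1}. $$ **Theorem.**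 There are constants $\delta,C_1,C_2>0$, independent of $\lambda,\epsilon,d$ (and of $\theta$), such that whenever $\epsilon\le\delta d$ and $d\le\delta\lambda$, every such solution satisfies $$\|\nabla v_\epsilon\|_{L^2(D_\epsilon)}\le C_2\sqrt{\epsilon/d},$$ and, if moreover $\epsilon\ln(\lambda/\epsilon)\le d$ (which holds, for given $\lambda$ and $d$, for all sufficiently small $\epsilon$), also $$C_1\sqrt{\epsilon/d}\le\|\nabla v_\epsilon\|_{L^2(D_\epsilon)}.$$ -/

import Mathlib

open Filter Topology MeasureTheory Bornology

namespace PECPMC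

noncomputable section

/-- The plane `ℝ²` with its Euclidean norm; a point is `x = (x₁, x₂) = (x 0, x 1)`. -/
abbrev Plane : Type := EuclideanSpace ℝ (Fin 2)

/-- The wavelength `λ = 2π/κ` of the wavenumber `κ`. -/
def wavelength (κ : ℝ) : ℝ := 2 * Real.pi / κ

/-- The open upper half-plane. -/
def upperHalf : Set Plane := {x | 0 < x 1}

/-- The open rectangular cavity `D_ε = (0, ε) × (-d, 0)`. -/
def cavity (ε d : ℝ) : Set Plane := {x | 0 < x 0 ∧ x 0 < ε ∧ -d < x 1 ∧ x 1 < 0}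

/-- The partial derivative `∂_{x_i} v`. -/
def partialDeriv (i : Fin 2) (v : Plane → ℂ) (x : Plane) : ℂ :=
  fderiv ℝ v x (EuclideanSpace.single i 1)

/-- `|∇v|² = |∂_{x₁} v|² + |∂_{x₂} v|²`. -/
def gradSq (v : Plane → ℂ) (x : Plane) : ℝ :=
  ‖partialDeriv 0 v x‖ ^ 2 + ‖partialDeriv 1 v x‖ ^ 2

/-- `‖∇v‖_{L²(S)}`. -/
def gradL2Norm (v : Plane → ℂ) (S : Set Plane) : ℝ :=
  Real.sqrt (∫ x in S, gradSq v x)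

/-- The incident plane wave `exp (i κ x·(sin θ, -cos θ))`. -/
def uInc (κ θ : ℝ) (x : Plane) : ℂ :=
  Complex.exp (Complex.I * κ * (x 0 * Real.sin θ - x 1 * Real.cos θ))

/-- The reflected plane wave `exp (i κ x·(sin θ, cos θ))`. -/
def uRef (κ θ : ℝ) (x : Plane) : ℂ :=
  Complex.exp (Complex.I * κ * (x 0 * Real.sin θ + x 1 * Real.cos θ))

/-- The scattered field `v - (u^inc + u^ref)` (used in the upper half-plane only). -/
def scattered (κ θ : ℝ) (v : Plane → ℂ) (x : Plane) : ℂ :=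
  v x - (uInc κ θ x + uRef κ θ x)

/-- The constant mode `φ₀ = 1/√ε`. -/
def phi0 (ε : ℝ) : ℂ := ((1 / Real.sqrt ε : ℝ) : ℂ)

/-- The zeroth Fourier coefficient of `v` on the segment `(0, ε) × {h}`; `h = 0` gives `v₀⁺` and
`h = -d` gives `v₀⁻`. -/
def coeff0 (ε h : ℝ) (v : Plane → ℂ) : ℂ :=
  ∫ t in (0 : ℝ)..ε, v !₂[t, h] * starRingEnd ℂ (phi0 ε)

/-- The single-mode Dirichlet-to-Neumann map
`i κ (e^{2iκd} + 1) / (e^{2iκd} - 1) v₀⁺ φ₀`, a constant function on the aperture. -/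
def dtn0 (κ ε d : ℝ) (v : Plane → ℂ) : ℂ :=
  Complex.I * κ * ((Complex.exp (Complex.I * 2 * κ * d) + 1) /
    (Complex.exp (Complex.I * 2 * κ * d) - 1)) * coeff0 ε 0 v * phi0 ε

/-- The mode coefficient `α₀⁺`. -/
def alphaPlus (κ ε d : ℝ) (v : Plane → ℂ) : ℂ :=
  (Complex.exp (Complex.I * κ * d) * coeff0 ε (-d) v - coeff0 ε 0 v) /
    (Complex.exp (Complex.I * 2 * κ * d) - 1)

/-- The mode coefficient `α₀⁻`. -/
def alphaMinus (κ ε d : ℝ) (v : Plane → ℂ) : ℂ :=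
  (Complex.exp (Complex.I * κ * d) * coeff0 ε 0 v - coeff0 ε (-d) v) /
    (Complex.exp (Complex.I * 2 * κ * d) - 1)

/-- `v` solves the single-mode approximate PEC-PMC cavity problem. On the line `x₂ = 0` the values
of `v` are its traces from above. No condition is imposed at the two end points of the aperture
(there the normal derivative of a solution jumps) other than finiteness of the local energy. -/
structure IsApproxSolution (κ θ ε d : ℝ) (v : Plane → ℂ) : Prop where
  contDiffOn : ContDiffOn ℝ 2 v upperHalf
  continuousOn : ContinuousOn v {x | 0 ≤ x 1 ∧ x ≠ !₂[0, 0] ∧ x ≠ !₂[ε, 0]}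
  /-- `v ∈ H¹` of every bounded part of the half-plane -/
  sq_integrable : ∀ R : ℝ, IntegrableOn (fun x => ‖v x‖ ^ 2) (Metric.ball 0 R ∩ upperHalf)
  gradSq_integrable : ∀ R : ℝ, IntegrableOn (gradSq v) (Metric.ball 0 R ∩ upperHalf)
  helmholtz : ∀ x ∈ upperHalf, Laplacian.laplacian v x + (κ : ℂ) ^ 2 * v x = 0
  /-- `∂_ν v = 0` on the line `x₂ = 0` outside the aperture -/
  neumann : ∀ t : ℝ, t ∉ Set.Icc 0 ε →
    Tendsto (partialDeriv 1 v) (𝓝[upperHalf] !₂[t, 0]) (𝓝 0)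
  /-- `∂_{x₂} v` equals the single-mode Dirichlet-to-Neumann map on the aperture -/
  aperture : ∀ t ∈ Set.Ioo 0 ε,
    Tendsto (partialDeriv 1 v) (𝓝[upperHalf] !₂[t, 0]) (𝓝 (dtn0 κ ε d v))
  /-- Sommerfeld radiation condition, uniformly in all upward directions -/
  radiation :
    Tendsto (fun x : Plane => (Real.sqrt ‖x‖ : ℂ) *
        (fderiv ℝ (scattered κ θ v) x (‖x‖⁻¹ • x) - Complex.I * κ * scattered κ θ v x))
      (cobounded Plane ⊓ 𝓟 upperHalf) (𝓝 0)
  /-- `v = 0` on the bottom of the cavity -/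
  bottom : ∀ t ∈ Set.Ioo 0 ε, v !₂[t, -d] = 0
  /-- `v` is the single waveguide mode in the cavity -/
  mode : ∀ x ∈ cavity ε d,
    v x = (alphaPlus κ ε d v * Complex.exp (-Complex.I * κ * x 1) +
      alphaMinus κ ε d v * Complex.exp (Complex.I * κ * (x 1 + d))) * phi0 ε

end

end PECPMC

/-! The problem collapses to one scalar. In the cavity the bottom condition removes v₀⁻, and the
mode becomes v₀⁺ φ₀ sin(κ(x₂+d))/sin(κd). For κd ≤ 1 its energy is therefore comparable to |v₀⁺|²/d
(`integral_gradSq_bounds`), and it remains to compare |v₀⁺| with √ε.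

On the aperture the Neumann datum is a constant, c = τ v₀⁺ φ₀ with τ = κ cot(κd) real and 0 < τ ≤
1/d. Let M₀ = (iπ/2) H₀⁽¹⁾, which is `hankelMoment 0`. Green's representation in the half-plane
gives π v^sc(y,0) = -c ∫₀^ε M₀(κ|t-y|) dt on the aperture (`trace_eq`). Adding the trace 2 exp(iκ y
sin θ) of the incident and reflected waves and averaging against φ₀ yields the linear equation v₀⁺
(1 + qJ) = 2 φ₀ X, with q = τ/(πε), where J is the double integral of M₀(κ|t-y|) over the aperture
and ε/2 ≤ |X| ≤ ε (`coeff0_eq`).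

Upper bound: M₀ behaves like -log z at 0, so Re M₀ is bounded below near 0 and the singularity only
helps. Since qε² ≤ ε/d ≤ δ, this gives Re(1 + qJ) ≥ 1/2. Lower bound: |M₀(z)| ≤ C - K log z gives
|qJ| ≤ (ε/d)(C + 2K - K log(κε)), which is bounded exactly because ε ln(λ/ε) ≤ d.

The analytic weight lies in `trace_eq`. Green's identity is applied in {x₂ > h} with smooth cutoffs
in place of boundary circles: one large disc, minus small discs about the two end points, where the
field need not be continuous. The large-disc error is small by the radiation condition together with
the growth o(√r) deduced from it; the small-disc errors are small by finite local energy. As h → 0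
the single layer converges by domination. In the double layer a rescaled Poisson kernel appears,
whose mass π produces the term π v^sc(y,0). The Hankel function itself is built from a Laplace
integral, from which the Bessel equation, the decay, the radiation estimate and the behaviour at 0
are all derived. -/

namespace PECPMC

noncomputable section

/-! ### The Hankel function as a Laplace integral -/

/-- The weight `(σ² - 2 i σ)^{-1/2}` in the Laplace representation of the Hankel function. -/
def hankelWeight (σ : ℝ) : ℂ :=
  ((σ : ℂ) ^ 2 - 2 * Complex.I * σ) ^ ((-(1 / 2) : ℝ) : ℂ)

/-- The integrand of `hankelMoment`. -/
def hankelIntegrand (k : ℕ) (z σ : ℝ) : ℂ :=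
  ((σ : ℂ) - Complex.I) ^ k * Complex.exp (-z * (σ - Complex.I)) * hankelWeight σ

/-- The functions `∫₀^∞ (σ - i)^k e^{-z(σ - i)} (σ² - 2 i σ)^{-1/2} dσ`. For `k = 0` this is
`(iπ/2) H₀⁽¹⁾(z)`, and differentiation in `z` raises `k` by one and changes the sign. -/
def hankelMoment (k : ℕ) (z : ℝ) : ℂ :=
  ∫ σ in Set.Ioi (0 : ℝ), hankelIntegrand k z σ

lemma hankelBase_eq (σ : ℝ) :
    (σ : ℂ) ^ 2 - 2 * Complex.I * σ = σ * ((σ : ℂ) - 2 * Complex.I) := by ring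

lemma two_le_norm_sub (σ : ℝ) : 2 ≤ ‖(σ : ℂ) - 2 * Complex.I‖ := by
  have := Complex.abs_im_le_norm ((σ : ℂ) - 2 * Complex.I)
  simpa using this

lemma norm_hankelWeight {σ : ℝ} (hσ : 0 < σ) :
    ‖hankelWeight σ‖ = (σ * ‖(σ : ℂ) - 2 * Complex.I‖) ^ (-(1 / 2) : ℝ) := by
  rw [hankelWeight, Complex.norm_cpow_real, hankelBase_eq, norm_mul, Complex.norm_real,
    Real.norm_of_nonneg hσ.le]

lemma norm_hankelWeight_le {σ : ℝ} (hσ : 0 < σ) :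
    ‖hankelWeight σ‖ ≤ σ ^ (-(1 / 2) : ℝ) := by
  rw [norm_hankelWeight hσ]
  apply Real.rpow_le_rpow_of_nonpos hσ _ (by norm_num)
  nlinarith [two_le_norm_sub σ]

lemma measurable_hankelWeight : Measurable hankelWeight := by
  unfold hankelWeight
  fun_prop

lemma measurable_hankelIntegrand (k : ℕ) (z : ℝ) : Measurable (hankelIntegrand k z) := by
  have := measurable_hankelWeight
  unfold hankelIntegrand
  fun_prop

lemma norm_sub_I_le {σ : ℝ} (hσ : 0 < σ) : ‖(σ : ℂ) - Complex.I‖ ≤ σ + 1 := by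
  refine (norm_sub_le _ _).trans ?_
  simp [abs_of_pos hσ]

lemma norm_exp_neg_mul (z σ : ℝ) :
    ‖Complex.exp (-z * (σ - Complex.I))‖ = Real.exp (-z * σ) := by
  rw [Complex.norm_exp]; congr 1; simp

lemma norm_hankelIntegrand_le (k : ℕ) (z : ℝ) {σ : ℝ} (hσ : 0 < σ) :
    ‖hankelIntegrand k z σ‖ ≤ (σ + 1) ^ k * Real.exp (-z * σ) * σ ^ (-(1 / 2) : ℝ) := by
  rw [hankelIntegrand, norm_mul, norm_mul, norm_pow, norm_exp_neg_mul]
  gcongr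
  · exact norm_sub_I_le hσ
  · exact norm_hankelWeight_le hσ

lemma integrableOn_rpow_mul_exp {s z : ℝ} (hs : -1 < s) (hz : 0 < z) :
    IntegrableOn (fun σ : ℝ => σ ^ s * Real.exp (-z * σ)) (Set.Ioi 0) := by
  simpa using integrableOn_rpow_mul_exp_neg_mul_rpow hs one_pos hz

lemma integrableOn_hankelBound (k : ℕ) {z : ℝ} (hz : 0 < z) :
    IntegrableOn (fun σ : ℝ => (σ + 1) ^ k * Real.exp (-z * σ) * σ ^ (-(1 / 2) : ℝ))
      (Set.Ioi 0) := by
  have h1 := integrableOn_rpow_mul_exp (s := (k : ℝ) - 1 / 2) (z := z)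
    (by have : (0 : ℝ) ≤ k := by positivity
        linarith) hz
  have h2 := integrableOn_rpow_mul_exp (s := -(1 / 2)) (z := z) (by norm_num) hz
  refine ((h1.add h2).const_mul (2 ^ (k - 1))).mono' (by fun_prop) ?_
  filter_upwards [ae_restrict_mem measurableSet_Ioi] with σ hσ
  have hσ : (0 : ℝ) < σ := hσ
  rw [Real.norm_of_nonneg (by positivity)]
  have h3 : σ ^ ((k : ℝ) - 1 / 2) = σ ^ k * σ ^ (-(1 / 2) : ℝ) := by
    rw [← Real.rpow_natCast, ← Real.rpow_add hσ]; ring_nf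
  have h4 := add_pow_le hσ.le zero_le_one k
  simp only [Pi.add_apply, h3]
  calc (σ + 1) ^ k * Real.exp (-z * σ) * σ ^ (-(1 / 2) : ℝ)
      ≤ (2 ^ (k - 1) * (σ ^ k + 1 ^ k)) * Real.exp (-z * σ) * σ ^ (-(1 / 2) : ℝ) := by gcongr
    _ = _ := by rw [one_pow]; ring

lemma integrableOn_hankelIntegrand (k : ℕ) {z : ℝ} (hz : 0 < z) :
    IntegrableOn (hankelIntegrand k z) (Set.Ioi 0) := by
  refine (integrableOn_hankelBound k hz).mono'
    (measurable_hankelIntegrand k z).aestronglyMeasurable ?_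
  filter_upwards [ae_restrict_mem measurableSet_Ioi] with σ hσ
  exact norm_hankelIntegrand_le k z hσ

lemma hasDerivAt_hankelMoment (k : ℕ) {z : ℝ} (hz : 0 < z) :
    HasDerivAt (hankelMoment k) (-hankelMoment (k + 1) z) z := by
  have h := hasDerivAt_integral_of_dominated_loc_of_deriv_le (𝕜 := ℝ)
    (μ := volume.restrict (Set.Ioi (0 : ℝ))) (F := hankelIntegrand k)
    -- Staying above z/2 keeps one exponential majorant valid for all nearby arguments.
    (F' := fun z σ => -hankelIntegrand (k + 1) z σ) (x₀ := z) (s := Set.Ioi (z / 2))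
    (bound := fun σ => (σ + 1) ^ (k + 1) * Real.exp (-(z / 2) * σ) * σ ^ (-(1 / 2) : ℝ))
    (Ioi_mem_nhds (by linarith))
    (Eventually.of_forall fun x => (measurable_hankelIntegrand k x).aestronglyMeasurable)
    (integrableOn_hankelIntegrand k hz)
    (measurable_hankelIntegrand (k + 1) z).neg.aestronglyMeasurable ?_
    (integrableOn_hankelBound (k + 1) (by linarith)) ?_
  · have h2 := h.2
    rw [integral_neg] at h2
    exact h2
  · filter_upwards [ae_restrict_mem measurableSet_Ioi] with σ hσ x hx
    rw [norm_neg]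
    refine (norm_hankelIntegrand_le (k + 1) x hσ).trans ?_
    have hσ : (0 : ℝ) < σ := hσ
    have hx : z / 2 < x := hx
    gcongr
  · refine Eventually.of_forall fun σ x _ => ?_
    unfold hankelIntegrand
    have h1 : HasDerivAt (fun x : ℝ => (-(x : ℂ)) * (σ - Complex.I)) (-1 * (σ - Complex.I)) x :=
      (Complex.ofRealCLM.hasDerivAt (x := x)).neg.mul_const _
    refine ((h1.cexp.const_mul (((σ : ℂ) - Complex.I) ^ k)).mul_const
      (hankelWeight σ)).congr_deriv ?_
    ring

lemma contDiffOn_hankelMoment (n : ℕ) (k : ℕ) :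
    ContDiffOn ℝ n (hankelMoment k) (Set.Ioi 0) := by
  induction n generalizing k with
  | zero =>
    simp only [Nat.cast_zero, contDiffOn_zero]
    exact fun z hz => (hasDerivAt_hankelMoment k hz).continuousAt.continuousWithinAt
  | succ n ih =>
    rw [Nat.cast_succ, contDiffOn_succ_iff_deriv_of_isOpen isOpen_Ioi]
    refine ⟨fun z hz => (hasDerivAt_hankelMoment k hz).differentiableAt.differentiableWithinAt,
      by simp, (ih (k + 1)).neg.congr fun z hz => (hasDerivAt_hankelMoment k hz).deriv⟩

lemma continuousOn_hankelMoment (k : ℕ) : ContinuousOn (hankelMoment k) (Set.Ioi 0) :=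
  (contDiffOn_hankelMoment 0 k).continuousOn

lemma hankelBase_mem_slitPlane {σ : ℝ} (hσ : 0 < σ) :
    (σ : ℂ) ^ 2 - 2 * Complex.I * σ ∈ Complex.slitPlane := by
  right
  have : ((σ : ℂ) ^ 2).im = 0 := by rw [← Complex.ofReal_pow, Complex.ofReal_im]
  simp [this, hσ.ne']

/-- The Bessel equation. -/
lemma hankelMoment_bessel {z : ℝ} (hz : 0 < z) :
    z * hankelMoment 2 z - hankelMoment 1 z + z * hankelMoment 0 z = 0 := by
  -- Since (σ - i)² + 1 = σ² - 2iσ, the combined integrand is minus the derivative of this function,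
  -- which vanishes at 0 and at infinity.
  set g : ℝ → ℂ := fun σ => Complex.exp (-z * (σ - Complex.I)) *
    ((σ : ℂ) ^ 2 - 2 * Complex.I * σ) ^ ((1 / 2 : ℝ) : ℂ) with hg
  set g' : ℝ → ℂ := fun σ => -(z * hankelIntegrand 2 z σ - hankelIntegrand 1 z σ +
    z * hankelIntegrand 0 z σ) with hg'
  have hgn : ∀ σ : ℝ, 0 ≤ σ → ‖g σ‖ ≤ Real.exp (-z * σ) * (σ * (σ + 2)) ^ (1 / 2 : ℝ) := by
    intro σ hσ
    rw [hg]
    simp only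
    rw [norm_mul, norm_exp_neg_mul, Complex.norm_cpow_real, hankelBase_eq, norm_mul,
      Complex.norm_real, Real.norm_of_nonneg hσ]
    gcongr
    refine (norm_sub_le _ _).trans ?_
    simp [abs_of_nonneg hσ]
  have hderiv : ∀ σ ∈ Set.Ioi (0 : ℝ), HasDerivAt g (g' σ) σ := by
    intro σ hσ
    have hσ : 0 < σ := hσ
    have hb := hankelBase_mem_slitPlane hσ
    have h1 : HasDerivAt (fun s : ℂ => Complex.exp (-z * (s - Complex.I)))
        (Complex.exp (-z * (σ - Complex.I)) * (-z * 1)) (σ : ℂ) :=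
      (((hasDerivAt_id (σ : ℂ)).sub_const _).const_mul _).cexp
    have h2 : HasDerivAt (fun s : ℂ => s ^ 2 - 2 * Complex.I * s)
        (2 * (σ : ℂ) - 2 * Complex.I) (σ : ℂ) := by
      refine ((hasDerivAt_pow 2 (σ : ℂ)).sub
        ((hasDerivAt_id (σ : ℂ)).const_mul (2 * Complex.I))).congr_deriv ?_
      simp
    have h3 := (h1.mul (h2.cpow_const (c := ((1 / 2 : ℝ) : ℂ)) hb)).comp_ofReal
    refine h3.congr_deriv ?_
    have h4 : ((σ : ℂ) ^ 2 - 2 * Complex.I * σ) ^ ((1 / 2 : ℝ) : ℂ) =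
        ((σ : ℂ) ^ 2 - 2 * Complex.I * σ) * hankelWeight σ := by
      rw [hankelWeight]
      generalize (σ : ℂ) ^ 2 - 2 * Complex.I * σ = b at hb
      have h := Complex.cpow_add (x := b) 1 ((-(1 / 2) : ℝ) : ℂ) (Complex.slitPlane_ne_zero hb)
      rw [Complex.cpow_one] at h
      rw [← h]
      congr 1
      push_cast; norm_num
    have h5 : ((σ : ℂ) ^ 2 - 2 * Complex.I * σ) ^ (((1 / 2 : ℝ) : ℂ) - 1) = hankelWeight σ := by
      rw [hankelWeight]; congr 1; push_cast; norm_num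
    rw [h4, h5, hg']
    simp only [hankelIntegrand]
    push_cast
    linear_combination ((z : ℂ) * Complex.exp (-z * (σ - Complex.I)) * hankelWeight σ) *
      Complex.I_sq
  have hInt : IntegrableOn g' (Set.Ioi 0) :=
    (((integrableOn_hankelIntegrand 2 hz).const_mul _).sub (integrableOn_hankelIntegrand 1 hz)).add
      ((integrableOn_hankelIntegrand 0 hz).const_mul _) |>.neg
  have hg0 : g 0 = 0 := by simp [hg]
  have hcont : ContinuousWithinAt g (Set.Ici 0) 0 := by
    rw [ContinuousWithinAt, hg0]
    refine squeeze_zero_norm' (a := fun σ => Real.exp (-z * σ) * (σ * (σ + 2)) ^ (1 / 2 : ℝ)) ?_ ?_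
    · filter_upwards [self_mem_nhdsWithin] with σ hσ using hgn σ hσ
    · have : Continuous fun σ : ℝ => Real.exp (-z * σ) * (σ * (σ + 2)) ^ (1 / 2 : ℝ) := by
        refine Continuous.mul (by fun_prop) ?_
        exact Continuous.rpow_const (by fun_prop) (fun _ => Or.inr (by norm_num))
      have h := (this.tendsto 0).mono_left (nhdsWithin_le_nhds (s := Set.Ici 0))
      simpa using h
  have htop : Tendsto g atTop (𝓝 0) := by
    refine squeeze_zero_norm' (a := fun σ => Real.exp (-z * σ) * (σ ^ 1 + 2)) ?_ ?_
    · filter_upwards [eventually_ge_atTop 0] with σ hσ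
      refine (hgn σ hσ).trans ?_
      gcongr
      calc (σ * (σ + 2)) ^ (1 / 2 : ℝ) ≤ ((σ + 2) ^ 2) ^ (1 / 2 : ℝ) := by
            gcongr; nlinarith
        _ = σ ^ 1 + 2 := by
            rw [← Real.sqrt_eq_rpow, Real.sqrt_sq (by linarith), pow_one]
    · have h1 := Real.tendsto_pow_mul_exp_neg_atTop_nhds_zero
      have h2 : Tendsto (fun σ : ℝ => z * σ) atTop atTop := tendsto_id.const_mul_atTop hz
      have h3 := (((h1 1).comp h2).const_mul z⁻¹).add (((h1 0).comp h2).const_mul 2)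
      simp only [mul_zero, add_zero] at h3
      refine h3.congr fun σ => ?_
      simp only [Function.comp, pow_one, pow_zero]
      rw [neg_mul]
      field_simp
  have h := integral_Ioi_of_hasDerivAt_of_tendsto hcont hderiv hInt htop
  rw [hg0, hg', integral_neg, integral_add, integral_sub, integral_const_mul,
    integral_const_mul] at h
  · simp only [sub_zero, neg_eq_zero] at h
    exact h
  · exact (integrableOn_hankelIntegrand 2 hz).const_mul _
  · exact integrableOn_hankelIntegrand 1 hz
  · exact ((integrableOn_hankelIntegrand 2 hz).const_mul _).sub (integrableOn_hankelIntegrand 1 hz)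
  · exact (integrableOn_hankelIntegrand 0 hz).const_mul _

lemma integral_rpow_neg_half_mul_exp {z : ℝ} (hz : 0 < z) :
    ∫ σ in Set.Ioi (0 : ℝ), σ ^ (-(1 / 2) : ℝ) * Real.exp (-z * σ) =
      Real.Gamma (1 / 2) * z ^ (-(1 / 2) : ℝ) := by
  have h := Real.integral_rpow_mul_exp_neg_mul_Ioi (a := 1 / 2) (r := z) (by norm_num) hz
  rw [one_div z, Real.inv_rpow hz.le, ← Real.rpow_neg hz.le, mul_comm] at h
  rw [← h]
  refine setIntegral_congr_fun measurableSet_Ioi fun σ _ => ?_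
  norm_num

lemma integral_rpow_half_mul_exp {z : ℝ} (hz : 0 < z) :
    ∫ σ in Set.Ioi (0 : ℝ), σ ^ (1 / 2 : ℝ) * Real.exp (-z * σ) =
      Real.Gamma (3 / 2) * z ^ (-(3 / 2) : ℝ) := by
  have h := Real.integral_rpow_mul_exp_neg_mul_Ioi (a := 3 / 2) (r := z) (by norm_num) hz
  rw [one_div z, Real.inv_rpow hz.le, ← Real.rpow_neg hz.le, mul_comm] at h
  rw [← h]
  refine setIntegral_congr_fun measurableSet_Ioi fun σ _ => ?_
  norm_num

lemma norm_hankelMoment_zero_le {z : ℝ} (hz : 0 < z) :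
    ‖hankelMoment 0 z‖ ≤ Real.Gamma (1 / 2) * z ^ (-(1 / 2) : ℝ) := by
  rw [← integral_rpow_neg_half_mul_exp hz]
  refine norm_integral_le_of_norm_le (integrableOn_rpow_mul_exp (by norm_num) hz) ?_
  filter_upwards [ae_restrict_mem measurableSet_Ioi] with σ hσ
  refine (norm_hankelIntegrand_le 0 z hσ).trans (le_of_eq ?_)
  ring

/-- The outgoing radiation condition for the Hankel function. -/
lemma norm_hankelMoment_radiation_le {z : ℝ} (hz : 0 < z) :
    ‖hankelMoment 1 z + Complex.I * hankelMoment 0 z‖ ≤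
      Real.Gamma (3 / 2) * z ^ (-(3 / 2) : ℝ) := by
  rw [← integral_rpow_half_mul_exp hz, hankelMoment, hankelMoment, ← integral_const_mul,
    ← integral_add (integrableOn_hankelIntegrand 1 hz)
      ((integrableOn_hankelIntegrand 0 hz).const_mul _)]
  refine norm_integral_le_of_norm_le (integrableOn_rpow_mul_exp (by norm_num) hz) ?_
  filter_upwards [ae_restrict_mem measurableSet_Ioi] with σ hσ
  have hσ : 0 < σ := hσ
  -- The factor (σ - i) + i = σ gains a power of σ, hence a power of 1/z after integration.
  have h1 : hankelIntegrand 1 z σ + Complex.I * hankelIntegrand 0 z σ =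
      σ * Complex.exp (-z * (σ - Complex.I)) * hankelWeight σ := by
    simp only [hankelIntegrand]; ring
  rw [h1, norm_mul, norm_mul, norm_exp_neg_mul, Complex.norm_real, Real.norm_of_nonneg hσ.le]
  have h2 : σ ^ (1 / 2 : ℝ) = σ * σ ^ (-(1 / 2) : ℝ) := by
    conv_rhs => enter [1]; rw [← Real.rpow_one σ]
    rw [← Real.rpow_add hσ]; norm_num
  rw [h2]
  have h3 := norm_hankelWeight_le hσ
  calc σ * Real.exp (-z * σ) * ‖hankelWeight σ‖
      ≤ σ * Real.exp (-z * σ) * σ ^ (-(1 / 2) : ℝ) := by gcongr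
    _ = _ := by ring

/-- With N = |s - 2i| one has |s - i| ≤ N, so the product is at most √(N/s), and √N ≤ √s + 2. The
bound separates the limit at infinity from the integrable singularity at 0. -/
lemma norm_sub_I_mul_hankelWeight_le {s : ℝ} (hs : 0 < s) :
    ‖((s : ℂ) - Complex.I) * hankelWeight s‖ ≤ 1 + 2 * s ^ (-(1 / 2) : ℝ) := by
  set N := ‖(s : ℂ) - 2 * Complex.I‖ with hN
  have hN2 : 2 ≤ N := two_le_norm_sub s
  have hN3 : N ≤ s + 2 := by
    refine (norm_sub_le _ _).trans ?_
    simp [abs_of_pos hs]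
  have h1 : ‖(s : ℂ) - Complex.I‖ ≤ N := by
    rw [hN, Complex.norm_eq_sqrt_sq_add_sq, Complex.norm_eq_sqrt_sq_add_sq]
    apply Real.sqrt_le_sqrt
    norm_num
  rw [norm_mul, norm_hankelWeight hs, ← hN]
  have h2 : (s * N) ^ (-(1 / 2) : ℝ) = (√s * √N)⁻¹ := by
    rw [Real.rpow_neg (by positivity), ← Real.sqrt_eq_rpow, Real.sqrt_mul hs.le]
  have h3 : s ^ (-(1 / 2) : ℝ) = (√s)⁻¹ := by
    rw [Real.rpow_neg hs.le, ← Real.sqrt_eq_rpow]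
  rw [h2, h3]
  have hs' : 0 < √s := Real.sqrt_pos.2 hs
  have hN' : 0 < √N := Real.sqrt_pos.2 (by linarith)
  have h4 : √N ≤ √s + 2 := by
    rw [Real.sqrt_le_left (by positivity)]
    nlinarith [Real.sq_sqrt hs.le]
  calc ‖(s : ℂ) - Complex.I‖ * (√s * √N)⁻¹ ≤ N * (√s * √N)⁻¹ := by gcongr
    _ = √N * (√s)⁻¹ := by
        nth_rewrite 1 [← Real.mul_self_sqrt (show 0 ≤ N by linarith)]
        field_simp
    _ ≤ (√s + 2) * (√s)⁻¹ := by gcongr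
    _ = _ := by field_simp

/-- A positive factor leaves the argument unchanged, so the principal branch stays multiplicative.
-/
lemma ofReal_mul_cpow {a : ℝ} (ha : 0 < a) {x : ℂ} (hx : x ≠ 0) (c : ℂ) :
    ((a : ℂ) * x) ^ c = (a : ℂ) ^ c * x ^ c := by
  have ha' : (a : ℂ) ≠ 0 := by exact_mod_cast ha.ne'
  rw [Complex.cpow_def_of_ne_zero (mul_ne_zero ha' hx), Complex.cpow_def_of_ne_zero ha',
    Complex.cpow_def_of_ne_zero hx, Complex.log_ofReal_mul ha hx, ← Complex.exp_add,
    Complex.ofReal_log ha.le]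
  ring_nf

lemma tendsto_sub_I_mul_hankelWeight :
    Tendsto (fun s : ℝ => ((s : ℂ) - Complex.I) * hankelWeight s) atTop (𝓝 1) := by
  have hinv : Tendsto (fun s : ℝ => ((s⁻¹ : ℝ) : ℂ)) atTop (𝓝 0) := by
    have := (Complex.continuous_ofReal.tendsto 0).comp (tendsto_inv_atTop_zero (𝕜 := ℝ))
    rw [Complex.ofReal_zero] at this
    exact this
  have h1 : Tendsto (fun s : ℝ => (1 - Complex.I * ((s⁻¹ : ℝ) : ℂ)) *
      (1 - 2 * Complex.I * ((s⁻¹ : ℝ) : ℂ)) ^ ((-(1 / 2) : ℝ) : ℂ)) atTop (𝓝 1) := by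
    have hc : ContinuousAt (fun u : ℂ => (1 - Complex.I * u) *
        (1 - 2 * Complex.I * u) ^ ((-(1 / 2) : ℝ) : ℂ)) 0 := by
      refine ContinuousAt.mul (by fun_prop) (ContinuousAt.cpow (by fun_prop) (by fun_prop) ?_)
      simp
    have := hc.tendsto.comp hinv
    simp only [mul_zero, sub_zero, Complex.one_cpow, mul_one] at this
    exact this
  refine h1.congr' ?_
  filter_upwards [eventually_gt_atTop 0] with s hs
  have hs0 : (s : ℂ) ≠ 0 := by exact_mod_cast hs.ne'
  have h2 : (s : ℂ) ^ 2 - 2 * Complex.I * s =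
      ((s ^ 2 : ℝ) : ℂ) * (1 - 2 * Complex.I * ((s⁻¹ : ℝ) : ℂ)) := by
    push_cast; field_simp
  have h3 : ((s ^ 2 : ℝ) : ℂ) ^ ((-(1 / 2) : ℝ) : ℂ) = (s : ℂ)⁻¹ := by
    rw [← Complex.ofReal_cpow (by positivity), ← Complex.ofReal_inv]
    congr 1
    rw [Real.rpow_neg (by positivity), ← Real.sqrt_eq_rpow, Real.sqrt_sq hs.le]
  have h5 : 1 - 2 * Complex.I * ((s⁻¹ : ℝ) : ℂ) ≠ 0 := fun h => by
    have := congrArg Complex.re h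
    simp at this
  have h4 : hankelWeight s = (s : ℂ)⁻¹ *
      (1 - 2 * Complex.I * ((s⁻¹ : ℝ) : ℂ)) ^ ((-(1 / 2) : ℝ) : ℂ) := by
    rw [hankelWeight, h2, ofReal_mul_cpow (by positivity) h5, h3]
  rw [h4]
  push_cast
  field_simp

/-- The substitution τ = zσ has a Jacobian that absorbs the factor z, and it moves z out of the
decaying exponential. Small z then means large arguments of a function tending to 1. -/
lemma mul_hankelMoment_one {z : ℝ} (hz : 0 < z) :
    z * hankelMoment 1 z = Complex.exp (Complex.I * z) * ∫ τ in Set.Ioi (0 : ℝ),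
      (((τ / z : ℝ) : ℂ) - Complex.I) * hankelWeight (τ / z) * Real.exp (-τ) := by
  set G : ℝ → ℂ := fun τ =>
    (((τ / z : ℝ) : ℂ) - Complex.I) * hankelWeight (τ / z) * Real.exp (-τ) with hG
  have h := integral_comp_mul_left_Ioi G 0 hz
  rw [mul_zero] at h
  have h2 : hankelMoment 1 z = Complex.exp (Complex.I * z) * ∫ x in Set.Ioi (0 : ℝ), G (z * x) := by
    rw [hankelMoment, ← integral_const_mul]
    refine setIntegral_congr_fun measurableSet_Ioi fun σ _ => ?_
    simp only [hG, hankelIntegrand, pow_one]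
    rw [mul_div_cancel_left₀ _ hz.ne',
      show (-(z : ℂ) * (σ - Complex.I)) = Complex.I * z + ((-(z * σ) : ℝ) : ℂ) by push_cast; ring,
      Complex.exp_add, Complex.ofReal_exp]
    ring
  rw [h2, h, Complex.real_smul]
  have : (z : ℂ) ≠ 0 := by exact_mod_cast hz.ne'
  push_cast
  field_simp

lemma norm_scaled_hankelIntegrand_le {z τ : ℝ} (hz : 0 < z) (hτ : 0 < τ) :
    ‖(((τ / z : ℝ) : ℂ) - Complex.I) * hankelWeight (τ / z) * Real.exp (-τ)‖ ≤
      Real.exp (-τ) + 2 * √z * (τ ^ (-(1 / 2) : ℝ) * Real.exp (-1 * τ)) := by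
  rw [norm_mul, Complex.norm_real, Real.norm_of_nonneg (Real.exp_pos _).le]
  have h := norm_sub_I_mul_hankelWeight_le (div_pos hτ hz)
  have h2 : (τ / z) ^ (-(1 / 2) : ℝ) = √z * τ ^ (-(1 / 2) : ℝ) := by
    rw [Real.div_rpow hτ.le hz.le, Real.rpow_neg hz.le, ← Real.sqrt_eq_rpow, div_inv_eq_mul,
      mul_comm]
  rw [h2] at h
  calc _ ≤ (1 + 2 * (√z * τ ^ (-(1 / 2) : ℝ))) * Real.exp (-τ) := by gcongr
    _ = _ := by rw [neg_one_mul]; ring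

/-- The derivative of the Hankel function behaves like `1/z` up to a factor `1 + √z`. -/
lemma exists_norm_mul_hankelMoment_one_le :
    ∃ K : ℝ, 0 < K ∧ ∀ z : ℝ, 0 < z → ‖z * hankelMoment 1 z‖ ≤ K * (1 + √z) := by
  refine ⟨1 + 2 * Real.Gamma (1 / 2), by have := Real.Gamma_pos_of_pos (s := 1 / 2) (by norm_num)
                                         positivity, fun z hz => ?_⟩
  have hΓ := Real.Gamma_pos_of_pos (s := 1 / 2) (by norm_num)
  have hI := integrableOn_rpow_mul_exp (s := -(1 / 2)) (z := 1) (by norm_num) one_pos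
  have h := norm_integral_le_of_norm_le (μ := volume.restrict (Set.Ioi (0 : ℝ)))
    (f := fun τ : ℝ => (((τ / z : ℝ) : ℂ) - Complex.I) * hankelWeight (τ / z) * Real.exp (-τ))
    (g := fun τ => Real.exp (-τ) + 2 * √z * (τ ^ (-(1 / 2) : ℝ) * Real.exp (-1 * τ)))
    ((integrableOn_exp_neg_Ioi 0).add (hI.const_mul _))
    (by filter_upwards [ae_restrict_mem measurableSet_Ioi] with τ hτ
        exact norm_scaled_hankelIntegrand_le hz hτ)
  rw [integral_add (integrableOn_exp_neg_Ioi 0) (hI.const_mul _), integral_const_mul,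
    integral_rpow_neg_half_mul_exp one_pos, integral_exp_neg_Ioi_zero, Real.one_rpow, mul_one] at h
  rw [mul_hankelMoment_one hz, norm_mul, mul_comm Complex.I, Complex.norm_exp_ofReal_mul_I, one_mul]
  refine h.trans ?_
  nlinarith [Real.sqrt_nonneg z]

/-- Dominated convergence reduces the rescaled integral to ∫ e^{-τ} = 1. This normalization of the
logarithmic singularity fixes the constant π in the representation formula and the sign used in the
lower bound for the real part. -/
lemma tendsto_mul_hankelMoment_one :
    Tendsto (fun z : ℝ => z * hankelMoment 1 z) (𝓝[>] 0) (𝓝 1) := by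
  have hI := integrableOn_rpow_mul_exp (s := -(1 / 2)) (z := 1) (by norm_num) one_pos
  have h1 : Tendsto (fun z : ℝ => ∫ τ in Set.Ioi (0 : ℝ),
      (((τ / z : ℝ) : ℂ) - Complex.I) * hankelWeight (τ / z) * Real.exp (-τ)) (𝓝[>] 0)
      (𝓝 (∫ τ in Set.Ioi (0 : ℝ), ((Real.exp (-τ) : ℝ) : ℂ))) := by
    refine tendsto_integral_filter_of_dominated_convergence
      (fun τ => Real.exp (-τ) + 2 * (τ ^ (-(1 / 2) : ℝ) * Real.exp (-1 * τ))) ?_ ?_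
      ((integrableOn_exp_neg_Ioi 0).add (hI.const_mul _)) ?_
    · refine Eventually.of_forall fun z => Measurable.aestronglyMeasurable ?_
      have := measurable_hankelWeight
      fun_prop
    · filter_upwards [Ioo_mem_nhdsGT (zero_lt_one' ℝ)] with z hz
      filter_upwards [ae_restrict_mem measurableSet_Ioi] with τ hτ
      refine (norm_scaled_hankelIntegrand_le hz.1 hτ).trans ?_
      have hτ : (0 : ℝ) < τ := hτ
      have : √z ≤ 1 := Real.sqrt_le_one.2 hz.2.le
      have : 2 * √z ≤ 2 := by linarith
      gcongr
    · filter_upwards [ae_restrict_mem measurableSet_Ioi] with τ hτ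
      have hτ : (0 : ℝ) < τ := hτ
      have h2 : Tendsto (fun z : ℝ => τ / z) (𝓝[>] 0) atTop := by
        simp_rw [div_eq_mul_inv]
        exact tendsto_inv_nhdsGT_zero.const_mul_atTop hτ
      have h3 := (tendsto_sub_I_mul_hankelWeight.comp h2).mul_const ((Real.exp (-τ) : ℝ) : ℂ)
      rw [one_mul] at h3
      exact h3
  rw [integral_complex_ofReal, integral_exp_neg_Ioi_zero] at h1
  have h2 : Tendsto (fun z : ℝ => Complex.exp (Complex.I * z)) (𝓝[>] 0) (𝓝 1) := by
    have : Continuous fun z : ℝ => Complex.exp (Complex.I * z) := by fun_prop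
    have := (this.tendsto 0).mono_left (nhdsWithin_le_nhds (s := Set.Ioi 0))
    simpa using this
  have h3 := h2.mul h1
  simp only [Complex.ofReal_one, mul_one] at h3
  refine h3.congr' ?_
  filter_upwards [self_mem_nhdsWithin] with z hz
  exact (mul_hankelMoment_one hz).symm

/-- The Hankel function is bounded below in real part near `0`. -/
lemma exists_re_hankelMoment_zero_ge :
    ∃ z₀ C : ℝ, 0 < z₀ ∧ 0 < C ∧ ∀ z ∈ Set.Ioo 0 z₀, -C ≤ (hankelMoment 0 z).re := by
  have h1 : Tendsto (fun z : ℝ => (z * hankelMoment 1 z).re) (𝓝[>] 0) (𝓝 1) :=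
    (Complex.continuous_re.tendsto 1).comp tendsto_mul_hankelMoment_one
  have h2 := h1.eventually (lt_mem_nhds (zero_lt_one' ℝ))
  obtain ⟨z₁, hz₁, h3⟩ := (mem_nhdsGT_iff_exists_Ioo_subset (a := (0 : ℝ))).1 h2
  have hz₁ : 0 < z₁ := hz₁
  refine ⟨z₁ / 2, |(hankelMoment 0 (z₁ / 2)).re| + 1, by linarith, by positivity, fun z hz => ?_⟩
  have hd : ∀ x ∈ Set.Ioo 0 z₁,
      HasDerivAt (fun x => (hankelMoment 0 x).re) (-(hankelMoment 1 x).re) x := fun x hx => by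
    have := Complex.reCLM.hasFDerivAt.comp_hasDerivAt x (hasDerivAt_hankelMoment 0 hx.1)
    exact this
  -- Near 0 the real part of x · `hankelMoment 1 x` is positive, so the real part of the zeroth
  -- moment decreases, and its value at z₁/2 bounds it below on the left.
  have h4 : AntitoneOn (fun x => (hankelMoment 0 x).re) (Set.Ioo 0 z₁) := by
    refine antitoneOn_of_deriv_nonpos (convex_Ioo _ _)
      (fun x hx => (hd x hx).continuousAt.continuousWithinAt) ?_ ?_
    · rw [interior_Ioo]
      exact fun x hx => (hd x hx).differentiableAt.differentiableWithinAt
    · rw [interior_Ioo]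
      intro x hx
      rw [(hd x hx).deriv]
      have h5 : 0 < ((x : ℂ) * hankelMoment 1 x).re := h3 hx
      rw [Complex.re_ofReal_mul] at h5
      have := (mul_pos_iff_of_pos_left hx.1).1 h5
      linarith
  have h6 := h4 ⟨hz.1, by linarith [hz.2]⟩ ⟨by linarith, by linarith⟩ hz.2.le
  have h7 := neg_abs_le (hankelMoment 0 (z₁ / 2)).re
  simp only at h6
  linarith

/-- The Hankel function has at most a logarithmic singularity at `0`. -/
lemma exists_norm_hankelMoment_zero_le_log :
    ∃ C K : ℝ, 0 < C ∧ 0 < K ∧ ∀ z ∈ Set.Ioc (0 : ℝ) 1,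
      ‖hankelMoment 0 z‖ ≤ C - K * Real.log z := by
  obtain ⟨K, hK, h⟩ := exists_norm_mul_hankelMoment_one_le
  refine ⟨‖hankelMoment 0 1‖ + 1, K * 2, by positivity, by positivity, fun z hz => ?_⟩
  have h1 : hankelMoment 0 z = hankelMoment 0 1 + ∫ x in z..1, hankelMoment 1 x := by
    have := intervalIntegral.integral_eq_sub_of_hasDerivAt (a := z) (b := 1)
      (f := hankelMoment 0) (f' := fun x => -hankelMoment 1 x)
      (fun x hx => hasDerivAt_hankelMoment 0 (by
        rw [Set.uIcc_of_le hz.2] at hx; exact hz.1.trans_le hx.1))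
      (ContinuousOn.intervalIntegrable (by
        rw [Set.uIcc_of_le hz.2]
        exact ((continuousOn_hankelMoment 1).mono fun x hx => hz.1.trans_le hx.1).neg))
    rw [intervalIntegral.integral_neg] at this
    linear_combination this
  -- The factor 2 bounds 1 + √x for x ≤ 1.
  have h2 : ‖∫ x in z..1, hankelMoment 1 x‖ ≤ ∫ x in z..1, (K * 2) * x⁻¹ := by
    refine intervalIntegral.norm_integral_le_of_norm_le hz.2 ?_ ?_
    · refine Eventually.of_forall fun x hx => ?_
      have hx0 : 0 < x := hz.1.trans hx.1
      have h3 := h x hx0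
      rw [norm_mul, Complex.norm_real, Real.norm_of_nonneg hx0.le] at h3
      have : √x ≤ 1 := Real.sqrt_le_one.2 hx.2
      rw [← div_eq_mul_inv, le_div_iff₀ hx0]
      nlinarith
    · refine (ContinuousOn.intervalIntegrable ?_)
      rw [Set.uIcc_of_le hz.2]
      exact ContinuousOn.mul continuousOn_const
        (continuousOn_id.inv₀ fun x hx => (hz.1.trans_le hx.1).ne')
  rw [intervalIntegral.integral_const_mul, integral_inv_of_pos hz.1 one_pos, one_div,
    Real.log_inv] at h2
  rw [h1]
  have := norm_add_le (hankelMoment 0 1) (∫ x in z..1, hankelMoment 1 x)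
  linarith

/-! ### Partial derivatives in product coordinates and Green's identity -/

/-- The open upper half-plane in product coordinates. -/
def upperProd : Set (ℝ × ℝ) := {p | 0 < p.2}

/-- The partial derivative in the first coordinate. -/
def dFst (f : ℝ × ℝ → ℂ) (p : ℝ × ℝ) : ℂ := fderiv ℝ f p (1, 0)

/-- The partial derivative in the second coordinate. -/
def dSnd (f : ℝ × ℝ → ℂ) (p : ℝ × ℝ) : ℂ := fderiv ℝ f p (0, 1)

lemma isOpen_upperProd : IsOpen upperProd := isOpen_lt continuous_const continuous_snd

lemma dFst_eq_of_hasDerivAt {f : ℝ × ℝ → ℂ} {p : ℝ × ℝ} {a : ℂ} (hf : DifferentiableAt ℝ f p)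
    (h : HasDerivAt (fun s => f (s, p.2)) a p.1) : dFst f p = a := by
  have h1 : HasDerivAt (fun s : ℝ => (s, p.2)) ((1 : ℝ), (0 : ℝ)) p.1 :=
    (hasDerivAt_id p.1).prodMk (hasDerivAt_const p.1 p.2)
  have h2 : HasDerivAt (fun s => f (s, p.2)) (fderiv ℝ f p (1, 0)) p.1 :=
    HasFDerivAt.comp_hasDerivAt (f := fun s : ℝ => (s, p.2)) p.1 hf.hasFDerivAt h1
  exact h2.unique h

lemma dSnd_eq_of_hasDerivAt {f : ℝ × ℝ → ℂ} {p : ℝ × ℝ} {a : ℂ} (hf : DifferentiableAt ℝ f p)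
    (h : HasDerivAt (fun t => f (p.1, t)) a p.2) : dSnd f p = a := by
  have h1 : HasDerivAt (fun t : ℝ => (p.1, t)) ((0 : ℝ), (1 : ℝ)) p.2 :=
    (hasDerivAt_const p.2 p.1).prodMk (hasDerivAt_id p.2)
  have h2 : HasDerivAt (fun t => f (p.1, t)) (fderiv ℝ f p (0, 1)) p.2 :=
    HasFDerivAt.comp_hasDerivAt (f := fun t : ℝ => (p.1, t)) p.2 hf.hasFDerivAt h1
  exact h2.unique h

lemma dFst_mul {f g : ℝ × ℝ → ℂ} {p : ℝ × ℝ} (hf : DifferentiableAt ℝ f p)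
    (hg : DifferentiableAt ℝ g p) :
    dFst (fun q => f q * g q) p = f p * dFst g p + dFst f p * g p := by
  simp only [dFst]
  rw [fderiv_fun_mul hf hg]
  simp [mul_comm]

lemma dSnd_mul {f g : ℝ × ℝ → ℂ} {p : ℝ × ℝ} (hf : DifferentiableAt ℝ f p)
    (hg : DifferentiableAt ℝ g p) :
    dSnd (fun q => f q * g q) p = f p * dSnd g p + dSnd f p * g p := by
  simp only [dSnd]
  rw [fderiv_fun_mul hf hg]
  simp [mul_comm]

lemma dFst_sub {f g : ℝ × ℝ → ℂ} {p : ℝ × ℝ} (hf : DifferentiableAt ℝ f p)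
    (hg : DifferentiableAt ℝ g p) :
    dFst (fun q => f q - g q) p = dFst f p - dFst g p := by
  simp only [dFst]
  rw [fderiv_fun_sub hf hg]
  simp

lemma dSnd_sub {f g : ℝ × ℝ → ℂ} {p : ℝ × ℝ} (hf : DifferentiableAt ℝ f p)
    (hg : DifferentiableAt ℝ g p) :
    dSnd (fun q => f q - g q) p = dSnd f p - dSnd g p := by
  simp only [dSnd]
  rw [fderiv_fun_sub hf hg]
  simp

lemma contDiffOn_dFst {f : ℝ × ℝ → ℂ} {m n : ℕ∞} (hf : ContDiffOn ℝ n f upperProd)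
    (hmn : m + 1 ≤ n) : ContDiffOn ℝ m (dFst f) upperProd :=
  (hf.fderiv_of_isOpen isOpen_upperProd (by exact_mod_cast hmn)).clm_apply contDiffOn_const

lemma contDiffOn_dSnd {f : ℝ × ℝ → ℂ} {m n : ℕ∞} (hf : ContDiffOn ℝ n f upperProd)
    (hmn : m + 1 ≤ n) : ContDiffOn ℝ m (dSnd f) upperProd :=
  (hf.fderiv_of_isOpen isOpen_upperProd (by exact_mod_cast hmn)).clm_apply contDiffOn_const

lemma differentiableAt_upperProd {f : ℝ × ℝ → ℂ} {n : ℕ∞} (hf : ContDiffOn ℝ n f upperProd)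
    (hn : 1 ≤ n) {p : ℝ × ℝ} (hp : p ∈ upperProd) : DifferentiableAt ℝ f p :=
  (hf.contDiffAt (isOpen_upperProd.mem_nhds hp)).differentiableAt
    (by have : n ≠ 0 := by rintro rfl; simp at hn
        exact_mod_cast this)

/-- Green's second identity in `{x₂ > h}` for two solutions of the Helmholtz equation, localized
by a compactly supported function `χ`. -/
lemma green_identity {f g χ : ℝ × ℝ → ℂ} {k : ℂ} (hf : ContDiffOn ℝ (2 : ℕ∞) f upperProd)
    (hg : ContDiffOn ℝ (2 : ℕ∞) g upperProd) (hχ : ContDiffOn ℝ (1 : ℕ∞) χ upperProd)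
    (hfk : ∀ p ∈ upperProd, dFst (dFst f) p + dSnd (dSnd f) p + k * f p = 0)
    (hgk : ∀ p ∈ upperProd, dFst (dFst g) p + dSnd (dSnd g) p + k * g p = 0)
    {A h : ℝ} (hh : 0 < h) (hA : h ≤ A)
    (hχA : ∀ p : ℝ × ℝ, p.1 = -A ∨ p.1 = A ∨ p.2 = A → χ p = 0) :
    ∫ s in (-A)..A, χ (s, h) * (g (s, h) * dSnd f (s, h) - f (s, h) * dSnd g (s, h)) =
      -∫ p in Set.Icc ((-A, h) : ℝ × ℝ) (A, A),
        (dFst χ p * (g p * dFst f p - f p * dFst g p) +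
          dSnd χ p * (g p * dSnd f p - f p * dSnd g p)) := by
  have hsub : Set.Icc ((-A, h) : ℝ × ℝ) (A, A) ⊆ upperProd := fun p hp => hh.trans_le hp.1.2
  have hf1 : ContDiffOn ℝ (1 : ℕ∞) (dFst f) upperProd := contDiffOn_dFst hf le_rfl
  have hf2 : ContDiffOn ℝ (1 : ℕ∞) (dSnd f) upperProd := contDiffOn_dSnd hf le_rfl
  have hg1 : ContDiffOn ℝ (1 : ℕ∞) (dFst g) upperProd := contDiffOn_dFst hg le_rfl
  have hg2 : ContDiffOn ℝ (1 : ℕ∞) (dSnd g) upperProd := contDiffOn_dSnd hg le_rfl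
  have hf' : ContDiffOn ℝ (1 : ℕ∞) f upperProd := hf.of_le (by norm_cast)
  have hg' : ContDiffOn ℝ (1 : ℕ∞) g upperProd := hg.of_le (by norm_cast)
  set F : ℝ × ℝ → ℂ := fun p => χ p * (g p * dFst f p - f p * dFst g p) with hF
  set G : ℝ × ℝ → ℂ := fun p => χ p * (g p * dSnd f p - f p * dSnd g p) with hG
  have hFc : ContDiffOn ℝ (1 : ℕ∞) F upperProd :=
    hχ.mul ((hg'.mul hf1).sub (hf'.mul hg1))
  have hGc : ContDiffOn ℝ (1 : ℕ∞) G upperProd :=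
    hχ.mul ((hg'.mul hf2).sub (hf'.mul hg2))
  -- The terms with undifferentiated χ cancel because f and g solve the same Helmholtz equation;
  -- only derivatives of χ survive.
  have hdiv : ∀ p ∈ upperProd, fderiv ℝ F p (1, 0) + fderiv ℝ G p (0, 1) =
      dFst χ p * (g p * dFst f p - f p * dFst g p) +
          dSnd χ p * (g p * dSnd f p - f p * dSnd g p) := by
    intro p hp
    have e1 := differentiableAt_upperProd hf' le_rfl hp
    have e2 := differentiableAt_upperProd hg' le_rfl hp
    have e3 := differentiableAt_upperProd hf1 le_rfl hp
    have e4 := differentiableAt_upperProd hf2 le_rfl hp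
    have e5 := differentiableAt_upperProd hg1 le_rfl hp
    have e6 := differentiableAt_upperProd hg2 le_rfl hp
    have e7 := differentiableAt_upperProd hχ le_rfl hp
    have h1 : dFst F p = _ := dFst_mul e7 ((e2.mul e3).sub (e1.mul e5))
    have h2 : dSnd G p = _ := dSnd_mul e7 ((e2.mul e4).sub (e1.mul e6))
    have h3 := dFst_sub (e2.fun_mul e3) (e1.fun_mul e5)
    have h4 := dSnd_sub (e2.fun_mul e4) (e1.fun_mul e6)
    rw [dFst_mul e2 e3, dFst_mul e1 e5] at h3
    rw [dSnd_mul e2 e4, dSnd_mul e1 e6] at h4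
    change dFst F p + dSnd G p = _
    rw [h1, h2]
    erw [h3, h4]
    linear_combination (χ p * g p) * hfk p hp - (χ p * f p) * hgk p hp
  have hInt : IntegrableOn (fun p => fderiv ℝ F p (1, 0) + fderiv ℝ G p (0, 1))
      (Set.Icc ((-A, h) : ℝ × ℝ) (A, A)) := by
    refine ContinuousOn.integrableOn_compact isCompact_Icc (ContinuousOn.mono ?_ hsub)
    exact (contDiffOn_dFst (m := 0) hFc le_rfl).continuousOn.add
      (contDiffOn_dSnd (m := 0) hGc le_rfl).continuousOn
  have hle : ((-A, h) : ℝ × ℝ) ≤ (A, A) := ⟨by simp; linarith, hA⟩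
  have key := integral_divergence_prod_Icc_of_hasFDerivAt_of_le F G (fderiv ℝ F) (fderiv ℝ G)
    (-A, h) (A, A) hle (hFc.continuousOn.mono hsub) (hGc.continuousOn.mono hsub)
    (fun p hp => (differentiableAt_upperProd hFc le_rfl (hh.trans hp.2.1)).hasFDerivAt)
    (fun p hp => (differentiableAt_upperProd hGc le_rfl (hh.trans hp.2.1)).hasFDerivAt) hInt
  -- The cutoff kills three sides of the rectangle, leaving only the bottom edge.
  have z1 : ∀ x : ℝ, G (x, A) = 0 := fun x => by simp [hG, hχA (x, A) (by simp)]
  have z2 : ∀ x : ℝ, F (A, x) = 0 := fun x => by simp [hF, hχA (A, x) (by simp)]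
  have z3 : ∀ x : ℝ, F (-A, x) = 0 := fun x => by simp [hF, hχA (-A, x) (by simp)]
  simp only [z1, z2, z3, intervalIntegral.integral_zero, add_zero, sub_zero, zero_sub] at key
  rw [setIntegral_congr_fun measurableSet_Icc fun p hp => hdiv p (hsub hp)] at key
  rw [key, neg_neg]

/-! ### The cylindrical wave: Helmholtz equation and far field -/

/-- The squared distance of a point to the boundary point `(y, 0)`. -/
def distSq (y : ℝ) (p : ℝ × ℝ) : ℝ := (p.1 - y) ^ 2 + p.2 ^ 2

/-- The radiating cylindrical wave centred at `(y, 0)`. -/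
def hankelWave (κ y : ℝ) (p : ℝ × ℝ) : ℂ := hankelMoment 0 (κ * √(distSq y p))

/-- The derivative of `q ↦ hankelMoment 0 (κ √q)`. -/
def hankelSlope (κ q : ℝ) : ℂ := -((κ / (2 * √q) : ℝ) : ℂ) * hankelMoment 1 (κ * √q)

lemma distSq_pos {y : ℝ} {p : ℝ × ℝ} (hp : p ∈ upperProd) : 0 < distSq y p := by
  have : 0 < p.2 := hp
  unfold distSq
  positivity

lemma hasDerivAt_hankelMoment_mul_sqrt (k : ℕ) {κ q : ℝ} (hκ : 0 < κ) (hq : 0 < q) :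
    HasDerivAt (fun q => hankelMoment k (κ * √q))
      (-((κ / (2 * √q) : ℝ) : ℂ) * hankelMoment (k + 1) (κ * √q)) q := by
  have h1 : HasDerivAt (fun q => κ * √q) (κ * (1 / (2 * √q))) q :=
    (Real.hasDerivAt_sqrt hq.ne').const_mul κ
  have h2 := (hasDerivAt_hankelMoment k (z := κ * √q) (by positivity)).scomp q h1
  refine h2.congr_deriv ?_
  rw [Complex.real_smul]
  push_cast
  ring

lemma hasDerivAt_hankelSlope {κ q : ℝ} (hκ : 0 < κ) (hq : 0 < q) :
    HasDerivAt (hankelSlope κ) (((κ / (4 * q * √q) : ℝ) : ℂ) * hankelMoment 1 (κ * √q) +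
      ((κ ^ 2 / (4 * q) : ℝ) : ℂ) * hankelMoment 2 (κ * √q)) q := by
  have hs : 0 < √q := Real.sqrt_pos.2 hq
  have h1 : HasDerivAt (fun q => κ / (2 * √q)) (-κ / (4 * q * √q)) q := by
    refine ((hasDerivAt_const q κ).div ((Real.hasDerivAt_sqrt hq.ne').const_mul 2)
      (by positivity)).congr_deriv ?_
    field_simp
    rw [Real.sq_sqrt hq.le]
    ring
  have h2 := (h1.ofReal_comp.neg).mul (hasDerivAt_hankelMoment_mul_sqrt 1 hκ hq)
  refine h2.congr_deriv ?_
  have h3 : ((κ ^ 2 / (4 * q) : ℝ) : ℂ) = ((κ / (2 * √q) : ℝ) : ℂ) * ((κ / (2 * √q) : ℝ) : ℂ) := by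
    rw [← Complex.ofReal_mul]
    congr 1
    field_simp
    rw [Real.sq_sqrt hq.le]
    ring
  rw [h3, neg_div, Pi.neg_apply]
  push_cast
  ring

lemma contDiffOn_hankelWave {κ : ℝ} (hκ : 0 < κ) (y : ℝ) (n : ℕ) :
    ContDiffOn ℝ n (hankelWave κ y) upperProd := by
  refine (contDiffOn_hankelMoment n 0).comp (f := fun p => κ * √(distSq y p)) ?_ ?_
  · refine contDiffOn_const.mul (ContDiffOn.sqrt ?_ fun p hp => (distSq_pos hp).ne')
    unfold distSq
    fun_prop
  · intro p hp
    have := distSq_pos (y := y) hp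
    exact Set.mem_Ioi.2 (by positivity)

lemma hasDerivAt_distSq_fst (y : ℝ) (p : ℝ × ℝ) :
    HasDerivAt (fun s => distSq y (s, p.2)) (2 * (p.1 - y)) p.1 := by
  unfold distSq
  refine ((((hasDerivAt_id p.1).sub_const y).pow 2).add_const (p.2 ^ 2)).congr_deriv ?_
  simp

lemma hasDerivAt_distSq_snd (y : ℝ) (p : ℝ × ℝ) :
    HasDerivAt (fun t => distSq y (p.1, t)) (2 * p.2) p.2 := by
  unfold distSq
  refine (((hasDerivAt_id p.2).pow 2).const_add ((p.1 - y) ^ 2)).congr_deriv ?_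
  simp

lemma dFst_hankelWave {κ : ℝ} (hκ : 0 < κ) (y : ℝ) {p : ℝ × ℝ} (hp : p ∈ upperProd) :
    dFst (hankelWave κ y) p = ((2 * (p.1 - y) : ℝ) : ℂ) * hankelSlope κ (distSq y p) := by
  have hd := differentiableAt_upperProd (n := 1) (contDiffOn_hankelWave hκ y 1) le_rfl hp
  refine dFst_eq_of_hasDerivAt hd ?_
  have h := (hasDerivAt_hankelMoment_mul_sqrt 0 hκ (distSq_pos (y := y) hp)).scomp p.1
    (hasDerivAt_distSq_fst y p)
  rw [Complex.real_smul] at h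
  exact h

lemma dSnd_hankelWave {κ : ℝ} (hκ : 0 < κ) (y : ℝ) {p : ℝ × ℝ} (hp : p ∈ upperProd) :
    dSnd (hankelWave κ y) p = ((2 * p.2 : ℝ) : ℂ) * hankelSlope κ (distSq y p) := by
  have hd := differentiableAt_upperProd (n := 1) (contDiffOn_hankelWave hκ y 1) le_rfl hp
  refine dSnd_eq_of_hasDerivAt hd ?_
  have h := (hasDerivAt_hankelMoment_mul_sqrt 0 hκ (distSq_pos (y := y) hp)).scomp p.2
    (hasDerivAt_distSq_snd y p)
  rw [Complex.real_smul] at h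
  exact h

/-- For a function F of the squared distance q the planar Laplacian is 4F' + 4qF''. Inserting the
derivatives of the moments leaves a multiple of the Bessel equation. -/
lemma hankelWave_helmholtz {κ : ℝ} (hκ : 0 < κ) (y : ℝ) {p : ℝ × ℝ} (hp : p ∈ upperProd) :
    dFst (dFst (hankelWave κ y)) p + dSnd (dSnd (hankelWave κ y)) p +
      (κ : ℂ) ^ 2 * hankelWave κ y p = 0 := by
  have hq := distSq_pos (y := y) hp
  have hE := contDiffOn_hankelWave hκ y 2
  have hS := hasDerivAt_hankelSlope hκ hq
  set S' := ((κ / (4 * distSq y p * √(distSq y p)) : ℝ) : ℂ) * hankelMoment 1 (κ * √(distSq y p)) +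
      ((κ ^ 2 / (4 * distSq y p) : ℝ) : ℂ) * hankelMoment 2 (κ * √(distSq y p)) with hS'
  have h1 : dFst (dFst (hankelWave κ y)) p = ((2 : ℝ) : ℂ) * hankelSlope κ (distSq y p) +
      ((2 * (p.1 - y) : ℝ) : ℂ) * (((2 * (p.1 - y) : ℝ) : ℂ) * S') := by
    refine dFst_eq_of_hasDerivAt (differentiableAt_upperProd
      (contDiffOn_dFst (m := 1) (n := 2) hE le_rfl) le_rfl hp) ?_
    have e1 := hS.scomp p.1 (hasDerivAt_distSq_fst y p)
    rw [Complex.real_smul] at e1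
    have e2 : HasDerivAt (fun s : ℝ => 2 * (s - y)) 2 p.1 := by
      simpa using ((hasDerivAt_id p.1).sub_const y).const_mul 2
    refine (e2.ofReal_comp.mul e1).congr_of_eventuallyEq (Eventually.of_forall fun s => ?_)
    exact dFst_hankelWave hκ y (p := (s, p.2)) hp
  have h2 : dSnd (dSnd (hankelWave κ y)) p = ((2 : ℝ) : ℂ) * hankelSlope κ (distSq y p) +
      ((2 * p.2 : ℝ) : ℂ) * (((2 * p.2 : ℝ) : ℂ) * S') := by
    refine dSnd_eq_of_hasDerivAt (differentiableAt_upperProd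
      (contDiffOn_dSnd (m := 1) (n := 2) hE le_rfl) le_rfl hp) ?_
    have e1 := hS.scomp p.2 (hasDerivAt_distSq_snd y p)
    rw [Complex.real_smul] at e1
    have e2 : HasDerivAt (fun s : ℝ => 2 * s) 2 p.2 := by
      simpa using (hasDerivAt_id p.2).const_mul 2
    refine (e2.ofReal_comp.mul e1).congr_of_eventuallyEq ?_
    filter_upwards [lt_mem_nhds (show 0 < p.2 from hp)] with t ht
    exact dSnd_hankelWave hκ y (p := (p.1, t)) ht
  rw [h1, h2, hS', hankelSlope, hankelWave]
  have hB := hankelMoment_bessel (z := κ * √(distSq y p)) (by positivity)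
  have hsq : ((√(distSq y p) : ℝ) : ℂ) ^ 2 = ((p.1 : ℂ) - y) ^ 2 + (p.2 : ℂ) ^ 2 := by
    rw [← Complex.ofReal_pow, Real.sq_sqrt hq.le, distSq]
    push_cast
    ring
  have hq2 : ((distSq y p : ℝ) : ℂ) = ((√(distSq y p) : ℝ) : ℂ) ^ 2 := by
    rw [← Complex.ofReal_pow, Real.sq_sqrt hq.le]
  have hr0 : ((√(distSq y p) : ℝ) : ℂ) ≠ 0 := by
    exact_mod_cast (Real.sqrt_pos.2 hq).ne'
  push_cast at hB ⊢
  rw [hq2]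
  generalize ((√(distSq y p) : ℝ) : ℂ) = r at *
  generalize hankelMoment 0 (κ * √(distSq y p)) = m₀ at *
  generalize hankelMoment 1 (κ * √(distSq y p)) = m₁ at *
  generalize hankelMoment 2 (κ * √(distSq y p)) = m₂ at *
  have h3 : ((p.1 : ℂ) - y) ^ 2 = r ^ 2 - (p.2 : ℂ) ^ 2 := by rw [hsq]; ring
  calc _ = 4 * (-(κ / (2 * r)) * m₁) + 4 * (((p.1 : ℂ) - y) ^ 2 + (p.2 : ℂ) ^ 2) *
        (κ / (4 * r ^ 2 * r) * m₁ + κ ^ 2 / (4 * r ^ 2) * m₂) + κ ^ 2 * m₀ := by ring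
    _ = (κ / r) * (κ * r * m₂ - m₁ + κ * r * m₀) := by
        rw [← hsq]; field_simp; ring
    _ = 0 := by rw [hB, mul_zero]

lemma rpow_neg_half_eq {z : ℝ} (hz : 0 < z) : z ^ (-(1 / 2) : ℝ) = 1 / √z := by
  rw [Real.rpow_neg hz.le, ← Real.sqrt_eq_rpow, one_div]

lemma rpow_neg_three_half_eq {z : ℝ} (hz : 0 < z) : z ^ (-(3 / 2) : ℝ) = 1 / (z * √z) := by
  rw [show (-(3 / 2) : ℝ) = -1 + -(1 / 2) by norm_num, Real.rpow_add hz, rpow_neg_half_eq hz,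
    Real.rpow_neg_one]
  field_simp

lemma distSq_zero (p : ℝ × ℝ) : distSq 0 p = p.1 ^ 2 + p.2 ^ 2 := by simp [distSq]

/-- The triangle inequality for the two centres. It transfers estimates in the distance to y into
estimates in the distance to the origin, where the radiation condition is stated. -/
lemma abs_sqrt_distSq_sub_le (y : ℝ) (p : ℝ × ℝ) :
    |√(distSq y p) - √(distSq 0 p)| ≤ |y| := by
  have h : ∀ a b : ℝ, √(distSq b p) ≤ √(distSq a p) + |a - b| := by
    intro a b
    rw [Real.sqrt_le_left (by positivity)]
    have h1 : |p.1 - a| ≤ √(distSq a p) := Real.abs_le_sqrt (by unfold distSq; nlinarith)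
    have h2 := Real.sq_sqrt (show 0 ≤ distSq a p by unfold distSq; positivity)
    have h3 : (p.1 - a) * (a - b) ≤ √(distSq a p) * |a - b| := by
      refine (le_abs_self _).trans ?_
      rw [abs_mul]
      gcongr
    have h4 := sq_abs (a - b)
    have h5 : distSq b p = distSq a p + 2 * ((p.1 - a) * (a - b)) + (a - b) ^ 2 := by
      unfold distSq; ring
    nlinarith
  rw [abs_sub_le_iff]
  have h1 := h 0 y
  have h2 := h y 0
  simp only [zero_sub, abs_neg, sub_zero] at h1 h2
  constructor <;> linarith

/-- Decay of the cylindrical wave, and its radiation condition with respect to the origin. -/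
lemma exists_hankelWave_far {κ : ℝ} (hκ : 0 < κ) (y : ℝ) :
    ∃ C R : ℝ, 0 < C ∧ 0 < R ∧ ∀ p ∈ upperProd, R ≤ √(distSq 0 p) →
      ‖hankelWave κ y p‖ ≤ C / √(√(distSq 0 p)) ∧
      ‖p.1 * dFst (hankelWave κ y) p + p.2 * dSnd (hankelWave κ y) p -
        Complex.I * κ * √(distSq 0 p) * hankelWave κ y p‖ ≤ C / √(√(distSq 0 p)) := by
  set G₀ := Real.Gamma (1 / 2) with hG₀
  set G₁ := Real.Gamma (3 / 2) with hG₁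
  have hG₀p : 0 < G₀ := Real.Gamma_pos_of_pos (by norm_num)
  have hG₁p : 0 < G₁ := Real.Gamma_pos_of_pos (by norm_num)
  set D := 1 / √(κ / 2) with hD
  have hDp : 0 < D := by positivity
  -- Beyond radius 2|y| + 1 the distance ρ to the centre of the wave is at least r/2.
  refine ⟨G₀ * D + (κ * (G₁ * (2 / κ) * D + 2 * |y| * (G₀ * D))), 2 * |y| + 1,
    by positivity, by positivity, fun p hp hR => ?_⟩
  set r := √(distSq 0 p) with hr
  set ρ := √(distSq y p) with hρ
  have hρp : 0 < ρ := Real.sqrt_pos.2 (distSq_pos hp)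
  have hrp : 0 < r := Real.sqrt_pos.2 (distSq_pos hp)
  have habs := abs_sub_le_iff.1 (abs_sqrt_distSq_sub_le y p)
  rw [← hr, ← hρ] at habs
  have hhalf : r / 2 ≤ ρ := by linarith [habs.2]
  have hz : 0 < κ * ρ := by positivity
  have hzr : κ / 2 * r ≤ κ * ρ := by nlinarith
  have hsz : 1 / √(κ * ρ) ≤ D / √r := by
    rw [hD, div_div, ← Real.sqrt_mul (by positivity)]
    gcongr
  have hM₀ : ‖hankelMoment 0 (κ * ρ)‖ ≤ G₀ * D / √r := by
    refine (norm_hankelMoment_zero_le hz).trans ?_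
    rw [rpow_neg_half_eq hz, mul_div_assoc]
    gcongr
  have hm : ‖hankelMoment 1 (κ * ρ) + Complex.I * hankelMoment 0 (κ * ρ)‖ * r ≤
      G₁ * (2 / κ) * D / √r := by
    refine (mul_le_mul_of_nonneg_right (norm_hankelMoment_radiation_le hz) hrp.le).trans ?_
    rw [rpow_neg_three_half_eq hz]
    have h1 : r / (κ * ρ) ≤ 2 / κ := by
      rw [div_le_div_iff₀ hz hκ]; nlinarith
    calc G₁ * (1 / (κ * ρ * √(κ * ρ))) * r = G₁ * (r / (κ * ρ)) * (1 / √(κ * ρ)) := by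
          field_simp
      _ ≤ G₁ * (2 / κ) * (D / √r) := by gcongr
      _ = _ := by ring
  refine ⟨?_, ?_⟩
  · refine hM₀.trans ?_
    gcongr
    exact le_add_of_nonneg_right (by positivity)
  -- X is x · ∇ρ, so the Euler operator applied to the wave gives -κX · `hankelMoment 1`. Writing r
  -- = X + (r - X) isolates the radiating combination; the remainder has the bounded coefficient r -
  -- X.
  · set X : ℝ := (p.1 * (p.1 - y) + p.2 * p.2) / ρ with hX
    have hρsq : ρ ^ 2 = (p.1 - y) ^ 2 + p.2 ^ 2 := Real.sq_sqrt (distSq_pos hp).le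
    have hrsq : r ^ 2 = p.1 ^ 2 + p.2 ^ 2 := by
      rw [hr, Real.sq_sqrt (distSq_pos hp).le, distSq_zero]
    have hXr : |X| ≤ r := by
      rw [hX, abs_div, abs_of_pos hρp, div_le_iff₀ hρp]
      refine abs_le_of_sq_le_sq ?_ (by positivity)
      rw [mul_pow, hρsq, hrsq]
      nlinarith [sq_nonneg (p.1 * p.2 - p.2 * (p.1 - y))]
    have hXd : |r - X| ≤ 2 * |y| := by
      have h1 : X = ρ + y * ((p.1 - y) / ρ) := by
        rw [hX]; field_simp; rw [hρsq]; ring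
      have h2 : |(p.1 - y) / ρ| ≤ 1 := by
        rw [abs_div, abs_of_pos hρp, div_le_one hρp]
        exact abs_le_of_sq_le_sq (by rw [hρsq]; nlinarith) hρp.le
      have h3 : |y * ((p.1 - y) / ρ)| ≤ |y| := by
        rw [abs_mul]; exact mul_le_of_le_one_right (abs_nonneg _) h2
      have h4 := abs_le.1 h3
      rw [h1, abs_le]
      constructor <;> linarith [habs.1, habs.2, h4.1, h4.2]
    have hexp : p.1 * dFst (hankelWave κ y) p + p.2 * dSnd (hankelWave κ y) p -
        Complex.I * κ * r * hankelWave κ y p =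
        -(κ : ℂ) * ((X : ℂ) * (hankelMoment 1 (κ * ρ) + Complex.I * hankelMoment 0 (κ * ρ)) +
          ((r - X : ℝ) : ℂ) * (Complex.I * hankelMoment 0 (κ * ρ))) := by
      rw [dFst_hankelWave hκ y hp, dSnd_hankelWave hκ y hp, hankelSlope, hankelWave, ← hρ, hX]
      have hρ0 : (ρ : ℂ) ≠ 0 := by exact_mod_cast hρp.ne'
      push_cast
      field_simp
      ring
    rw [hexp, norm_mul, norm_neg, Complex.norm_real, Real.norm_of_nonneg hκ.le]
    have h5 : ‖(X : ℂ) * (hankelMoment 1 (κ * ρ) + Complex.I * hankelMoment 0 (κ * ρ)) +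
          ((r - X : ℝ) : ℂ) * (Complex.I * hankelMoment 0 (κ * ρ))‖ ≤
          G₁ * (2 / κ) * D / √r + 2 * |y| * (G₀ * D / √r) := by
      refine (norm_add_le _ _).trans (add_le_add ?_ ?_)
      · rw [norm_mul, Complex.norm_real, Real.norm_eq_abs, mul_comm]
        exact (mul_le_mul_of_nonneg_left hXr (norm_nonneg _)).trans hm
      · rw [norm_mul, Complex.norm_real, Real.norm_eq_abs, norm_mul, Complex.norm_I, one_mul]
        gcongr
    calc _ ≤ κ * (G₁ * (2 / κ) * D / √r + 2 * |y| * (G₀ * D / √r)) := by gcongr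
      _ = (κ * (G₁ * (2 / κ) * D + 2 * |y| * (G₀ * D))) / √r := by ring
      _ ≤ _ := by
          gcongr
          exact le_add_of_nonneg_left (by positivity)

/-! ### Smooth cutoffs to discs -/

/-- A smooth function equal to `1` on `(-∞, 1]` and to `0` on `[2, ∞)`. -/
def cutoff (x : ℝ) : ℝ := Real.smoothTransition (2 - x)

lemma contDiff_cutoff {n : ℕ∞} : ContDiff ℝ n cutoff :=
  Real.smoothTransition.contDiff.comp (contDiff_const.sub contDiff_id)

lemma cutoff_of_le_one {x : ℝ} (hx : x ≤ 1) : cutoff x = 1 :=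
  Real.smoothTransition.one_of_one_le (by linarith)

lemma cutoff_of_two_le {x : ℝ} (hx : 2 ≤ x) : cutoff x = 0 :=
  Real.smoothTransition.zero_of_nonpos (by linarith)

lemma cutoff_nonneg (x : ℝ) : 0 ≤ cutoff x := Real.smoothTransition.nonneg _

lemma cutoff_le_one (x : ℝ) : cutoff x ≤ 1 := Real.smoothTransition.le_one _

lemma deriv_cutoff_eq_zero {x : ℝ} (hx : x < 1 ∨ 2 < x) : deriv cutoff x = 0 := by
  rcases hx with hx | hx
  · have : cutoff =ᶠ[𝓝 x] fun _ => 1 := by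
      filter_upwards [gt_mem_nhds hx] with t ht using cutoff_of_le_one ht.le
    rw [this.deriv_eq, deriv_const]
  · have : cutoff =ᶠ[𝓝 x] fun _ => 0 := by
      filter_upwards [lt_mem_nhds hx] with t ht using cutoff_of_two_le ht.le
    rw [this.deriv_eq, deriv_const]

lemma exists_abs_deriv_cutoff_le : ∃ K : ℝ, 0 < K ∧ ∀ x, |deriv cutoff x| ≤ K := by
  have hc : Continuous (deriv cutoff) := (contDiff_cutoff (n := 1)).continuous_deriv le_rfl
  obtain ⟨C, hC⟩ := (isCompact_Icc (a := (1 : ℝ)) (b := 2)).exists_bound_of_continuousOn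
    hc.continuousOn
  refine ⟨max C 1, by positivity, fun x => ?_⟩
  by_cases hx : x ∈ Set.Icc (1 : ℝ) 2
  · exact (hC x hx).trans (le_max_left _ _)
  · rw [Set.mem_Icc, not_and_or, not_le, not_le] at hx
    rw [deriv_cutoff_eq_zero hx, abs_zero]
    positivity

/-- A smooth cutoff to the disc of radius about `ρ` around `(b, 0)`. -/
def discCutoff (b ρ : ℝ) (p : ℝ × ℝ) : ℂ := (cutoff (distSq b p / ρ ^ 2) : ℝ)

lemma contDiff_discCutoff (b ρ : ℝ) {n : ℕ∞} : ContDiff ℝ n (discCutoff b ρ) := by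
  refine Complex.ofRealCLM.contDiff.comp (contDiff_cutoff.comp ?_)
  unfold distSq
  fun_prop

lemma dFst_discCutoff (b ρ : ℝ) (p : ℝ × ℝ) : dFst (discCutoff b ρ) p =
    ((deriv cutoff (distSq b p / ρ ^ 2) * (2 / ρ ^ 2) : ℝ) : ℂ) * ((p.1 - b : ℝ) : ℂ) := by
  refine dFst_eq_of_hasDerivAt ((contDiff_discCutoff b ρ (n := 1)).differentiable
    (by simp)).differentiableAt ?_
  have h1 : HasDerivAt cutoff (deriv cutoff (distSq b p / ρ ^ 2)) (distSq b p / ρ ^ 2) :=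
    ((contDiff_cutoff (n := 1)).differentiable (by simp)).differentiableAt.hasDerivAt
  have h2 := (h1.comp p.1 ((hasDerivAt_distSq_fst b p).div_const (ρ ^ 2))).ofReal_comp
  refine h2.congr_deriv ?_
  push_cast
  ring

lemma dSnd_discCutoff (b ρ : ℝ) (p : ℝ × ℝ) : dSnd (discCutoff b ρ) p =
    ((deriv cutoff (distSq b p / ρ ^ 2) * (2 / ρ ^ 2) : ℝ) : ℂ) * (p.2 : ℂ) := by
  refine dSnd_eq_of_hasDerivAt ((contDiff_discCutoff b ρ (n := 1)).differentiable
    (by simp)).differentiableAt ?_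
  have h1 : HasDerivAt cutoff (deriv cutoff (distSq b p / ρ ^ 2)) (distSq b p / ρ ^ 2) :=
    ((contDiff_cutoff (n := 1)).differentiable (by simp)).differentiableAt.hasDerivAt
  have h2 := (h1.comp p.2 ((hasDerivAt_distSq_snd b p).div_const (ρ ^ 2))).ofReal_comp
  refine h2.congr_deriv ?_
  push_cast
  ring

/-! ### Radiating aperture fields: growth and bulk errors -/

/-- `W` is a radiating solution of the Helmholtz equation in the half-plane, of locally finite
energy, with normal derivative `c` on the aperture `(0, ε) × {0}` and `0` on the rest of the
boundary line. -/
structure IsApertureField (κ ε : ℝ) (c : ℂ) (W : ℝ × ℝ → ℂ) : Prop where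
  contDiffOn : ContDiffOn ℝ (2 : ℕ∞) W upperProd
  continuousOn : ContinuousOn W {p | 0 ≤ p.2 ∧ p ≠ (0, 0) ∧ p ≠ (ε, 0)}
  sq_integrable : ∀ R : ℝ, IntegrableOn (fun p => ‖W p‖ ^ 2) (Set.Ioo (-R) R ×ˢ Set.Ioo 0 R)
  gradSq_integrable : ∀ R : ℝ, IntegrableOn (fun p => ‖dFst W p‖ ^ 2 + ‖dSnd W p‖ ^ 2)
    (Set.Ioo (-R) R ×ˢ Set.Ioo 0 R)
  helmholtz : ∀ p ∈ upperProd, dFst (dFst W) p + dSnd (dSnd W) p + (κ : ℂ) ^ 2 * W p = 0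
  neumann : ∀ t : ℝ, t ∉ Set.Icc 0 ε → Tendsto (dSnd W) (𝓝[upperProd] (t, 0)) (𝓝 0)
  aperture : ∀ t ∈ Set.Ioo 0 ε, Tendsto (dSnd W) (𝓝[upperProd] (t, 0)) (𝓝 c)
  -- The Sommerfeld condition multiplied by r, so that r∂ᵣ is the Euler operator; the nested root is
  -- √r.
  radiation : ∀ η : ℝ, 0 < η → ∃ R : ℝ, ∀ p ∈ upperProd, R ≤ √(distSq 0 p) →
    ‖p.1 * dFst W p + p.2 * dSnd W p - Complex.I * κ * √(distSq 0 p) * W p‖ ≤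
      η * √(√(distSq 0 p))

lemma distSq_nonneg (y : ℝ) (p : ℝ × ℝ) : 0 ≤ distSq y p := by unfold distSq; positivity

lemma continuous_distSq (y : ℝ) : Continuous (distSq y) := by unfold distSq; fun_prop

lemma abs_fst_sub_le (y : ℝ) (p : ℝ × ℝ) : |p.1 - y| ≤ √(distSq y p) :=
  Real.abs_le_sqrt (by unfold distSq; nlinarith)

lemma abs_snd_le (y : ℝ) (p : ℝ × ℝ) : |p.2| ≤ √(distSq y p) :=
  Real.abs_le_sqrt (by unfold distSq; nlinarith)

/-- A radiating field is `o(√r)` at infinity, by integration along rays. -/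
lemma IsApertureField.growth {κ ε : ℝ} {c : ℂ} {W : ℝ × ℝ → ℂ} (hε : 0 < ε)
    (hW : IsApertureField κ ε c W) {η : ℝ} (hη : 0 < η) :
    ∃ R : ℝ, ∀ p ∈ upperProd, R ≤ √(distSq 0 p) → ‖W p‖ ≤ η * √(√(distSq 0 p)) := by
  obtain ⟨R₀, hR₀⟩ := hW.radiation (η / 4) (by linarith)
  -- A radius above ε keeps the half-circle away from the end points, so W is bounded on it by
  -- compactness.
  set R₁ := max R₀ (ε + 1) with hR₁
  have hR₁p : 0 < R₁ := lt_of_lt_of_le (by linarith) (le_max_right _ _)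
  have hK : IsCompact {p : ℝ × ℝ | 0 ≤ p.2 ∧ distSq 0 p = R₁ ^ 2} := by
    refine (isCompact_Icc (a := ((-R₁, -R₁) : ℝ × ℝ)) (b := (R₁, R₁))).of_isClosed_subset
      ((isClosed_le continuous_const continuous_snd).inter
        (isClosed_eq (continuous_distSq 0) continuous_const)) ?_
    rintro p ⟨_, hp⟩
    have h1 := abs_fst_sub_le 0 p
    have h2 := abs_snd_le 0 p
    rw [hp, Real.sqrt_sq hR₁p.le] at h1 h2
    rw [sub_zero] at h1
    exact ⟨⟨(abs_le.1 h1).1, (abs_le.1 h2).1⟩, ⟨(abs_le.1 h1).2, (abs_le.1 h2).2⟩⟩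
  obtain ⟨M, hM⟩ := hK.exists_bound_of_continuousOn (hW.continuousOn.mono (by
    rintro p ⟨hp1, hp2⟩
    have h1 : ε < R₁ := lt_of_lt_of_le (by linarith) (le_max_right _ _)
    refine ⟨hp1, ?_, ?_⟩ <;> rintro rfl <;> simp [distSq] at hp2 <;> nlinarith))
  set M' := max M 0
  -- Beyond this radius the initial bound M' is at most half of η√r.
  refine ⟨max R₁ ((2 * M' / η) ^ 2), fun p hp hpR => ?_⟩
  set r := √(distSq 0 p) with hr
  have hrR₁ : R₁ ≤ r := (le_max_left _ _).trans hpR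
  have hrp : 0 < r := hR₁p.trans_le hrR₁
  have hMr : 2 * M' ≤ η * √r := by
    have h1 : 2 * M' / η ≤ √r := Real.le_sqrt_of_sq_le ((le_max_right _ _).trans hpR)
    rw [div_le_iff₀ hη] at h1
    linarith
  have hrsq : r ^ 2 = p.1 ^ 2 + p.2 ^ 2 := by
    rw [hr, Real.sq_sqrt (distSq_nonneg _ _), distSq_zero]
  set u : ℝ × ℝ := (p.1 / r, p.2 / r) with hu
  have hp2 : 0 < p.2 := hp
  have hu2 : 0 < u.2 := by simp only [hu]; positivity
  have hun : u.1 ^ 2 + u.2 ^ 2 = 1 := by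
    simp only [hu]; field_simp; linarith
  have hdist : ∀ s : ℝ, 0 < s → √(distSq 0 (s * u.1, s * u.2)) = s := fun s hs => by
    rw [distSq_zero, show (s * u.1) ^ 2 + (s * u.2) ^ 2 = s ^ 2 * (u.1 ^ 2 + u.2 ^ 2) by ring, hun,
      mul_one, Real.sqrt_sq hs.le]
  have hmem : ∀ s : ℝ, 0 < s → (s * u.1, s * u.2) ∈ upperProd := fun s hs => mul_pos hs hu2
  -- Removing the oscillation exp(iκs) along a ray turns the radiation condition into a bound on the
  -- derivative of f.
  set f : ℝ → ℂ := fun s => Complex.exp (-(Complex.I * κ * s)) * W (s * u.1, s * u.2) with hf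
  set f' : ℝ → ℂ := fun s => Complex.exp (-(Complex.I * κ * s)) *
    (u.1 * dFst W (s * u.1, s * u.2) + u.2 * dSnd W (s * u.1, s * u.2) -
      Complex.I * κ * W (s * u.1, s * u.2)) with hf'
  have hder : ∀ s : ℝ, 0 < s → HasDerivAt f (f' s) s := by
    intro s hs
    have h1 : HasDerivAt (fun s : ℝ => (s * u.1, s * u.2)) u s := by
      simpa using ((hasDerivAt_id s).mul_const u.1).prodMk ((hasDerivAt_id s).mul_const u.2)
    have h2 := HasFDerivAt.comp_hasDerivAt s
      (differentiableAt_upperProd hW.contDiffOn (by norm_num) (hmem s hs)).hasFDerivAt h1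
    have h3 : fderiv ℝ W (s * u.1, s * u.2) u =
        u.1 * dFst W (s * u.1, s * u.2) + u.2 * dSnd W (s * u.1, s * u.2) := by
      have : u = u.1 • ((1 : ℝ), (0 : ℝ)) + u.2 • ((0 : ℝ), (1 : ℝ)) := by ext <;> simp
      generalize (s * u.1, s * u.2) = q
      rw [dFst, dSnd, ← Complex.real_smul, ← Complex.real_smul, ← map_smul, ← map_smul, ← map_add,
        ← this]
    rw [h3] at h2
    have h4 : HasDerivAt (fun s : ℝ => Complex.exp (-(Complex.I * κ * s)))
        (Complex.exp (-(Complex.I * κ * s)) * (-(Complex.I * κ * 1))) s :=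
      (((Complex.ofRealCLM.hasDerivAt (x := s)).const_mul (Complex.I * κ)).neg).cexp
    refine (h4.mul h2).congr_deriv ?_
    simp only [hf', Function.comp]
    ring
  have hnexp : ∀ s : ℝ, ‖Complex.exp (-(Complex.I * κ * s))‖ = 1 := fun s => by
    rw [Complex.norm_exp]; simp
  have hf'n : ∀ s : ℝ, R₁ ≤ s → ‖f' s‖ ≤ η / 4 / √s := by
    intro s hs
    have hs0 : 0 < s := hR₁p.trans_le hs
    have h1 := hR₀ _ (hmem s hs0) (by rw [hdist s hs0]; exact (le_max_left _ _).trans hs)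
    rw [hdist s hs0] at h1
    simp only at h1
    rw [hf']
    simp only
    rw [norm_mul, hnexp, one_mul]
    have h2 : ((s * u.1 : ℝ) : ℂ) * dFst W (s * u.1, s * u.2) +
        ((s * u.2 : ℝ) : ℂ) * dSnd W (s * u.1, s * u.2) - Complex.I * κ * s * W (s * u.1, s * u.2) =
        s * (u.1 * dFst W (s * u.1, s * u.2) + u.2 * dSnd W (s * u.1, s * u.2) -
      Complex.I * κ * W (s * u.1, s * u.2)) := by push_cast; ring
    rw [h2, norm_mul, Complex.norm_real, Real.norm_of_nonneg hs0.le] at h1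
    have hss : 0 < √s := Real.sqrt_pos.2 hs0
    rw [le_div_iff₀ hss]
    have h3 := Real.mul_self_sqrt hs0.le
    nlinarith
  have hbd := image_norm_le_of_norm_deriv_right_le_deriv_boundary' (f := f) (f' := f') (a := R₁)
    (b := r) (B := fun s => M' + η / 2 * √s) (B' := fun s => η / 4 / √s)
    (fun s hs => (hder s (hR₁p.trans_le hs.1)).continuousAt.continuousWithinAt)
    (fun s hs => (hder s (hR₁p.trans_le hs.1)).hasDerivWithinAt)
    (by
      rw [hf]
      simp only
      rw [norm_mul, hnexp, one_mul]
      have h1 := hM (R₁ * u.1, R₁ * u.2) ⟨(hmem R₁ hR₁p).le, by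
        rw [← Real.sq_sqrt (distSq_nonneg 0 (R₁ * u.1, R₁ * u.2)), hdist R₁ hR₁p]⟩
      have h2 : M ≤ M' := le_max_left _ _
      have : 0 ≤ η / 2 * √R₁ := by positivity
      linarith)
    (by fun_prop)
    (fun s hs => by
      have hs0 : 0 < s := hR₁p.trans_le hs.1
      refine (((Real.hasDerivAt_sqrt hs0.ne').const_mul (η / 2)).const_add M').hasDerivWithinAt.congr_deriv ?_
      have := Real.sqrt_pos.2 hs0
      field_simp
      norm_num)
    (fun s hs => hf'n s hs.1) (Set.right_mem_Icc.2 hrR₁)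
  have hfr : ‖f r‖ = ‖W p‖ := by
    rw [hf]
    simp only
    rw [norm_mul, hnexp, one_mul]
    congr 2
    ext <;> simp only [hu] <;> field_simp
  rw [hfr] at hbd
  linarith

/-- The bulk integrand of Green's identity. -/
def greenDensity (f g χ : ℝ × ℝ → ℂ) (p : ℝ × ℝ) : ℂ :=
  dFst χ p * (g p * dFst f p - f p * dFst g p) + dSnd χ p * (g p * dSnd f p - f p * dSnd g p)

lemma volume_real_Icc_prod {a b c d : ℝ} (hab : a ≤ b) (hcd : c ≤ d) :
    volume.real (Set.Icc ((a, c) : ℝ × ℝ) (b, d)) = (b - a) * (d - c) := by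
  rw [← Set.Icc_prod_Icc, Measure.volume_eq_prod, measureReal_prod_prod, Real.volume_real_Icc,
    Real.volume_real_Icc, max_eq_left (by linarith), max_eq_left (by linarith)]

/-- The gradient of a disc cutoff is radial, so only Euler derivatives of W and of the wave enter.
Each product pairs an o(√r) factor of W with an O(1/√r) factor of the wave, while the factor 2K/R²
balances the area of order R². The estimate does not depend on the height h. -/
lemma IsApertureField.far_bulk {κ ε : ℝ} {c : ℂ} {W : ℝ × ℝ → ℂ} (hκ : 0 < κ) (hε : 0 < ε)
    (hW : IsApertureField κ ε c W) (y : ℝ) {η : ℝ} (hη : 0 < η) :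
    ∃ R₀ : ℝ, ∀ R : ℝ, R₀ ≤ R → ∀ h : ℝ, 0 < h → h ≤ 2 * R →
      ‖∫ p in Set.Icc ((-(2 * R), h) : ℝ × ℝ) (2 * R, 2 * R),
        greenDensity W (hankelWave κ y) (discCutoff 0 R) p‖ ≤ η := by
  obtain ⟨K, hK, hKb⟩ := exists_abs_deriv_cutoff_le
  obtain ⟨C, R₁, hC, hR₁, hE⟩ := exists_hankelWave_far hκ y
  -- 32 = 2 · 2 · 8: the factor in 2/R², the two products, and the area bound 8R².
  set η' := η / (32 * K * C) with hη'
  have hη'p : 0 < η' := by positivity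
  obtain ⟨R₂, hR₂⟩ := hW.growth hε hη'p
  obtain ⟨R₃, hR₃⟩ := hW.radiation η' hη'p
  refine ⟨max R₁ (max R₂ R₃), fun R hR h hh hhR => ?_⟩
  have hRR₁ : R₁ ≤ R := (le_max_left _ _).trans hR
  have hRR₂ : R₂ ≤ R := ((le_max_left _ _).trans (le_max_right _ _)).trans hR
  have hRR₃ : R₃ ≤ R := ((le_max_right _ _).trans (le_max_right _ _)).trans hR
  have hRp : 0 < R := hR₁.trans_le hRR₁
  have hb : ∀ p ∈ Set.Icc ((-(2 * R), h) : ℝ × ℝ) (2 * R, 2 * R),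
      ‖greenDensity W (hankelWave κ y) (discCutoff 0 R) p‖ ≤ K * (2 / R ^ 2) * (2 * C * η') := by
    intro p hp
    have hpu : p ∈ upperProd := hh.trans_le hp.1.2
    set E := hankelWave κ y
    set r := √(distSq 0 p) with hr
    -- Subtracting iκr times each function changes nothing, since the two additions cancel in the
    -- antisymmetric expression.
    have hden : greenDensity W E (discCutoff 0 R) p =
        ((deriv cutoff (distSq 0 p / R ^ 2) * (2 / R ^ 2) : ℝ) : ℂ) *
          (E p * (p.1 * dFst W p + p.2 * dSnd W p - Complex.I * κ * r * W p) -
            W p * (p.1 * dFst E p + p.2 * dSnd E p - Complex.I * κ * r * E p)) := by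
      rw [greenDensity, dFst_discCutoff, dSnd_discCutoff, sub_zero]
      ring
    rw [hden, norm_mul, Complex.norm_real, Real.norm_eq_abs, abs_mul,
      abs_of_pos (show 0 < 2 / R ^ 2 by positivity)]
    by_cases hsmall : distSq 0 p / R ^ 2 < 1
    · rw [deriv_cutoff_eq_zero (Or.inl hsmall), abs_zero, zero_mul, zero_mul]
      positivity
    · have hrR : R ≤ r := by
        rw [not_lt, le_div_iff₀ (by positivity), one_mul] at hsmall
        exact Real.le_sqrt_of_sq_le hsmall
      have hrp : 0 < r := hRp.trans_le hrR
      have hsr : 0 < √r := Real.sqrt_pos.2 hrp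
      obtain ⟨h1, h2⟩ := hE p hpu (hRR₁.trans hrR)
      have h3 := hR₂ p hpu (hRR₂.trans hrR)
      have h4 := hR₃ p hpu (hRR₃.trans hrR)
      gcongr
      · exact hKb _
      · refine (norm_sub_le _ _).trans ?_
        rw [norm_mul, norm_mul]
        calc _ ≤ C / √r * (η' * √r) + η' * √r * (C / √r) := by gcongr
          _ = 2 * C * η' := by field_simp; ring
  have hvol : volume (Set.Icc ((-(2 * R), h) : ℝ × ℝ) (2 * R, 2 * R)) < ⊤ :=
    isCompact_Icc.measure_lt_top
  refine (norm_setIntegral_le_of_norm_le_const hvol hb).trans ?_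
  rw [volume_real_Icc_prod (by linarith) hhR]
  calc K * (2 / R ^ 2) * (2 * C * η') * ((2 * R - -(2 * R)) * (2 * R - h))
      ≤ K * (2 / R ^ 2) * (2 * C * η') * ((2 * R - -(2 * R)) * (2 * R)) := by
        gcongr
        · linarith
        · linarith
    _ = η := by rw [hη']; field_simp; ring

lemma continuousOn_hankelSlope {κ : ℝ} (hκ : 0 < κ) : ContinuousOn (hankelSlope κ) (Set.Ioi 0) :=
  fun _ hq => (hasDerivAt_hankelSlope hκ hq).continuousAt.continuousWithinAt

/-- The cylindrical wave and its gradient are bounded near any boundary point other than its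
centre. -/
lemma exists_hankelWave_near_bound {κ : ℝ} (hκ : 0 < κ) {y b : ℝ} (hyb : y ≠ b) :
    ∃ B ρ : ℝ, 0 < B ∧ 0 < ρ ∧ ∀ p ∈ upperProd, |p.1 - b| < ρ → |p.2| < ρ →
      ‖hankelWave κ y p‖ ≤ B ∧ ‖dFst (hankelWave κ y) p‖ ≤ B ∧
        ‖dSnd (hankelWave κ y) p‖ ≤ B := by
  set ρ := |y - b| / 2 with hρ
  have hρp : 0 < ρ := by have := abs_pos.2 (sub_ne_zero.2 hyb); positivity
  have hsub : Set.Icc (ρ ^ 2) (10 * ρ ^ 2) ⊆ Set.Ioi 0 := fun q hq =>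
    (show 0 < ρ ^ 2 by positivity).trans_le hq.1
  have hc0 : ContinuousOn (fun q => hankelMoment 0 (κ * √q)) (Set.Icc (ρ ^ 2) (10 * ρ ^ 2)) :=
    fun q hq => (hasDerivAt_hankelMoment_mul_sqrt 0 hκ (hsub hq)).continuousAt.continuousWithinAt
  obtain ⟨B₁, hB₁⟩ := isCompact_Icc.exists_bound_of_continuousOn hc0
  obtain ⟨B₂, hB₂⟩ := isCompact_Icc.exists_bound_of_continuousOn
    ((continuousOn_hankelSlope hκ).mono hsub)
  have hB₂0 : 0 ≤ B₂ := (norm_nonneg _).trans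
    (hB₂ (ρ ^ 2) (Set.left_mem_Icc.2 (by nlinarith [sq_nonneg ρ])))
  refine ⟨max B₁ 0 + 6 * ρ * B₂ + 1, ρ, by positivity, hρp, fun p hp h1 h2 => ?_⟩
  have habs : |y - b| = 2 * ρ := by rw [hρ]; ring
  have h3 : |p.1 - y| ≤ 3 * ρ := by
    have := abs_sub_le p.1 b y
    rw [abs_sub_comm b y, habs] at this
    linarith
  have h4 : ρ ≤ |p.1 - y| := by
    have := abs_sub_le y p.1 b
    rw [abs_sub_comm y p.1, habs] at this
    linarith
  have hq : distSq y p ∈ Set.Icc (ρ ^ 2) (10 * ρ ^ 2) := by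
    have e1 := sq_abs (p.1 - y)
    have e2 := sq_abs p.2
    have e3 := abs_nonneg p.2
    unfold distSq
    constructor <;> nlinarith
  have h5 := hB₁ _ hq
  have h6 := hB₂ _ hq
  have h7 := le_max_left B₁ 0
  have h8 := le_max_right B₁ 0
  have h9 : 0 ≤ 6 * ρ * B₂ := by positivity
  refine ⟨?_, ?_, ?_⟩
  · have : ‖hankelWave κ y p‖ ≤ B₁ := h5
    linarith
  · rw [dFst_hankelWave hκ y hp, norm_mul, Complex.norm_real, Real.norm_eq_abs, abs_mul,
      abs_of_pos (zero_lt_two' ℝ)]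
    have : 2 * |p.1 - y| * ‖hankelSlope κ (distSq y p)‖ ≤ 2 * (3 * ρ) * B₂ := by gcongr
    linarith
  · rw [dSnd_hankelWave hκ y hp, norm_mul, Complex.norm_real, Real.norm_eq_abs, abs_mul,
      abs_of_pos (zero_lt_two' ℝ)]
    have : 2 * |p.2| * ‖hankelSlope κ (distSq y p)‖ ≤ 2 * (3 * ρ) * B₂ := by
      gcongr; linarith
    linarith

/-- The wave and its gradient are bounded near b, and the cutoff gradient is of size 1/ρ on a set of
area of order ρ². By a weighted Young inequality the error is controlled by a small constant plus a
multiple of the local energy of W, which tends to 0 with ρ by absolute continuity of the integral.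
-/
lemma IsApertureField.near_bulk {κ ε : ℝ} {c : ℂ} {W : ℝ × ℝ → ℂ} (hκ : 0 < κ)
    (hW : IsApertureField κ ε c W) {y b : ℝ} (hyb : y ≠ b) {η : ℝ} (hη : 0 < η) :
    ∀ᶠ ρ in 𝓝[>] (0 : ℝ), ∀ A h : ℝ, 0 < h →
      ‖∫ p in Set.Icc ((-A, h) : ℝ × ℝ) (A, A),
        greenDensity W (hankelWave κ y) (discCutoff b ρ) p‖ ≤ η := by
  obtain ⟨K, hK, hKb⟩ := exists_abs_deriv_cutoff_le
  obtain ⟨B, ρ₁, hB, hρ₁, hE⟩ := exists_hankelWave_near_bound hκ hyb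
  set S : ℝ → Set (ℝ × ℝ) := fun ρ => Set.Ioo (b - 2 * ρ) (b + 2 * ρ) ×ˢ Set.Ioo 0 (2 * ρ) with hS
  have hSm : ∀ ρ, MeasurableSet (S ρ) := fun ρ => measurableSet_Ioo.prod measurableSet_Ioo
  have hSvol : ∀ ρ, volume (S ρ) = ENNReal.ofReal (4 * ρ) * ENNReal.ofReal (2 * ρ) := fun ρ => by
    rw [hS, Measure.volume_eq_prod, Measure.prod_prod, Real.volume_Ioo, Real.volume_Ioo]
    ring_nf
  -- The weight 2 on |W|² is there because W multiplies both partial derivatives of the wave.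
  set Q : ℝ × ℝ → ℝ := fun p => ‖dFst W p‖ ^ 2 + ‖dSnd W p‖ ^ 2 + 2 * ‖W p‖ ^ 2 with hQ
  set T : Set (ℝ × ℝ) := Set.Ioo (-(|b| + 2)) (|b| + 2) ×ˢ Set.Ioo 0 (|b| + 2) with hT
  have hQi : IntegrableOn Q T :=
    (hW.gradSq_integrable (|b| + 2)).add ((hW.sq_integrable (|b| + 2)).const_mul 2)
  have hST : ∀ ρ, ρ ≤ 1 → S ρ ⊆ T := by
    rintro ρ hρ p ⟨⟨h1, h2⟩, h3, h4⟩
    have := neg_abs_le b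
    have := le_abs_self b
    have := abs_nonneg b
    exact ⟨⟨by linarith, by linarith⟩, h3, by linarith⟩
  -- Chosen so that the constant part of the majorant integrates to η/4 over area 8ρ²; the energy
  -- part will contribute at most η/2.
  set μ := η / (512 * K * B) with hμ
  have hμp : 0 < μ := by positivity
  have hlim : Tendsto (fun ρ => ∫ p in S ρ, Q p ∂(volume.restrict T)) (𝓝[>] 0) (𝓝 0) := by
    refine Integrable.tendsto_setIntegral_nhds_zero hQi ?_
    have h1 : Tendsto (fun ρ : ℝ => ENNReal.ofReal (4 * ρ) * ENNReal.ofReal (2 * ρ)) (𝓝[>] 0)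
        (𝓝 0) := by
      have e1 : Tendsto (fun ρ : ℝ => ENNReal.ofReal (4 * ρ)) (𝓝 0) (𝓝 0) := by
        have : Continuous fun ρ : ℝ => ENNReal.ofReal (4 * ρ) :=
          ENNReal.continuous_ofReal.comp (continuous_const.mul continuous_id)
        simpa using this.tendsto 0
      have e2 : Tendsto (fun ρ : ℝ => ENNReal.ofReal (2 * ρ)) (𝓝 0) (𝓝 0) := by
        have : Continuous fun ρ : ℝ => ENNReal.ofReal (2 * ρ) :=
          ENNReal.continuous_ofReal.comp (continuous_const.mul continuous_id)
        simpa using this.tendsto 0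
      have := ENNReal.Tendsto.mul e1 (by simp) e2 (by simp)
      rw [mul_zero] at this
      exact this.mono_left nhdsWithin_le_nhds
    refine tendsto_of_tendsto_of_tendsto_of_le_of_le tendsto_const_nhds h1 (fun _ => bot_le)
      fun ρ => ?_
    simp only [Function.comp]
    rw [← hSvol]
    exact Measure.restrict_apply_le _ _
  have hsm : ∀ᶠ ρ in 𝓝[>] (0 : ℝ), ∫ p in S ρ, Q p ∂(volume.restrict T) < η * μ / (8 * K * B) :=
    hlim.eventually (gt_mem_nhds (by positivity))
  have hlt : ∀ᶠ ρ in 𝓝[>] (0 : ℝ), ρ < min 1 (ρ₁ / 2) :=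
    (gt_mem_nhds (by positivity)).filter_mono nhdsWithin_le_nhds
  filter_upwards [hsm, hlt, self_mem_nhdsWithin] with ρ hρs hρl hρp A h hh
  have hρp : 0 < ρ := hρp
  have hρ1 : ρ ≤ 1 := hρl.le.trans (min_le_left _ _)
  have hρ2 : 2 * ρ < ρ₁ := by have := hρl.trans_le (min_le_right _ _); linarith
  rw [Measure.restrict_restrict (hSm ρ), Set.inter_eq_left.2 (hST ρ hρ1)] at hρs
  have hQS : IntegrableOn Q (S ρ) := hQi.mono_set (hST ρ hρ1)
  have hSfin : volume (S ρ) < ⊤ := by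
    rw [hSvol]; exact ENNReal.mul_lt_top ENNReal.ofReal_lt_top ENNReal.ofReal_lt_top
  set g : ℝ × ℝ → ℝ := fun p => 4 * K * B * (4 * μ / ρ ^ 2) + 4 * K * B / μ * Q p with hg
  have hgS : IntegrableOn g (S ρ) :=
    (integrableOn_const (hs := hSfin.ne)).add (hQS.const_mul _)
  have hQ0 : ∀ p, 0 ≤ Q p := fun p => by rw [hQ]; positivity
  have hg0 : ∀ p, 0 ≤ g p := fun p => by
    have := hQ0 p
    rw [hg]; positivity
  have hb : ∀ p ∈ Set.Icc ((-A, h) : ℝ × ℝ) (A, A),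
      ‖greenDensity W (hankelWave κ y) (discCutoff b ρ) p‖ ≤ (S ρ).indicator g p := by
    intro p hp
    have hpu : p ∈ upperProd := hh.trans_le hp.1.2
    have hpu' : 0 < p.2 := hpu
    set E := hankelWave κ y
    set t := deriv cutoff (distSq b p / ρ ^ 2) with ht
    rw [greenDensity, dFst_discCutoff, dSnd_discCutoff, ← ht]
    by_cases hsmall : 2 < distSq b p / ρ ^ 2
    · rw [ht, deriv_cutoff_eq_zero (Or.inr hsmall)]
      simp only [zero_mul, Complex.ofReal_zero, add_zero, norm_zero]
      exact Set.indicator_nonneg (fun p _ => hg0 p) p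
    · have hd : √(distSq b p) < 2 * ρ := by
        rw [not_lt, div_le_iff₀ (by positivity)] at hsmall
        rw [Real.sqrt_lt' (by positivity)]
        nlinarith [sq_pos_of_pos hρp]
      have h1 : |p.1 - b| < 2 * ρ := (abs_fst_sub_le b p).trans_lt hd
      have h2 : |p.2| < 2 * ρ := (abs_snd_le b p).trans_lt hd
      have hpS : p ∈ S ρ := by
        have e1 := abs_lt.1 h1
        have e2 := abs_lt.1 h2
        exact ⟨⟨by linarith, by linarith⟩, hpu', e2.2⟩
      rw [Set.indicator_of_mem hpS]
      obtain ⟨h3, h4, h5⟩ := hE p hpu (h1.trans hρ2) (h2.trans hρ2)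
      have ht' : |t| ≤ K := hKb _
      have ea : ‖E p * dFst W p - W p * dFst E p‖ ≤ B * (‖dFst W p‖ + ‖W p‖) := by
        refine (norm_sub_le _ _).trans ?_
        rw [norm_mul, norm_mul]
        nlinarith [norm_nonneg (dFst W p), norm_nonneg (W p)]
      have eb : ‖E p * dSnd W p - W p * dSnd E p‖ ≤ B * (‖dSnd W p‖ + ‖W p‖) := by
        refine (norm_sub_le _ _).trans ?_
        rw [norm_mul, norm_mul]
        nlinarith [norm_nonneg (dSnd W p), norm_nonneg (W p)]
      have ec : ∀ x : ℝ, |x| ≤ 2 * ρ →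
          ‖((t * (2 / ρ ^ 2) : ℝ) : ℂ) * (x : ℂ)‖ ≤ 4 * K / ρ := by
        intro x hx
        rw [norm_mul, Complex.norm_real, Complex.norm_real, Real.norm_eq_abs, Real.norm_eq_abs,
          abs_mul, abs_of_pos (show 0 < 2 / ρ ^ 2 by positivity)]
        calc |t| * (2 / ρ ^ 2) * |x| ≤ K * (2 / ρ ^ 2) * (2 * ρ) := by gcongr
          _ = 4 * K / ρ := by field_simp; ring
      have ey : ∀ a : ℝ, a / ρ ≤ μ / ρ ^ 2 + a ^ 2 / μ := by
        intro a
        rw [← sub_nonneg]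
        have : μ / ρ ^ 2 + a ^ 2 / μ - a / ρ =
            ((μ / ρ - a) ^ 2 + (μ / ρ) * a) / μ := by field_simp; ring
        rw [this]
        apply div_nonneg _ hμp.le
        nlinarith [sq_nonneg (μ / ρ - a), sq_nonneg (μ / ρ), sq_nonneg a,
          sq_nonneg (μ / ρ - a / 2)]
      calc _ ≤ 4 * K / ρ * (B * (‖dFst W p‖ + ‖W p‖)) + 4 * K / ρ * (B * (‖dSnd W p‖ + ‖W p‖)) := by
            refine (norm_add_le _ _).trans ?_
            rw [norm_mul _ (E p * dFst W p - W p * dFst E p),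
              norm_mul _ (E p * dSnd W p - W p * dSnd E p)]
            have := ec _ h1.le
            have := ec _ h2.le
            gcongr
        _ = 4 * K * B * (‖dFst W p‖ / ρ + ‖dSnd W p‖ / ρ + ‖W p‖ / ρ + ‖W p‖ / ρ) := by ring
        _ ≤ 4 * K * B * ((μ / ρ ^ 2 + ‖dFst W p‖ ^ 2 / μ) + (μ / ρ ^ 2 + ‖dSnd W p‖ ^ 2 / μ) +
              (μ / ρ ^ 2 + ‖W p‖ ^ 2 / μ) + (μ / ρ ^ 2 + ‖W p‖ ^ 2 / μ)) := by
            have e1 := ey ‖dFst W p‖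
            have e2 := ey ‖dSnd W p‖
            have e3 := ey ‖W p‖
            gcongr
        _ = g p := by rw [hg, hQ]; ring
  have hind : Integrable ((S ρ).indicator g) volume := hgS.integrable_indicator (hSm ρ)
  have hI := norm_integral_le_of_norm_le (μ := volume.restrict (Set.Icc ((-A, h) : ℝ × ℝ) (A, A)))
    (f := greenDensity W (hankelWave κ y) (discCutoff b ρ)) hind.restrict
    (by filter_upwards [ae_restrict_mem measurableSet_Icc] with p hp using hb p hp)
  refine hI.trans ((setIntegral_le_integral hind
    (Eventually.of_forall fun p => Set.indicator_nonneg (fun p _ => hg0 p) p)).trans ?_)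
  have hsum : ∫ p in S ρ, g p =
      volume.real (S ρ) * (4 * K * B * (4 * μ / ρ ^ 2)) + 4 * K * B / μ * ∫ p in S ρ, Q p := by
    have h1 : IntegrableOn (fun _ => 4 * K * B * (4 * μ / ρ ^ 2)) (S ρ) :=
      integrableOn_const (hs := hSfin.ne)
    have h2 := integral_add h1 (hQS.const_mul (4 * K * B / μ))
    rw [setIntegral_const, smul_eq_mul, integral_const_mul] at h2
    exact h2
  rw [integral_indicator (hSm ρ), hsum]
  have hv : volume.real (S ρ) = 8 * ρ ^ 2 := by
    rw [Measure.real, hSvol, ENNReal.toReal_mul, ENNReal.toReal_ofReal (by positivity),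
      ENNReal.toReal_ofReal (by positivity)]
    ring
  rw [hv]
  have e1 : 8 * ρ ^ 2 * (4 * K * B * (4 * μ / ρ ^ 2)) = η / 4 := by
    rw [hμ]; field_simp; norm_num
  have e2 : 4 * K * B / μ * ∫ p in S ρ, Q p ≤ 4 * K * B / μ * (η * μ / (8 * K * B)) := by
    gcongr
  have e3 : 4 * K * B / μ * (η * μ / (8 * K * B)) = η / 2 := by field_simp; norm_num
  linarith

/-! ### Boundary limits of the layer integrals -/

/-- The closed upper half-plane without the end points of the aperture. -/
def closedUpper (ε : ℝ) : Set (ℝ × ℝ) := {p | 0 ≤ p.2 ∧ p ≠ (0, 0) ∧ p ≠ (ε, 0)}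

/-- Only the two end points prevent a compactness argument, and χ vanishes on discs around them. -/
lemma exists_bound_mul_of_vanish {ε ρ A : ℝ} (hρ : 0 < ρ) {χ Z : ℝ × ℝ → ℂ} (hχ : Continuous χ)
    (hχ0 : ∀ p, distSq 0 p < ρ ^ 2 → χ p = 0) (hχε : ∀ p, distSq ε p < ρ ^ 2 → χ p = 0)
    (hZ : ContinuousOn Z (closedUpper ε)) :
    ∃ B : ℝ, 0 ≤ B ∧ ∀ p ∈ Set.Icc ((-A, 0) : ℝ × ℝ) (A, 1), ‖χ p * Z p‖ ≤ B := by
  have hK : IsCompact (Set.Icc ((-A, 0) : ℝ × ℝ) (A, 1) ∩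
      ({p | ρ ^ 2 ≤ distSq 0 p} ∩ {p | ρ ^ 2 ≤ distSq ε p})) :=
    isCompact_Icc.inter_right ((isClosed_le continuous_const (continuous_distSq 0)).inter
      (isClosed_le continuous_const (continuous_distSq ε)))
  have hsub : Set.Icc ((-A, 0) : ℝ × ℝ) (A, 1) ∩
      ({p | ρ ^ 2 ≤ distSq 0 p} ∩ {p | ρ ^ 2 ≤ distSq ε p}) ⊆ closedUpper ε := by
    rintro p ⟨hp, hp0, hpε⟩
    refine ⟨hp.1.2, ?_, ?_⟩
    · rintro rfl
      have : ρ ^ 2 ≤ 0 := by simpa [distSq] using hp0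
      nlinarith
    · rintro rfl
      have : ρ ^ 2 ≤ 0 := by simpa [distSq] using hpε
      nlinarith
  obtain ⟨B, hB⟩ := hK.exists_bound_of_continuousOn (hχ.continuousOn.mul (hZ.mono hsub))
  refine ⟨max B 0, le_max_right _ _, fun p hp => ?_⟩
  by_cases h0 : distSq 0 p < ρ ^ 2
  · rw [hχ0 p h0, zero_mul, norm_zero]; exact le_max_right _ _
  by_cases hε : distSq ε p < ρ ^ 2
  · rw [hχε p hε, zero_mul, norm_zero]; exact le_max_right _ _
  exact (hB p ⟨hp, not_lt.1 h0, not_lt.1 hε⟩).trans (le_max_left _ _)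

lemma closure_upperProd_mem {p : ℝ × ℝ} (hp : 0 ≤ p.2) : p ∈ closure upperProd := by
  have h1 : Tendsto (fun t : ℝ => (p.1, p.2 + t)) (𝓝[>] 0) (𝓝 p) := by
    have : Continuous fun t : ℝ => (p.1, p.2 + t) := by fun_prop
    have h := (this.tendsto 0).mono_left (nhdsWithin_le_nhds (s := Set.Ioi 0))
    simpa using h
  refine mem_closure_of_tendsto h1 ?_
  filter_upwards [self_mem_nhdsWithin] with t ht
  have : (0 : ℝ) < t := ht
  exact show 0 < p.2 + t by linarith

lemma continuous_line {G : ℝ × ℝ → ℂ} (hG : ContinuousOn G upperProd) {h : ℝ} (hh : 0 < h) :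
    Continuous fun s : ℝ => G (s, h) :=
  hG.comp_continuous (by fun_prop) fun _ => hh

lemma IsApertureField.continuousOn_dSnd {κ ε : ℝ} {c : ℂ} {W : ℝ × ℝ → ℂ}
    (hW : IsApertureField κ ε c W) : ContinuousOn (dSnd W) upperProd :=
  (contDiffOn_dSnd (m := 1) hW.contDiffOn le_rfl).continuousOn

/-- The prescribed boundary limits let the normal derivative extend continuously to the closed
half-plane minus the end points. Compactness then upgrades pointwise limits to the uniform bound
that dominated convergence needs. -/
lemma IsApertureField.exists_bound_mul_dSnd {κ ε ρ A : ℝ} {c : ℂ} {W : ℝ × ℝ → ℂ}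
    (hW : IsApertureField κ ε c W) (hρ : 0 < ρ) {χ : ℝ × ℝ → ℂ} (hχ : Continuous χ)
    (hχ0 : ∀ p, distSq 0 p < ρ ^ 2 → χ p = 0) (hχε : ∀ p, distSq ε p < ρ ^ 2 → χ p = 0) :
    ∃ B : ℝ, 0 ≤ B ∧ ∀ p ∈ Set.Icc ((-A, 0) : ℝ × ℝ) (A, 1), p ∈ upperProd →
      ‖χ p * dSnd W p‖ ≤ B := by
  have hext : ContinuousOn (extendFrom upperProd (dSnd W)) (closedUpper ε) := by
    refine continuousOn_extendFrom (fun p hp => closure_upperProd_mem hp.1) fun p hp => ?_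
    rcases hp.1.lt_or_eq with h | h
    · exact ⟨_, hW.continuousOn_dSnd p h⟩
    · have hp' : p = (p.1, 0) := by ext <;> simp [← h]
      rw [hp']
      by_cases h1 : p.1 ∈ Set.Icc 0 ε
      · refine ⟨c, hW.aperture p.1 ⟨lt_of_le_of_ne h1.1 fun e => ?_, lt_of_le_of_ne h1.2 fun e => ?_⟩⟩
        · exact hp.2.1 (by rw [hp', ← e])
        · exact hp.2.2 (by rw [hp', e])
      · exact ⟨0, hW.neumann p.1 h1⟩
  obtain ⟨B, hB0, hB⟩ := exists_bound_mul_of_vanish (A := A) hρ hχ hχ0 hχε hext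
  refine ⟨B, hB0, fun p hp hpu => ?_⟩
  have := hB p hp
  rwa [extendFrom_eq (subset_closure hpu) (hW.continuousOn_dSnd p hpu)] at this

lemma intervalIntegrable_inv_sqrt_abs (a b : ℝ) :
    IntervalIntegrable (fun x : ℝ => 1 / √|x|) volume a b := by
  have hpos : ∀ M : ℝ, 0 ≤ M → IntervalIntegrable (fun x : ℝ => 1 / √|x|) volume 0 M := by
    intro M hM
    refine (intervalIntegral.intervalIntegrable_rpow' (r := -(1 / 2)) (a := 0) (b := M)
      (by norm_num)).congr_ae ?_
    rw [Set.uIoc_of_le hM]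
    filter_upwards [ae_restrict_mem measurableSet_Ioc] with x hx
    rw [abs_of_pos hx.1, rpow_neg_half_eq hx.1]
  have h0 : ∀ M : ℝ, IntervalIntegrable (fun x : ℝ => 1 / √|x|) volume 0 M := by
    intro M
    rcases le_total 0 M with h | h
    · exact hpos M h
    · rw [IntervalIntegrable.iff_comp_neg]
      simpa using hpos (-M) (by linarith)
  exact (h0 a).symm.trans (h0 b)

/-- The z^{-1/2} bound decreases in z, so its value on the boundary line dominates the wave at every
height above it, and it is locally integrable in x. -/
lemma norm_hankelMoment_zero_le_of_le {κ x z : ℝ} (hκ : 0 < κ) (hx : 0 < |x|) (hz : κ * |x| ≤ z) :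
    ‖hankelMoment 0 z‖ ≤ Real.Gamma (1 / 2) / √κ * (1 / √|x|) := by
  have h1 : 0 < κ * |x| := by positivity
  have hΓ : 0 < Real.Gamma (1 / 2) := Real.Gamma_pos_of_pos (by norm_num)
  refine (norm_hankelMoment_zero_le (h1.trans_le hz)).trans ?_
  rw [rpow_neg_half_eq (h1.trans_le hz)]
  calc Real.Gamma (1 / 2) * (1 / √z) ≤ Real.Gamma (1 / 2) * (1 / √(κ * |x|)) := by gcongr
    _ = _ := by rw [Real.sqrt_mul hκ.le]; ring

lemma intervalIntegrable_bound (κ y a b : ℝ) :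
    IntervalIntegrable (fun s : ℝ => Real.Gamma (1 / 2) / √κ * (1 / √|s - y|)) volume a b := by
  have h := ((intervalIntegrable_inv_sqrt_abs (a - y) (b - y)).comp_sub_right y)
  simp only [sub_add_cancel] at h
  exact h.const_mul _

lemma ae_ne (y : ℝ) : ∀ᵐ s : ℝ, s ≠ y := by
  rw [ae_iff]; simp

/-- Boundary limit of the single-layer part of Green's identity. -/
lemma IsApertureField.tendsto_single_layer {κ ε ρ A y : ℝ} {c : ℂ} {W : ℝ × ℝ → ℂ} (hκ : 0 < κ)
    (hε : 0 < ε) (hW : IsApertureField κ ε c W) (hρ : 0 < ρ) {χ : ℝ × ℝ → ℂ} (hχ : Continuous χ)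
    (hχ0 : ∀ p, distSq 0 p < ρ ^ 2 → χ p = 0) (hχε : ∀ p, distSq ε p < ρ ^ 2 → χ p = 0)
    (hA : ε < A) :
    Tendsto (fun h => ∫ s in (-A)..A, χ (s, h) * (hankelWave κ y (s, h) * dSnd W (s, h)))
      (𝓝[>] 0) (𝓝 (c * ∫ t in (0 : ℝ)..ε, χ (t, 0) * hankelMoment 0 (κ * |t - y|))) := by
  obtain ⟨B, hB0, hB⟩ := hW.exists_bound_mul_dSnd (A := A) hρ hχ hχ0 hχε
  have hlim : ∫ s in (-A)..A, (Set.Ioo 0 ε).indicator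
      (fun t => c * (χ (t, 0) * hankelMoment 0 (κ * |t - y|))) s =
      c * ∫ t in (0 : ℝ)..ε, χ (t, 0) * hankelMoment 0 (κ * |t - y|) := by
    rw [intervalIntegral.integral_of_le (by linarith), setIntegral_indicator measurableSet_Ioo,
      Set.inter_eq_right.2 (show Set.Ioo 0 ε ⊆ Set.Ioc (-A) A from
        fun t ht => ⟨by linarith [ht.1], by linarith [ht.2]⟩),
      ← integral_Ioc_eq_integral_Ioo, ← intervalIntegral.integral_of_le hε.le,
      intervalIntegral.integral_const_mul]
  rw [← hlim]
  refine intervalIntegral.tendsto_integral_filter_of_dominated_convergence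
    (fun s => B * (Real.Gamma (1 / 2) / √κ * (1 / √|s - y|))) ?_ ?_
    ((intervalIntegrable_bound κ y _ _).const_mul B) ?_
  · filter_upwards [self_mem_nhdsWithin] with h hh
    refine Continuous.aestronglyMeasurable ?_
    exact (hχ.comp (by fun_prop)).mul ((continuous_line (contDiffOn_hankelWave hκ y 0).continuousOn
      hh).mul (continuous_line hW.continuousOn_dSnd hh))
  · filter_upwards [Ioo_mem_nhdsGT (zero_lt_one' ℝ)] with h hh
    filter_upwards [ae_ne y] with s hs hsA
    rw [Set.uIoc_of_le (by linarith)] at hsA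
    have h1 := hB (s, h) ⟨⟨hsA.1.le, hh.1.le⟩, ⟨hsA.2, hh.2.le⟩⟩ hh.1
    have h2 : ‖hankelWave κ y (s, h)‖ ≤ Real.Gamma (1 / 2) / √κ * (1 / √|s - y|) := by
      refine norm_hankelMoment_zero_le_of_le hκ (abs_pos.2 (sub_ne_zero.2 hs)) ?_
      have := abs_fst_sub_le y (s, h)
      gcongr
    calc _ = ‖χ (s, h) * dSnd W (s, h)‖ * ‖hankelWave κ y (s, h)‖ := by
          rw [← norm_mul]; congr 1; ring
      _ ≤ _ := by gcongr
  · filter_upwards [ae_ne y, ae_ne 0, ae_ne ε] with s hsy hs0 hsε _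
    have hline : Tendsto (fun h : ℝ => (s, h)) (𝓝[>] 0) (𝓝[upperProd] (s, 0)) := by
      refine tendsto_nhdsWithin_iff.2 ⟨?_, ?_⟩
      · have : Continuous fun h : ℝ => (s, h) := by fun_prop
        exact (this.tendsto 0).mono_left nhdsWithin_le_nhds
      · filter_upwards [self_mem_nhdsWithin] with h hh using hh
    have hχl : Tendsto (fun h : ℝ => χ (s, h)) (𝓝[>] 0) (𝓝 (χ (s, 0))) :=
      (hχ.tendsto (s, 0)).comp (hline.mono_right nhdsWithin_le_nhds)
    have hEl : Tendsto (fun h : ℝ => hankelWave κ y (s, h)) (𝓝[>] 0)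
        (𝓝 (hankelMoment 0 (κ * |s - y|))) := by
      have hpos : 0 < κ * |s - y| := mul_pos hκ (abs_pos.2 (sub_ne_zero.2 hsy))
      have h1 := (hasDerivAt_hankelMoment 0 hpos).continuousAt.tendsto
      have h2 : Tendsto (fun h : ℝ => κ * √(distSq y (s, h))) (𝓝[>] 0) (𝓝 (κ * |s - y|)) := by
        have h3 : Continuous fun h : ℝ => κ * √(distSq y (s, h)) := by
          have := continuous_distSq y
          fun_prop
        have h4 := (h3.tendsto 0).mono_left (nhdsWithin_le_nhds (s := Set.Ioi 0))
        rwa [show distSq y (s, 0) = (s - y) ^ 2 by simp [distSq], Real.sqrt_sq_eq_abs] at h4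
      exact h1.comp h2
    by_cases hmem : s ∈ Set.Ioo 0 ε
    · rw [Set.indicator_of_mem hmem]
      have := hχl.mul (hEl.mul ((hW.aperture s hmem).comp hline))
      rwa [show χ (s, 0) * (hankelMoment 0 (κ * |s - y|) * c) =
        c * (χ (s, 0) * hankelMoment 0 (κ * |s - y|)) by ring] at this
    · rw [Set.indicator_of_notMem hmem]
      have hn : s ∉ Set.Icc 0 ε := fun h =>
        hmem ⟨lt_of_le_of_ne h.1 (Ne.symm hs0), lt_of_le_of_ne h.2 hsε⟩
      have := hχl.mul (hEl.mul ((hW.neumann s hn).comp hline))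
      rwa [mul_zero, mul_zero] at this

/-- The scaling s = y + hu exposes the Poisson profile 1/(1 + u²), multiplied by -z · `hankelMoment
1 z` at z = κh√(1 + u²). That factor tends to -1 as h → 0. -/
lemma mul_dSnd_hankelWave {κ y h : ℝ} (hκ : 0 < κ) (hh : 0 < h) (u : ℝ) :
    h * dSnd (hankelWave κ y) (y + h * u, h) =
      -((κ * (h * √(1 + u ^ 2)) : ℝ) * hankelMoment 1 (κ * (h * √(1 + u ^ 2)))) *
        (((1 + u ^ 2)⁻¹ : ℝ) : ℂ) := by
  have hq : distSq y (y + h * u, h) = (h * √(1 + u ^ 2)) ^ 2 := by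
    rw [mul_pow, Real.sq_sqrt (by positivity), distSq]; ring
  rw [dSnd_hankelWave hκ y (p := (y + h * u, h)) hh, hankelSlope, hq,
    Real.sqrt_sq (by positivity)]
  have h1 : (√(1 + u ^ 2) : ℂ) ≠ 0 := by
    exact_mod_cast (Real.sqrt_pos.2 (show 0 < 1 + u ^ 2 by positivity)).ne'
  have h2 : (h : ℂ) ≠ 0 := by exact_mod_cast hh.ne'
  have h3 : ((1 + u ^ 2 : ℝ) : ℂ) = (√(1 + u ^ 2) : ℂ) ^ 2 := by
    rw [← Complex.ofReal_pow, Real.sq_sqrt (by positivity)]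
  rw [Complex.ofReal_inv, h3]
  push_cast
  field_simp

/-- Boundary limit of the double-layer part of Green's identity. -/
lemma IsApertureField.tendsto_double_layer {κ ε ρ A y : ℝ} {c : ℂ} {W : ℝ × ℝ → ℂ} (hκ : 0 < κ)
    (hW : IsApertureField κ ε c W) (hρ : 0 < ρ) {χ : ℝ × ℝ → ℂ} (hχ : Continuous χ)
    (hχ0 : ∀ p, distSq 0 p < ρ ^ 2 → χ p = 0) (hχε : ∀ p, distSq ε p < ρ ^ 2 → χ p = 0)
    (hy : y ∈ Set.Ioo 0 ε) (hA : ε < A) :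
    Tendsto (fun h => ∫ s in (-A)..A, χ (s, h) * (W (s, h) * dSnd (hankelWave κ y) (s, h)))
      (𝓝[>] 0) (𝓝 (-(Real.pi * (χ (y, 0) * W (y, 0))))) := by
  obtain ⟨B, hB0, hB⟩ := exists_bound_mul_of_vanish (A := A) hρ hχ hχ0 hχε hW.continuousOn
  obtain ⟨K, hK, hKb⟩ := exists_norm_mul_hankelMoment_one_le
  have hA0 : 0 < A := by linarith [hy.1, hy.2]
  -- The rescaled integrand; the indicator keeps the domain of integration equal to ℝ for every h.
  set Φ : ℝ → ℝ → ℂ := fun h u =>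
    (Set.Ioc (-A) A).indicator (fun s => χ (s, h) * W (s, h)) (y + h * u) *
      (-((κ * (h * √(1 + u ^ 2)) : ℝ) * hankelMoment 1 (κ * (h * √(1 + u ^ 2)))) *
        (((1 + u ^ 2)⁻¹ : ℝ) : ℂ)) with hΦ
  have hsubst : ∀ h : ℝ, 0 < h →
      ∫ s in (-A)..A, χ (s, h) * (W (s, h) * dSnd (hankelWave κ y) (s, h)) = ∫ u, Φ h u := by
    intro h hh
    set φ : ℝ → ℂ := fun s => (Set.Ioc (-A) A).indicator (fun s => χ (s, h) * W (s, h)) s *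
      dSnd (hankelWave κ y) (s, h) with hφ
    have h1 : ∫ s in (-A)..A, χ (s, h) * (W (s, h) * dSnd (hankelWave κ y) (s, h)) =
        ∫ s, φ s := by
      rw [intervalIntegral.integral_of_le (by linarith), ← integral_indicator measurableSet_Ioc]
      congr 1
      ext s
      simp only [hφ, Set.indicator]
      split_ifs <;> ring
    have h2 : ∫ u, φ (y + h * u) = |h⁻¹| • ∫ s, φ s := by
      rw [Measure.integral_comp_mul_left (fun s => φ (y + s)) h, integral_add_left_eq_self]
    have h3 : ∀ u, Φ h u = (h : ℂ) * φ (y + h * u) := fun u => by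
      simp only [hΦ, hφ]
      rw [← mul_dSnd_hankelWave hκ hh u]
      ring
    rw [h1]
    simp only [h3]
    rw [integral_const_mul, h2, abs_of_pos (by positivity), Complex.real_smul]
    have : (h : ℂ) ≠ 0 := by exact_mod_cast hh.ne'
    push_cast
    field_simp
  have hlim : Tendsto (fun h => ∫ u, Φ h u) (𝓝[>] 0)
      (𝓝 (∫ u : ℝ, χ (y, 0) * W (y, 0) * (-1 * (((1 + u ^ 2)⁻¹ : ℝ) : ℂ)))) := by
    refine tendsto_integral_filter_of_dominated_convergence
      (fun u => B * (K * (1 + √(κ * (2 * A + 1)))) * (1 + u ^ 2)⁻¹) ?_ ?_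
      (integrable_inv_one_add_sq.const_mul _) ?_
    · filter_upwards [self_mem_nhdsWithin] with h hh
      have hh : 0 < h := hh
      have hc1 : Continuous fun s => χ (s, h) * W (s, h) :=
        (hχ.comp (by fun_prop)).mul (continuous_line hW.contDiffOn.continuousOn hh)
      have hm1 : Measurable fun u => (Set.Ioc (-A) A).indicator
          (fun s => χ (s, h) * W (s, h)) (y + h * u) :=
        (hc1.measurable.indicator measurableSet_Ioc).comp (by fun_prop)
      have hc2 : Continuous fun u : ℝ => hankelMoment 1 (κ * (h * √(1 + u ^ 2))) :=
        (continuousOn_hankelMoment 1).comp_continuous (by fun_prop)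
          fun u => by
            have : 0 < √(1 + u ^ 2) := Real.sqrt_pos.2 (by positivity)
            exact Set.mem_Ioi.2 (by positivity)
      have hm2 := hc2.measurable
      refine Measurable.aestronglyMeasurable ?_
      simp only [hΦ]
      fun_prop
    · filter_upwards [Ioo_mem_nhdsGT (zero_lt_one' ℝ)] with h hh
      refine Eventually.of_forall fun u => ?_
      have hinv : 0 < (1 + u ^ 2)⁻¹ := by positivity
      simp only [hΦ]
      by_cases hmem : y + h * u ∈ Set.Ioc (-A) A
      · rw [Set.indicator_of_mem hmem, norm_mul _ (_ * _), norm_mul (-_), norm_neg,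
          Complex.norm_real ((1 + u ^ 2)⁻¹), Real.norm_of_nonneg hinv.le, ← mul_assoc]
        have hz : 0 < κ * (h * √(1 + u ^ 2)) := by
          have : 0 < √(1 + u ^ 2) := Real.sqrt_pos.2 (by positivity)
          have := hh.1
          positivity
        have h1 := hKb _ hz
        have h2 := hB (y + h * u, h) ⟨⟨hmem.1.le, hh.1.le⟩, ⟨hmem.2, hh.2.le⟩⟩
        -- On the support of the indicator h|u| ≤ 2A, and h < 1; this makes the factor z ·
        -- `hankelMoment 1 z` uniformly bounded.
        have h3 : h * √(1 + u ^ 2) ≤ 2 * A + 1 := by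
          have e1 : |h * u| ≤ 2 * A := by
            rw [abs_le]; constructor <;> linarith [hmem.1, hmem.2, hy.1, hy.2]
          have e2 : √(1 + u ^ 2) ≤ 1 + |u| := by
            rw [Real.sqrt_le_left (by positivity)]
            nlinarith [sq_abs u, abs_nonneg u]
          rw [abs_mul, abs_of_pos hh.1] at e1
          nlinarith [hh.1, hh.2]
        have h4 : √(κ * (h * √(1 + u ^ 2))) ≤ √(κ * (2 * A + 1)) := by gcongr
        gcongr
        exact h1.trans (by gcongr)
      · rw [Set.indicator_of_notMem hmem, zero_mul, norm_zero]
        positivity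
    · refine Eventually.of_forall fun u => ?_
      have hpt : Tendsto (fun h : ℝ => (y + h * u, h)) (𝓝[>] 0) (𝓝 (y, 0)) := by
        have : Continuous fun h : ℝ => (y + h * u, h) := by fun_prop
        have h := (this.tendsto 0).mono_left (nhdsWithin_le_nhds (s := Set.Ioi 0))
        simpa using h
      have hpos : ∀ᶠ h in 𝓝[>] (0 : ℝ), 0 < h := self_mem_nhdsWithin
      have hyc : ((y, 0) : ℝ × ℝ) ∈ closedUpper ε :=
        ⟨le_rfl, by simpa using hy.1.ne', by simpa using hy.2.ne⟩
      have hpt' : Tendsto (fun h : ℝ => (y + h * u, h)) (𝓝[>] 0) (𝓝[closedUpper ε] (y, 0)) := by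
        refine tendsto_nhdsWithin_iff.2 ⟨hpt, ?_⟩
        filter_upwards [hpos] with h hh
        refine ⟨hh.le, ?_, ?_⟩ <;> intro e <;> exact hh.ne' (congrArg Prod.snd e)
      have hVl := ((hχ.tendsto (y, 0)).comp hpt).mul ((hW.continuousOn (y, 0) hyc).tendsto.comp hpt')
      have hz : Tendsto (fun h : ℝ => κ * (h * √(1 + u ^ 2))) (𝓝[>] 0) (𝓝[>] 0) := by
        refine tendsto_nhdsWithin_iff.2 ⟨?_, ?_⟩
        · have : Continuous fun h : ℝ => κ * (h * √(1 + u ^ 2)) := by fun_prop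
          have h := (this.tendsto 0).mono_left (nhdsWithin_le_nhds (s := Set.Ioi 0))
          simpa using h
        · filter_upwards [hpos] with h hh
          have : 0 < √(1 + u ^ 2) := Real.sqrt_pos.2 (by positivity)
          exact Set.mem_Ioi.2 (by positivity)
      have hMl := ((tendsto_mul_hankelMoment_one.comp hz).neg).mul_const (((1 + u ^ 2)⁻¹ : ℝ) : ℂ)
      have hind : ∀ᶠ h in 𝓝[>] (0 : ℝ), y + h * u ∈ Set.Ioc (-A) A := by
        have h1 : Tendsto (fun h : ℝ => y + h * u) (𝓝[>] 0) (𝓝 y) :=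
          (continuous_fst.tendsto _).comp hpt
        exact h1.eventually (Ioc_mem_nhds (by linarith [hy.1]) (by linarith [hy.2]))
      refine (hVl.mul hMl).congr' ?_
      filter_upwards [hind] with h hh
      simp only [hΦ, Function.comp]
      rw [Set.indicator_of_mem hh]
  have hval : ∫ u : ℝ, χ (y, 0) * W (y, 0) * (-1 * (((1 + u ^ 2)⁻¹ : ℝ) : ℂ)) =
      -(Real.pi * (χ (y, 0) * W (y, 0))) := by
    rw [integral_const_mul, integral_const_mul, integral_complex_ofReal,
      integral_univ_inv_one_add_sq]
    ring
  rw [hval] at hlim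
  refine hlim.congr' ?_
  filter_upwards [self_mem_nhdsWithin] with h hh
  exact (hsubst h hh).symm

/-! ### The representation formula on the aperture -/

lemma discCutoff_eq_one {b ρ : ℝ} (hρ : 0 < ρ) {p : ℝ × ℝ} (h : √(distSq b p) ≤ ρ) :
    discCutoff b ρ p = 1 := by
  rw [discCutoff, cutoff_of_le_one, Complex.ofReal_one]
  rw [div_le_one (by positivity)]
  exact (Real.sqrt_le_left hρ.le).1 h

lemma discCutoff_eq_zero {b ρ : ℝ} (hρ : 0 < ρ) {p : ℝ × ℝ} (h : 2 * ρ ≤ √(distSq b p)) :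
    discCutoff b ρ p = 0 := by
  rw [discCutoff, cutoff_of_two_le, Complex.ofReal_zero]
  rw [le_div_iff₀ (by positivity)]
  have := (Real.le_sqrt (by positivity) (distSq_nonneg b p)).1 h
  nlinarith [sq_nonneg ρ]

lemma norm_discCutoff_le (b ρ : ℝ) (p : ℝ × ℝ) : ‖discCutoff b ρ p‖ ≤ 1 := by
  rw [discCutoff, Complex.norm_real, Real.norm_of_nonneg (cutoff_nonneg _)]
  exact cutoff_le_one _

/-- The cutoff to a large disc from which the discs around the end points are removed. -/
def apertureCutoff (ε R ρ : ℝ) (p : ℝ × ℝ) : ℂ :=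
  discCutoff 0 R p - discCutoff 0 ρ p - discCutoff ε ρ p

lemma continuous_apertureCutoff (ε R ρ : ℝ) : Continuous (apertureCutoff ε R ρ) :=
  (((contDiff_discCutoff 0 R (n := 1)).continuous.sub
    (contDiff_discCutoff 0 ρ (n := 1)).continuous).sub
      (contDiff_discCutoff ε ρ (n := 1)).continuous)

lemma sqrt_distSq_boundary (b t : ℝ) : √(distSq b (t, 0)) = |t - b| := by
  rw [show distSq b (t, 0) = (t - b) ^ 2 by simp [distSq], Real.sqrt_sq_eq_abs]

/-- Near 0 the large cutoff and the small one at 0 both equal 1 and cancel; 4ρ < ε puts the point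
outside the support of the other small cutoff. -/
lemma apertureCutoff_near_zero {ε R ρ : ℝ} (hρ : 0 < ρ) (hρε : 4 * ρ < ε) (hρR : ρ ≤ R)
    {p : ℝ × ℝ} (hp : distSq 0 p < ρ ^ 2) : apertureCutoff ε R ρ p = 0 := by
  have h1 : √(distSq 0 p) < ρ := (Real.sqrt_lt' hρ).2 hp
  have h3 : ε ≤ √(distSq ε p) + √(distSq 0 p) := by
    have e1 := abs_fst_sub_le ε p
    have e2 := abs_fst_sub_le 0 p
    rw [sub_zero] at e2
    linarith [neg_abs_le (p.1 - ε), le_abs_self p.1]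
  rw [apertureCutoff, discCutoff_eq_one (hρ.trans_le hρR) (by linarith),
    discCutoff_eq_one hρ h1.le, discCutoff_eq_zero hρ (by linarith)]
  ring

lemma apertureCutoff_near_end {ε R ρ : ℝ} (hρ : 0 < ρ) (hρε : 4 * ρ < ε) (hρR : ε + ρ ≤ R)
    {p : ℝ × ℝ} (hp : distSq ε p < ρ ^ 2) : apertureCutoff ε R ρ p = 0 := by
  have h1 : √(distSq ε p) < ρ := (Real.sqrt_lt' hρ).2 hp
  have h2 := abs_sub_le_iff.1 (abs_sqrt_distSq_sub_le ε p)
  rw [abs_of_pos (by linarith)] at h2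
  have h3 : ε ≤ √(distSq ε p) + √(distSq 0 p) := by
    have e1 := abs_fst_sub_le ε p
    have e2 := abs_fst_sub_le 0 p
    rw [sub_zero] at e2
    linarith [neg_abs_le (p.1 - ε), le_abs_self p.1]
  rw [apertureCutoff, discCutoff_eq_one (by linarith) (by linarith [h2.2]),
    discCutoff_eq_one hρ h1.le, discCutoff_eq_zero (b := 0) hρ (by linarith)]
  ring

lemma apertureCutoff_eq_one {ε R ρ t : ℝ} (hρ : 0 < ρ) (ht : 2 * ρ ≤ t) (htε : 2 * ρ ≤ ε - t)
    (hR : ε ≤ R) : apertureCutoff ε R ρ (t, 0) = 1 := by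
  have h1 : √(distSq 0 (t, 0)) = t := by
    rw [sqrt_distSq_boundary, sub_zero, abs_of_pos (by linarith)]
  have h2 : √(distSq ε (t, 0)) = ε - t := by
    rw [sqrt_distSq_boundary, abs_sub_comm, abs_of_pos (by linarith)]
  rw [apertureCutoff, discCutoff_eq_one (by linarith) (by rw [h1]; linarith),
    discCutoff_eq_zero hρ (by rw [h1]; linarith), discCutoff_eq_zero hρ (by rw [h2]; linarith)]
  ring

lemma intervalIntegrable_hankelMoment_zero {κ : ℝ} (hκ : 0 < κ) (y a b : ℝ) :
    IntervalIntegrable (fun t => hankelMoment 0 (κ * |t - y|)) volume a b := by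
  have hm : AEStronglyMeasurable (fun t : ℝ => hankelMoment 0 (κ * |t - y|)) volume := by
    have hc : ContinuousOn (fun t : ℝ => hankelMoment 0 (κ * |t - y|)) {y}ᶜ :=
      (continuousOn_hankelMoment 0).comp (by fun_prop) fun t ht =>
        mul_pos hκ (abs_pos.2 (sub_ne_zero.2 ht))
    have h1 := hc.aestronglyMeasurable (μ := volume) (measurableSet_singleton y).compl
    rwa [Measure.restrict_eq_self_of_ae_mem (show ∀ᵐ t : ℝ, t ∈ ({y}ᶜ : Set ℝ) from ae_ne y)]
      at h1
  refine (intervalIntegrable_bound κ y a b).mono_fun hm.restrict ?_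
  filter_upwards [ae_restrict_of_ae (ae_ne y)] with t ht
  refine (norm_hankelMoment_zero_le_of_le hκ (abs_pos.2 (sub_ne_zero.2 ht)) le_rfl).trans
    (le_abs_self _)

lemma tendsto_integral_apertureCutoff {κ ε R : ℝ} (hκ : 0 < κ) (hR : ε ≤ R) (hε : 0 < ε) (y : ℝ) :
    Tendsto (fun ρ => ∫ t in (0 : ℝ)..ε, apertureCutoff ε R ρ (t, 0) *
        hankelMoment 0 (κ * |t - y|)) (𝓝[>] 0)
      (𝓝 (∫ t in (0 : ℝ)..ε, hankelMoment 0 (κ * |t - y|))) := by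
  have hInt := intervalIntegrable_hankelMoment_zero hκ y 0 ε
  refine intervalIntegral.tendsto_integral_filter_of_dominated_convergence
    (fun t => 3 * ‖hankelMoment 0 (κ * |t - y|)‖) ?_ ?_ (hInt.norm.const_mul 3) ?_
  · refine Eventually.of_forall fun ρ => AEStronglyMeasurable.mul ?_ ?_
    · exact ((continuous_apertureCutoff ε R ρ).comp (by fun_prop)).aestronglyMeasurable
    · rw [Set.uIoc_of_le hε.le]
      exact hInt.1.aestronglyMeasurable
  · refine Eventually.of_forall fun ρ => Eventually.of_forall fun t _ => ?_
    rw [norm_mul]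
    gcongr
    refine (norm_sub_le _ _).trans ?_
    have := norm_sub_le (discCutoff 0 R (t, 0)) (discCutoff 0 ρ (t, 0))
    linarith [norm_discCutoff_le 0 R (t, 0), norm_discCutoff_le 0 ρ (t, 0),
      norm_discCutoff_le ε ρ (t, 0)]
  · filter_upwards [ae_ne ε] with t htε ht
    rw [Set.uIoc_of_le hε.le] at ht
    have ht2 : t < ε := lt_of_le_of_ne ht.2 htε
    refine tendsto_const_nhds.congr' ?_
    have hlt : ∀ᶠ ρ in 𝓝[>] (0 : ℝ), ρ < min (t / 2) ((ε - t) / 2) :=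
      (gt_mem_nhds (lt_min (by linarith [ht.1]) (by linarith))).filter_mono nhdsWithin_le_nhds
    filter_upwards [hlt, self_mem_nhdsWithin] with ρ hρ hρp
    have h1 := hρ.trans_le (min_le_left _ _)
    have h2 := hρ.trans_le (min_le_right _ _)
    rw [apertureCutoff_eq_one hρp (by linarith) (by linarith) hR, one_mul]

/-- Representation of the boundary values of a radiating field by its Neumann data. -/
theorem IsApertureField.trace_eq {κ ε y : ℝ} {c : ℂ} {W : ℝ × ℝ → ℂ} (hκ : 0 < κ) (hε : 0 < ε)
    (hW : IsApertureField κ ε c W) (hy : y ∈ Set.Ioo 0 ε) :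
    c * (∫ t in (0 : ℝ)..ε, hankelMoment 0 (κ * |t - y|)) + Real.pi * W (y, 0) = 0 := by
  rw [← norm_le_zero_iff]
  refine le_of_forall_pos_le_add fun η' hη' => ?_
  -- One share for removing the cutoff from the aperture integral and one for each of the three bulk
  -- terms.
  set η := η' / 4 with hη
  have hηp : 0 < η := by positivity
  obtain ⟨R₀, hR₀⟩ := hW.far_bulk hκ hε y hηp
  set R := max R₀ (ε + 1) with hR
  have hRε : ε + 1 ≤ R := le_max_right _ _
  have hfar := hR₀ R (le_max_left _ _)
  have hy0 := hy.1
  have hyε := hy.2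
  have hρlt : ∀ᶠ ρ in 𝓝[>] (0 : ℝ), ρ < min (min (y / 2) ((ε - y) / 2)) (1 / 2) :=
    (gt_mem_nhds (lt_min (lt_min (by linarith) (by linarith)) (by norm_num))).filter_mono
      nhdsWithin_le_nhds
  have hIlim := ((tendsto_integral_apertureCutoff (R := R) hκ (by linarith) hε y).const_mul c)
  have hI := (Metric.tendsto_nhds.1 hIlim) η hηp
  -- R is fixed before ρ. The near bounds hold for every rectangle and height, so one ρ serves
  -- throughout the limit h → 0.
  obtain ⟨ρ, ⟨⟨⟨⟨hn0, hnε⟩, hρl⟩, hρp⟩, hIρ⟩⟩ :=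
    ((((hW.near_bulk hκ hy.1.ne' hηp).and (hW.near_bulk hκ hy.2.ne hηp)).and hρlt).and
      (self_mem_nhdsWithin)).and hI |>.exists
  have hρp : 0 < ρ := hρp
  have hρ1 := hρl.trans_le ((min_le_left _ _).trans (min_le_left _ _))
  have hρ2 := hρl.trans_le ((min_le_left _ _).trans (min_le_right _ _))
  have hρ3 := hρl.trans_le (min_le_right _ _)
  set χ := apertureCutoff ε R ρ with hχ
  set E := hankelWave κ y with hEdef
  have hχc : Continuous χ := continuous_apertureCutoff ε R ρ
  have hχ0 : ∀ p, distSq 0 p < ρ ^ 2 → χ p = 0 := fun p hp =>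
    apertureCutoff_near_zero hρp (by linarith) (by linarith) hp
  have hχε : ∀ p, distSq ε p < ρ ^ 2 → χ p = 0 := fun p hp =>
    apertureCutoff_near_end hρp (by linarith) (by linarith) hp
  have hA : ε < 2 * R := by linarith
  have hχy : χ (y, 0) = 1 := apertureCutoff_eq_one hρp (by linarith) (by linarith) (by linarith)
  have hlim := (hW.tendsto_single_layer (y := y) hκ hε hρp hχc hχ0 hχε hA).sub
    (hW.tendsto_double_layer hκ hρp hχc hχ0 hχε hy hA)
  rw [hχy, one_mul, sub_neg_eq_add] at hlim
  have hE2 : ContDiffOn ℝ (2 : ℕ∞) E upperProd := contDiffOn_hankelWave hκ y 2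
  have hEc : ContinuousOn E upperProd := hE2.continuousOn
  have hEdc : ContinuousOn (dSnd E) upperProd :=
    (contDiffOn_dSnd (m := 1) hE2 le_rfl).continuousOn
  have hgreen : ∀ b σ h : ℝ, 0 < h → h ≤ 2 * R → 0 < σ →
      (∀ p : ℝ × ℝ, p.1 = -(2 * R) ∨ p.1 = 2 * R ∨ p.2 = 2 * R → 2 * σ ≤ √(distSq b p)) →
      ∫ s in (-(2 * R))..(2 * R), discCutoff b σ (s, h) *
        (E (s, h) * dSnd W (s, h) - W (s, h) * dSnd E (s, h)) =
      -∫ p in Set.Icc ((-(2 * R), h) : ℝ × ℝ) (2 * R, 2 * R),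
        greenDensity W E (discCutoff b σ) p := fun b σ h hh hhR hσ hb =>
    green_identity (k := (κ : ℂ) ^ 2) hW.contDiffOn hE2 (contDiff_discCutoff b σ).contDiffOn
      hW.helmholtz (fun p hp => hankelWave_helmholtz hκ y hp) hh hhR
      fun p hp => discCutoff_eq_zero hσ (hb p hp)
  have hedge : ∀ b σ : ℝ, 0 ≤ b → b ≤ ε → 2 * σ ≤ 2 * R - b →
      ∀ p : ℝ × ℝ, p.1 = -(2 * R) ∨ p.1 = 2 * R ∨ p.2 = 2 * R → 2 * σ ≤ √(distSq b p) := by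
    intro b σ hb0 hbε hσ p hp
    have e1 := abs_fst_sub_le b p
    have e2 := abs_snd_le b p
    rcases hp with hp | hp | hp
    · linarith [neg_abs_le (p.1 - b)]
    · linarith [le_abs_self (p.1 - b)]
    · linarith [le_abs_self p.2]
  have hbound : ∀ᶠ h in 𝓝[>] (0 : ℝ),
      ‖(∫ s in (-(2 * R))..(2 * R), χ (s, h) * (E (s, h) * dSnd W (s, h))) -
        ∫ s in (-(2 * R))..(2 * R), χ (s, h) * (W (s, h) * dSnd E (s, h))‖ ≤ 3 * η := by
    filter_upwards [Ioo_mem_nhdsGT (show (0 : ℝ) < 2 * R by linarith)] with h hh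
    have c1 := continuous_line hEc hh.1
    have c2 := continuous_line hEdc hh.1
    have c3 := continuous_line hW.continuousOn_dSnd hh.1
    have c4 := continuous_line hW.contDiffOn.continuousOn hh.1
    have c5 : Continuous fun s : ℝ => χ (s, h) := hχc.comp (by fun_prop)
    have c6 : ∀ b σ : ℝ, IntervalIntegrable (fun s => discCutoff b σ (s, h) *
        (E (s, h) * dSnd W (s, h) - W (s, h) * dSnd E (s, h))) volume (-(2 * R)) (2 * R) :=
      fun b σ => Continuous.intervalIntegrable
        ((((contDiff_discCutoff b σ (n := 1)).continuous).comp (by fun_prop)).mul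
          ((c1.mul c3).sub (c4.mul c2))) _ _
    have c7 : IntervalIntegrable (fun s => χ (s, h) * (E (s, h) * dSnd W (s, h))) volume
        (-(2 * R)) (2 * R) := (c5.mul (c1.mul c3)).intervalIntegrable _ _
    have c8 : IntervalIntegrable (fun s => χ (s, h) * (W (s, h) * dSnd E (s, h))) volume
        (-(2 * R)) (2 * R) := (c5.mul (c4.mul c2)).intervalIntegrable _ _
    -- The cutoff is a linear combination of disc cutoffs, so Green's identity can be applied to
    -- each disc separately.
    have hsplit : (∫ s in (-(2 * R))..(2 * R), χ (s, h) * (E (s, h) * dSnd W (s, h))) -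
        (∫ s in (-(2 * R))..(2 * R), χ (s, h) * (W (s, h) * dSnd E (s, h))) =
        (∫ s in (-(2 * R))..(2 * R), discCutoff 0 R (s, h) *
          (E (s, h) * dSnd W (s, h) - W (s, h) * dSnd E (s, h))) -
        (∫ s in (-(2 * R))..(2 * R), discCutoff 0 ρ (s, h) *
          (E (s, h) * dSnd W (s, h) - W (s, h) * dSnd E (s, h))) -
        (∫ s in (-(2 * R))..(2 * R), discCutoff ε ρ (s, h) *
          (E (s, h) * dSnd W (s, h) - W (s, h) * dSnd E (s, h))) := by
      rw [← intervalIntegral.integral_sub c7 c8, ← intervalIntegral.integral_sub (c6 _ _) (c6 _ _),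
        ← intervalIntegral.integral_sub ((c6 _ _).sub (c6 _ _)) (c6 _ _)]
      congr 1
      ext s
      simp only [hχ, apertureCutoff]
      ring
    rw [hsplit, hgreen 0 R h hh.1 hh.2.le (by linarith)
        (hedge 0 R le_rfl hε.le (by linarith)),
      hgreen 0 ρ h hh.1 hh.2.le hρp (hedge 0 ρ le_rfl hε.le (by linarith)),
      hgreen ε ρ h hh.1 hh.2.le hρp (hedge ε ρ hε.le le_rfl (by linarith))]
    have b1 := hfar h hh.1 hh.2.le
    have b2 := hn0 (2 * R) h hh.1
    have b3 := hnε (2 * R) h hh.1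
    refine (norm_sub_le _ _).trans ?_
    refine (add_le_add_left (norm_sub_le _ _) _).trans ?_
    simp only [norm_neg]
    linarith
  have hfin := le_of_tendsto hlim.norm hbound
  have hd := hIρ.le
  rw [dist_comm, dist_eq_norm] at hd
  calc _ = ‖(c * (∫ t in (0 : ℝ)..ε, hankelMoment 0 (κ * |t - y|)) -
        c * ∫ t in (0 : ℝ)..ε, χ (t, 0) * hankelMoment 0 (κ * |t - y|)) +
        (c * (∫ t in (0 : ℝ)..ε, χ (t, 0) * hankelMoment 0 (κ * |t - y|)) +
          Real.pi * W (y, 0))‖ := by congr 1; ring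
    _ ≤ η + 3 * η := (norm_add_le _ _).trans (add_le_add hd hfin)
    _ = 0 + η' := by rw [hη]; ring

/-! ### From the Euclidean plane to product coordinates; plane waves -/

/-- The identification of `ℝ × ℝ` with the Euclidean plane. -/
def toPlane : (ℝ × ℝ) ≃L[ℝ] Plane :=
  (ContinuousLinearEquiv.finTwoArrow ℝ ℝ).symm.trans (EuclideanSpace.equiv (Fin 2) ℝ).symm

lemma toPlane_apply (p : ℝ × ℝ) : toPlane p = !₂[p.1, p.2] := rfl

lemma toPlane_zero (p : ℝ × ℝ) : toPlane p 0 = p.1 := rfl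

lemma toPlane_one (p : ℝ × ℝ) : toPlane p 1 = p.2 := rfl

lemma toPlane_single_zero : toPlane (1, 0) = EuclideanSpace.single 0 1 := by
  ext i; fin_cases i <;> simp [toPlane_apply]

lemma toPlane_single_one : toPlane (0, 1) = EuclideanSpace.single 1 1 := by
  ext i; fin_cases i <;> simp [toPlane_apply]

lemma toPlane_mem_upperHalf {p : ℝ × ℝ} : toPlane p ∈ upperHalf ↔ p ∈ upperProd := Iff.rfl

lemma norm_toPlane (p : ℝ × ℝ) : ‖toPlane p‖ = √(distSq 0 p) := by
  rw [EuclideanSpace.norm_eq, distSq_zero]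
  simp [toPlane_apply]

lemma measurePreserving_toPlane : MeasurePreserving toPlane volume volume :=
  (EuclideanSpace.volume_preserving_symm_measurableEquiv_toLp (Fin 2)).symm.comp
    (volume_preserving_finTwoArrow ℝ).symm

lemma measurableEmbedding_toPlane : MeasurableEmbedding toPlane :=
  toPlane.toHomeomorph.measurableEmbedding

lemma fderiv_comp_toPlane (f : Plane → ℂ) (p : ℝ × ℝ) :
    fderiv ℝ (fun q => f (toPlane q)) p = (fderiv ℝ f (toPlane p)).comp (toPlane : _ →L[ℝ] Plane) :=
  toPlane.comp_right_fderiv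

lemma dFst_comp_toPlane (f : Plane → ℂ) (p : ℝ × ℝ) :
    dFst (fun q => f (toPlane q)) p = partialDeriv 0 f (toPlane p) := by
  rw [dFst, fderiv_comp_toPlane, partialDeriv, ← toPlane_single_zero]
  rfl

lemma dSnd_comp_toPlane (f : Plane → ℂ) (p : ℝ × ℝ) :
    dSnd (fun q => f (toPlane q)) p = partialDeriv 1 f (toPlane p) := by
  rw [dSnd, fderiv_comp_toPlane, partialDeriv, ← toPlane_single_one]
  rfl

/-- The coordinate-free Laplacian is evaluated in the standard orthonormal basis; the C² hypothesis
turns iterated partial derivatives into diagonal entries of the second derivative. -/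
lemma laplacian_comp_toPlane {f : Plane → ℂ} {p : ℝ × ℝ} (hf : ContDiffAt ℝ 2 f (toPlane p)) :
    dFst (dFst fun q => f (toPlane q)) p + dSnd (dSnd fun q => f (toPlane q)) p =
      Laplacian.laplacian f (toPlane p) := by
  have hd : DifferentiableAt ℝ (fderiv ℝ f) (toPlane p) :=
    (hf.fderiv_right (m := 1) (by norm_num)).differentiableAt (by norm_num)
  have key : ∀ i : Fin 2, fderiv ℝ (partialDeriv i f) (toPlane p) (EuclideanSpace.single i 1) =
      fderiv ℝ (fderiv ℝ f) (toPlane p) (EuclideanSpace.single i 1)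
        (EuclideanSpace.single i 1) := by
    intro i
    have h : HasFDerivAt (partialDeriv i f) _ (toPlane p) :=
      hd.hasFDerivAt.clm_apply (hasFDerivAt_const (EuclideanSpace.single i (1 : ℝ)) (toPlane p))
    rw [h.fderiv]
    simp
  have h1 : (dFst fun q => f (toPlane q)) = fun q => partialDeriv 0 f (toPlane q) :=
    funext (dFst_comp_toPlane f)
  have h2 : (dSnd fun q => f (toPlane q)) = fun q => partialDeriv 1 f (toPlane q) :=
    funext (dSnd_comp_toPlane f)
  rw [h1, h2, dFst_comp_toPlane, dSnd_comp_toPlane,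
    InnerProductSpace.laplacian_eq_iteratedFDeriv_orthonormalBasis f
      (EuclideanSpace.basisFun (Fin 2) ℝ)]
  simp only [Fin.sum_univ_two, iteratedFDeriv_two_apply, EuclideanSpace.basisFun_apply]
  rw [partialDeriv, partialDeriv, key 0, key 1]
  rfl

/-- The plane wave `exp (i (a x₁ + b x₂))`. -/
def planeWave (a b : ℝ) (p : ℝ × ℝ) : ℂ := Complex.exp (Complex.I * (a * p.1 + b * p.2))

lemma contDiff_planeWave (a b : ℝ) {n : ℕ∞} : ContDiff ℝ n (planeWave a b) := by
  have h1 : ContDiff ℝ n fun p : ℝ × ℝ => (p.1 : ℂ) := Complex.ofRealCLM.contDiff.comp contDiff_fst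
  have h2 : ContDiff ℝ n fun p : ℝ × ℝ => (p.2 : ℂ) := Complex.ofRealCLM.contDiff.comp contDiff_snd
  unfold planeWave
  fun_prop

lemma dFst_planeWave (a b : ℝ) : dFst (planeWave a b) = fun p => Complex.I * a * planeWave a b p := by
  ext p
  refine dFst_eq_of_hasDerivAt ((contDiff_planeWave a b (n := 1)).differentiable
    (by simp)).differentiableAt ?_
  have h := ((((Complex.ofRealCLM.hasDerivAt (x := p.1)).const_mul (a : ℂ)).add_const
    ((b : ℂ) * p.2)).const_mul Complex.I).cexp
  refine h.congr_deriv ?_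
  simp only [planeWave, Complex.ofRealCLM_apply, Complex.ofReal_one]
  ring

lemma dSnd_planeWave (a b : ℝ) : dSnd (planeWave a b) = fun p => Complex.I * b * planeWave a b p := by
  ext p
  refine dSnd_eq_of_hasDerivAt ((contDiff_planeWave a b (n := 1)).differentiable
    (by simp)).differentiableAt ?_
  have h := ((((Complex.ofRealCLM.hasDerivAt (x := p.2)).const_mul (b : ℂ)).const_add
    ((a : ℂ) * p.1)).const_mul Complex.I).cexp
  refine h.congr_deriv ?_
  simp only [planeWave, Complex.ofRealCLM_apply, Complex.ofReal_one]
  ring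

lemma planeWave_helmholtz (a b : ℝ) (p : ℝ × ℝ) :
    dFst (dFst (planeWave a b)) p + dSnd (dSnd (planeWave a b)) p =
      -(a ^ 2 + b ^ 2) * planeWave a b p := by
  have hd : DifferentiableAt ℝ (planeWave a b) p :=
    ((contDiff_planeWave a b (n := 1)).differentiable (by simp)).differentiableAt
  have h1 : dFst (dFst (planeWave a b)) p = Complex.I * a * (Complex.I * a * planeWave a b p) := by
    rw [dFst_planeWave, dFst_mul (differentiableAt_const _) hd, dFst_planeWave]
    simp [dFst]
  have h2 : dSnd (dSnd (planeWave a b)) p = Complex.I * b * (Complex.I * b * planeWave a b p) := by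
    rw [dSnd_planeWave, dSnd_mul (differentiableAt_const _) hd, dSnd_planeWave]
    simp [dSnd]
  rw [h1, h2]
  linear_combination (((a : ℂ) ^ 2 + b ^ 2) * planeWave a b p) * Complex.I_sq

lemma uInc_toPlane (κ θ : ℝ) (p : ℝ × ℝ) :
    uInc κ θ (toPlane p) = planeWave (κ * Real.sin θ) (-(κ * Real.cos θ)) p := by
  rw [uInc, planeWave, toPlane_zero, toPlane_one]
  congr 1
  push_cast
  ring

lemma uRef_toPlane (κ θ : ℝ) (p : ℝ × ℝ) :
    uRef κ θ (toPlane p) = planeWave (κ * Real.sin θ) (κ * Real.cos θ) p := by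
  rw [uRef, planeWave, toPlane_zero, toPlane_one]
  congr 1
  push_cast
  ring

/-- The sum of the incident and the reflected wave. -/
def uTot (κ θ : ℝ) (x : Plane) : ℂ := uInc κ θ x + uRef κ θ x

lemma uTot_toPlane (κ θ : ℝ) : (fun p => uTot κ θ (toPlane p)) = fun p =>
    planeWave (κ * Real.sin θ) (-(κ * Real.cos θ)) p + planeWave (κ * Real.sin θ) (κ * Real.cos θ) p := by
  ext p
  rw [uTot, uInc_toPlane, uRef_toPlane]

lemma contDiff_uTot_toPlane (κ θ : ℝ) {n : ℕ∞} :
    ContDiff ℝ n (fun p => uTot κ θ (toPlane p)) := by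
  rw [uTot_toPlane]
  exact (contDiff_planeWave _ _).add (contDiff_planeWave _ _)

lemma contDiff_of_comp_toPlane {f : Plane → ℂ} {n : ℕ∞} (h : ContDiff ℝ n fun p => f (toPlane p)) :
    ContDiff ℝ n f := by
  have e : f = (fun p => f (toPlane p)) ∘ toPlane.symm := by ext x; simp
  rw [e]
  exact h.comp toPlane.symm.contDiff

lemma contDiff_uInc (κ θ : ℝ) {n : ℕ∞} : ContDiff ℝ n (uInc κ θ) :=
  contDiff_of_comp_toPlane (by simp only [uInc_toPlane]; exact contDiff_planeWave _ _)

lemma contDiff_uRef (κ θ : ℝ) {n : ℕ∞} : ContDiff ℝ n (uRef κ θ) :=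
  contDiff_of_comp_toPlane (by simp only [uRef_toPlane]; exact contDiff_planeWave _ _)

lemma contDiff_uTot (κ θ : ℝ) {n : ℕ∞} : ContDiff ℝ n (uTot κ θ) :=
  (contDiff_uInc κ θ).add (contDiff_uRef κ θ)

lemma laplacian_uTot (κ θ : ℝ) (p : ℝ × ℝ) :
    Laplacian.laplacian (uTot κ θ) (toPlane p) = -(κ : ℂ) ^ 2 * uTot κ θ (toPlane p) := by
  have hsc : (Real.sin θ : ℂ) ^ 2 + (Real.cos θ : ℂ) ^ 2 = 1 := by
    exact_mod_cast Real.sin_sq_add_cos_sq θ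
  have h1 : Laplacian.laplacian (uInc κ θ) (toPlane p) = -(κ : ℂ) ^ 2 * uInc κ θ (toPlane p) := by
    rw [← laplacian_comp_toPlane (contDiff_uInc κ θ (n := 2)).contDiffAt]
    simp only [uInc_toPlane]
    rw [planeWave_helmholtz]
    push_cast at hsc ⊢
    linear_combination (-(κ : ℂ) ^ 2 *
      planeWave (κ * Real.sin θ) (-(κ * Real.cos θ)) p) * hsc
  have h2 : Laplacian.laplacian (uRef κ θ) (toPlane p) = -(κ : ℂ) ^ 2 * uRef κ θ (toPlane p) := by
    rw [← laplacian_comp_toPlane (contDiff_uRef κ θ (n := 2)).contDiffAt]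
    simp only [uRef_toPlane]
    rw [planeWave_helmholtz]
    push_cast at hsc ⊢
    linear_combination (-(κ : ℂ) ^ 2 *
      planeWave (κ * Real.sin θ) (κ * Real.cos θ) p) * hsc
  have h3 := ContDiffAt.laplacian_add (contDiff_uInc κ θ (n := 2)).contDiffAt
    (contDiff_uRef κ θ (n := 2)).contDiffAt (x := toPlane p)
  have h4 : uTot κ θ = uInc κ θ + uRef κ θ := rfl
  rw [h4, h3, h1, h2, Pi.add_apply]
  ring

/-- The vertical wavenumbers are opposite, so the two normal derivatives cancel on the line. Hence
the scattered field inherits the Neumann data of v unchanged. -/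
lemma dSnd_uTot_boundary (κ θ t : ℝ) : dSnd (fun p => uTot κ θ (toPlane p)) (t, 0) = 0 := by
  have hd : ∀ a b, DifferentiableAt ℝ (planeWave a b) (t, 0) := fun a b =>
    ((contDiff_planeWave a b (n := 1)).differentiable (by simp)).differentiableAt
  rw [uTot_toPlane, dSnd, fderiv_fun_add (hd _ _) (hd _ _)]
  change dSnd _ _ + dSnd _ _ = 0
  rw [dSnd_planeWave, dSnd_planeWave]
  simp only [planeWave]
  push_cast
  simp

lemma continuous_dFst {f : ℝ × ℝ → ℂ} (hf : ContDiff ℝ 1 f) : Continuous (dFst f) :=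
  (hf.continuous_fderiv (by norm_num)).clm_apply continuous_const

lemma continuous_dSnd {f : ℝ × ℝ → ℂ} (hf : ContDiff ℝ 1 f) : Continuous (dSnd f) :=
  (hf.continuous_fderiv (by norm_num)).clm_apply continuous_const

lemma sq_integrableOn_box_sub {f g : ℝ × ℝ → ℂ} {R : ℝ} (hfc : ContinuousOn f upperProd)
    (hg : Continuous g) (hf : IntegrableOn (fun p => ‖f p‖ ^ 2) (Set.Ioo (-R) R ×ˢ Set.Ioo 0 R)) :
    IntegrableOn (fun p => ‖f p - g p‖ ^ 2) (Set.Ioo (-R) R ×ˢ Set.Ioo 0 R) := by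
  have hm : MeasurableSet (Set.Ioo (-R) R ×ˢ Set.Ioo 0 R) := measurableSet_Ioo.prod measurableSet_Ioo
  have hgi : IntegrableOn (fun p => ‖g p‖ ^ 2) (Set.Ioo (-R) R ×ˢ Set.Ioo 0 R) := by
    have : IntegrableOn (fun p => ‖g p‖ ^ 2) (Set.Icc ((-R, 0) : ℝ × ℝ) (R, R)) :=
      (hg.norm.pow 2).continuousOn.integrableOn_compact isCompact_Icc
    refine this.mono_set ?_
    rw [← Set.Icc_prod_Icc]
    exact Set.prod_mono Set.Ioo_subset_Icc_self Set.Ioo_subset_Icc_self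
  have hsub : Set.Ioo (-R) R ×ˢ Set.Ioo 0 R ⊆ upperProd := fun p hp => hp.2.1
  refine ((hf.const_mul 2).add (hgi.const_mul 2)).mono'
    ((((hfc.mono hsub).sub hg.continuousOn).norm.pow 2).aestronglyMeasurable hm) ?_
  refine Eventually.of_forall fun p => ?_
  rw [Real.norm_of_nonneg (by positivity)]
  have h1 := norm_sub_le (f p) (g p)
  simp only [Pi.add_apply]
  nlinarith [norm_nonneg (f p - g p), sq_nonneg (‖f p‖ - ‖g p‖)]

lemma integrableOn_box {F : Plane → ℝ}
    (hF : ∀ R : ℝ, IntegrableOn F (Metric.ball 0 R ∩ upperHalf)) (R : ℝ) :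
    IntegrableOn (fun p => F (toPlane p)) (Set.Ioo (-R) R ×ˢ Set.Ioo 0 R) := by
  have h := (measurePreserving_toPlane.integrableOn_comp_preimage
    measurableEmbedding_toPlane).2 (hF (2 * R))
  -- A box of side parameter R fits into the ball of radius 2R.
  refine h.mono_set ?_
  rintro p ⟨⟨h1, h2⟩, h3, h4⟩
  refine ⟨?_, h3⟩
  rw [mem_ball_zero_iff, norm_toPlane, distSq_zero, Real.sqrt_lt' (by linarith)]
  nlinarith

lemma tendsto_toPlane_boundary (t : ℝ) :
    Tendsto toPlane (𝓝[upperProd] (t, 0)) (𝓝[upperHalf] !₂[t, 0]) := by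
  refine tendsto_nhdsWithin_iff.2 ⟨?_, ?_⟩
  · exact (toPlane.continuous.tendsto (t, 0)).mono_left nhdsWithin_le_nhds
  · filter_upwards [self_mem_nhdsWithin] with p hp using hp

/-- The scattered part of a solution, in product coordinates, is a radiating field driven by the
Dirichlet-to-Neumann data on the aperture. -/
theorem IsApproxSolution.isApertureField {κ θ ε d : ℝ} {v : Plane → ℂ}
    (hv : IsApproxSolution κ θ ε d v) :
    IsApertureField κ ε (dtn0 κ ε d v) (fun p => scattered κ θ v (toPlane p)) := by
  set V : ℝ × ℝ → ℂ := fun p => v (toPlane p) with hV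
  set U : ℝ × ℝ → ℂ := fun p => uTot κ θ (toPlane p) with hU
  have hW : (fun p => scattered κ θ v (toPlane p)) = fun p => V p - U p := rfl
  have hVc : ContDiffOn ℝ (2 : ℕ∞) V upperProd :=
    hv.contDiffOn.comp toPlane.contDiff.contDiffOn fun p hp => hp
  have hUc : ∀ {n : ℕ∞}, ContDiff ℝ n U := contDiff_uTot_toPlane κ θ
  have hVd : ∀ p ∈ upperProd, DifferentiableAt ℝ V p := fun p hp =>
    differentiableAt_upperProd hVc (by norm_num) hp
  have hUd : ∀ p, DifferentiableAt ℝ U p := fun p =>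
    ((hUc (n := 1)).differentiable (by simp)).differentiableAt
  have hopen : IsOpen upperHalf := by
    have : upperHalf = toPlane.symm ⁻¹' upperProd := by
      ext x
      rw [Set.mem_preimage, ← toPlane_mem_upperHalf, ContinuousLinearEquiv.apply_symm_apply]
    rw [this]
    exact isOpen_upperProd.preimage toPlane.symm.continuous
  have hbd : ∀ (t : ℝ) (a : ℂ), Tendsto (partialDeriv 1 v) (𝓝[upperHalf] !₂[t, 0]) (𝓝 a) →
      Tendsto (dSnd fun p => scattered κ θ v (toPlane p)) (𝓝[upperProd] (t, 0)) (𝓝 a) := by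
    intro t a ha
    have h1 : Tendsto (dSnd V) (𝓝[upperProd] (t, 0)) (𝓝 a) := by
      have : dSnd V = partialDeriv 1 v ∘ toPlane := funext (dSnd_comp_toPlane v)
      rw [this]
      exact ha.comp (tendsto_toPlane_boundary t)
    have h2 : Tendsto (dSnd U) (𝓝[upperProd] (t, 0)) (𝓝 0) := by
      have := (continuous_dSnd hUc).tendsto (t, 0)
      rw [dSnd_uTot_boundary] at this
      exact this.mono_left nhdsWithin_le_nhds
    have h3 := h1.sub h2
    rw [sub_zero] at h3
    refine h3.congr' ?_
    filter_upwards [self_mem_nhdsWithin] with p hp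
    rw [hW, dSnd_sub (hVd p hp) (hUd p)]
  refine ⟨?_, ?_, ?_, ?_, ?_, ?_, ?_, ?_⟩
  · exact hVc.sub hUc.contDiffOn
  · refine ContinuousOn.sub (f := V) (g := U) ?_ (hUc (n := 1)).continuous.continuousOn
    refine hv.continuousOn.comp toPlane.continuous.continuousOn ?_
    rintro p ⟨h1, h2, h3⟩
    refine ⟨h1, fun h => h2 ?_, fun h => h3 ?_⟩
    · exact toPlane.injective h
    · exact toPlane.injective h
  · exact fun R => sq_integrableOn_box_sub hVc.continuousOn (hUc (n := 1)).continuous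
      (integrableOn_box hv.sq_integrable R)
  · intro R
    have hm : MeasurableSet (Set.Ioo (-R) R ×ˢ Set.Ioo 0 R) :=
      measurableSet_Ioo.prod measurableSet_Ioo
    have hsub : Set.Ioo (-R) R ×ˢ Set.Ioo 0 R ⊆ upperProd := fun p hp => hp.2.1
    have hg := integrableOn_box hv.gradSq_integrable R
    have hgrad : ∀ p, gradSq v (toPlane p) = ‖dFst V p‖ ^ 2 + ‖dSnd V p‖ ^ 2 := fun p => by
      rw [gradSq, ← dFst_comp_toPlane, ← dSnd_comp_toPlane]
    have c1 := (contDiffOn_dFst (m := 1) hVc le_rfl).continuousOn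
    have c2 := (contDiffOn_dSnd (m := 1) hVc le_rfl).continuousOn
    have i1 : IntegrableOn (fun p => ‖dFst V p‖ ^ 2) (Set.Ioo (-R) R ×ˢ Set.Ioo 0 R) := by
      refine hg.mono' (((c1.mono hsub).norm.pow 2).aestronglyMeasurable hm)
        (Eventually.of_forall fun p => ?_)
      rw [Real.norm_of_nonneg (by positivity), hgrad]
      exact le_add_of_nonneg_right (by positivity)
    have i2 : IntegrableOn (fun p => ‖dSnd V p‖ ^ 2) (Set.Ioo (-R) R ×ˢ Set.Ioo 0 R) := by
      refine hg.mono' (((c2.mono hsub).norm.pow 2).aestronglyMeasurable hm)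
        (Eventually.of_forall fun p => ?_)
      rw [Real.norm_of_nonneg (by positivity), hgrad]
      exact le_add_of_nonneg_left (by positivity)
    have h := (sq_integrableOn_box_sub c1 (continuous_dFst hUc) i1).add
      (sq_integrableOn_box_sub c2 (continuous_dSnd hUc) i2)
    refine h.congr_fun (fun p hp => ?_) hm
    simp only [Pi.add_apply]
    rw [hW, dSnd_sub (hVd p (hsub hp)) (hUd p), dFst_sub (hVd p (hsub hp)) (hUd p)]
  · intro p hp
    have hvp : ContDiffAt ℝ 2 v (toPlane p) := hv.contDiffOn.contDiffAt (hopen.mem_nhds hp)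
    have hup : ContDiffAt ℝ 2 (uTot κ θ) (toPlane p) := (contDiff_uTot κ θ (n := 2)).contDiffAt
    have hs : scattered κ θ v = v - uTot κ θ := rfl
    rw [laplacian_comp_toPlane (f := scattered κ θ v) (by rw [hs]; exact hvp.sub hup), hs,
      ContDiffAt.laplacian_sub hvp hup, laplacian_uTot, Pi.sub_apply]
    linear_combination hv.helmholtz (toPlane p) hp
  · exact fun t ht => hbd t 0 (hv.neumann t ht)
  · exact fun t ht => hbd t _ (hv.aperture t ht)
  · intro η hη
    have hb := (Metric.hasBasis_cobounded_compl_closedBall (0 : Plane)).inf_principal upperHalf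
    have h1 := (Metric.tendsto_nhds.1 hv.radiation) η hη
    obtain ⟨R, -, hR⟩ := hb.eventually_iff.1 h1
    -- The shift gives both r > 0 and a point strictly outside the closed ball.
    refine ⟨max R 0 + 1, fun p hp hpR => ?_⟩
    have hr := norm_toPlane p
    set r := √(distSq 0 p) with hrdef
    have hrR : R < r := by linarith [le_max_left R 0]
    have hrp : 0 < r := by linarith [le_max_right R 0]
    have h2 := hR (x := toPlane p) ⟨by
      rw [Set.mem_compl_iff, mem_closedBall_zero_iff, hr, not_le]
      exact hrR, hp⟩
    rw [dist_zero_right, hr, norm_mul, Complex.norm_real, Real.norm_of_nonneg (Real.sqrt_nonneg _)]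
      at h2
    set S := scattered κ θ v with hS
    have h3 : fderiv ℝ S (toPlane p) (toPlane p) =
        p.1 * dFst (fun q => S (toPlane q)) p + p.2 * dSnd (fun q => S (toPlane q)) p := by
      have e : toPlane p = p.1 • toPlane (1, 0) + p.2 • toPlane (0, 1) := by
        rw [← map_smul, ← map_smul, ← map_add]
        congr 1
        ext <;> simp
      have e' := congrArg (fderiv ℝ S (toPlane p)) e
      rw [map_add, map_smul, map_smul] at e'
      rw [dFst_comp_toPlane, dSnd_comp_toPlane, partialDeriv, partialDeriv, ← toPlane_single_zero,
        ← toPlane_single_one, ← Complex.real_smul, ← Complex.real_smul, e']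
    have hrc : (r : ℂ) ≠ 0 := by exact_mod_cast hrp.ne'
    have h4 : p.1 * dFst (fun q => S (toPlane q)) p + p.2 * dSnd (fun q => S (toPlane q)) p -
        Complex.I * κ * r * S (toPlane p) =
        r * (fderiv ℝ S (toPlane p) (r⁻¹ • toPlane p) - Complex.I * κ * S (toPlane p)) := by
      rw [map_smul, h3, Complex.real_smul]
      push_cast
      field_simp
    rw [h4, norm_mul, Complex.norm_real, Real.norm_of_nonneg hrp.le]
    have h5 := Real.mul_self_sqrt hrp.le
    have h6 := Real.sqrt_pos.2 hrp
    set X := ‖fderiv ℝ S (toPlane p) (r⁻¹ • toPlane p) - Complex.I * κ * S (toPlane p)‖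
    calc r * X = √r * (√r * X) := by rw [← mul_assoc, h5]
      _ ≤ √r * η := by gcongr
      _ = η * √r := mul_comm _ _

/-! ### Estimates for the aperture integrals -/

/-- The single-layer potential of the aperture, restricted to the boundary line. -/
def layer (κ ε y : ℝ) : ℂ := ∫ t in (0 : ℝ)..ε, hankelMoment 0 (κ * |t - y|)

/-- After translation y enters only through the limits of integration of a locally integrable
function. -/
lemma continuous_layer {κ : ℝ} (hκ : 0 < κ) (ε : ℝ) : Continuous (layer κ ε) := by
  have hInt : ∀ a b : ℝ, IntervalIntegrable (fun s => hankelMoment 0 (κ * |s|)) volume a b :=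
    fun a b => by simpa using intervalIntegrable_hankelMoment_zero hκ 0 a b
  have h1 : ∀ y, layer κ ε y = (∫ s in (0 : ℝ)..(ε - y), hankelMoment 0 (κ * |s|)) -
      ∫ s in (0 : ℝ)..(0 - y), hankelMoment 0 (κ * |s|) := fun y => by
    rw [layer, intervalIntegral.integral_comp_sub_right (fun s => hankelMoment 0 (κ * |s|)) y,
      intervalIntegral.integral_interval_sub_left (hInt _ _) (hInt _ _)]
  have h2 := intervalIntegral.continuous_primitive hInt 0
  rw [funext h1]
  exact (h2.comp (by fun_prop)).sub (h2.comp (by fun_prop))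

/-- All arguments κ|t - y| stay below z₀, and the logarithmic singularity has the favourable sign.
This one-sided bound is therefore free of logarithms, which is why the upper estimate needs no
condition on ε ln(λ/ε). -/
lemma re_layer_ge {κ ε y z₀ C : ℝ} (hκ : 0 < κ) (hε : 0 < ε) (hz₀ : κ * ε < z₀)
    (hC : ∀ z ∈ Set.Ioo 0 z₀, -C ≤ (hankelMoment 0 z).re) (hy : y ∈ Set.Icc 0 ε) :
    -C * ε ≤ (layer κ ε y).re := by
  have hInt := intervalIntegrable_hankelMoment_zero hκ y 0 ε
  have h1 : (layer κ ε y).re = ∫ t in (0 : ℝ)..ε, (hankelMoment 0 (κ * |t - y|)).re :=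
    (Complex.reCLM.intervalIntegral_comp_comm hInt).symm
  rw [h1]
  have h2 : ∫ _ in (0 : ℝ)..ε, -C ≤ ∫ t in (0 : ℝ)..ε, (hankelMoment 0 (κ * |t - y|)).re := by
    refine intervalIntegral.integral_mono_ae_restrict hε.le (by simp)
      ⟨Complex.reCLM.integrable_comp hInt.1, Complex.reCLM.integrable_comp hInt.2⟩ ?_
    filter_upwards [ae_restrict_mem measurableSet_Icc, ae_restrict_of_ae (ae_ne y)] with t ht hty
    have h3 : |t - y| ≤ ε := by
      rw [abs_le]; constructor <;> linarith [ht.1, ht.2, hy.1, hy.2]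
    have h4 : 0 < |t - y| := abs_pos.2 (sub_ne_zero.2 hty)
    refine hC _ ⟨by positivity, lt_of_le_of_lt ?_ hz₀⟩
    gcongr
  rw [intervalIntegral.integral_const, sub_zero, smul_eq_mul] at h2
  linarith

/-- For x > 0 this is log(x/ε) ≥ 1 - ε/x multiplied by x; at x = 0 the convention for the logarithm
at 0 makes the right side 0. -/
lemma mul_log_ge {x ε : ℝ} (hx : 0 ≤ x) (hε : 0 < ε) :
    x * Real.log ε + x - ε ≤ x * Real.log x := by
  rcases hx.eq_or_lt with rfl | hx
  · simp [hε.le]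
  · have h := Real.one_sub_inv_le_log_of_pos (div_pos hx hε)
    rw [Real.log_div hx.ne' hε.ne', inv_div] at h
    have h2 := mul_le_mul_of_nonneg_left h hx.le
    have h3 : x * (1 - ε / x) = x - ε := by field_simp
    linarith

/-- The real logarithm is even, so the integrand is log|t - y|. Its primitive leaves y log y + (ε -
y) log(ε - y) - ε, to which `mul_log_ge` applies twice. -/
lemma integral_log_abs_ge {ε y : ℝ} (hε : 0 < ε) (hy : y ∈ Set.Icc 0 ε) :
    ε * Real.log ε - 2 * ε ≤ ∫ t in (0 : ℝ)..ε, Real.log (t - y) := by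
  rw [intervalIntegral.integral_comp_sub_right (fun s => Real.log s) y, integral_log]
  have h1 := mul_log_ge hy.1 hε
  have h2 := mul_log_ge (sub_nonneg.2 hy.2) hε
  rw [zero_sub, Real.log_neg_eq_log]
  nlinarith

/-- Integrating the logarithmic majorant of the kernel costs 2K beyond its value at distance ε,
uniformly in the position y. -/
lemma norm_layer_le {κ ε y C K : ℝ} (hκ : 0 < κ) (hε : 0 < ε) (hκε : κ * ε ≤ 1) (hK : 0 < K)
    (hC : ∀ z ∈ Set.Ioc (0 : ℝ) 1, ‖hankelMoment 0 z‖ ≤ C - K * Real.log z)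
    (hy : y ∈ Set.Icc 0 ε) :
    ‖layer κ ε y‖ ≤ ε * (C + 2 * K - K * Real.log (κ * ε)) := by
  have hlog : IntervalIntegrable (fun t => Real.log (t - y)) volume 0 ε := by
    have := (intervalIntegral.intervalIntegrable_log' (a := 0 - y) (b := ε - y)).comp_sub_right y
    simpa using this
  have hb : ∀ᵐ t : ℝ, t ∈ Set.Ioc 0 ε → ‖hankelMoment 0 (κ * |t - y|)‖ ≤
      (C - K * Real.log κ) - K * Real.log (t - y) := by
    filter_upwards [ae_ne y] with t hty ht
    have h3 : |t - y| ≤ ε := by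
      rw [abs_le]; constructor <;> linarith [ht.1, ht.2, hy.1, hy.2]
    have h4 : 0 < |t - y| := abs_pos.2 (sub_ne_zero.2 hty)
    have h5 := hC (κ * |t - y|) ⟨by positivity, le_trans (by gcongr) hκε⟩
    rw [Real.log_mul hκ.ne' h4.ne', Real.log_abs] at h5
    linarith
  have h := intervalIntegral.norm_integral_le_of_norm_le hε.le hb
    ((by simp : IntervalIntegrable (fun _ => C - K * Real.log κ) volume 0 ε).sub
      (hlog.const_mul K))
  rw [intervalIntegral.integral_sub (by simp) (hlog.const_mul K),
    intervalIntegral.integral_const, intervalIntegral.integral_const_mul, sub_zero,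
    smul_eq_mul] at h
  have h6 := mul_le_mul_of_nonneg_left (integral_log_abs_ge hε hy) hK.le
  rw [Real.log_mul hκ.ne' hε.ne']
  refine h.trans ?_
  nlinarith

/-- The mean of the single-layer potential over the aperture, times `ε`. -/
def selfLayer (κ ε : ℝ) : ℂ := ∫ y in (0 : ℝ)..ε, layer κ ε y

lemma re_selfLayer_ge {κ ε z₀ C : ℝ} (hκ : 0 < κ) (hε : 0 < ε) (hz₀ : κ * ε < z₀)
    (hC : ∀ z ∈ Set.Ioo 0 z₀, -C ≤ (hankelMoment 0 z).re) :
    -C * ε ^ 2 ≤ (selfLayer κ ε).re := by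
  have hc := continuous_layer hκ ε
  have h1 : (selfLayer κ ε).re = ∫ y in (0 : ℝ)..ε, (layer κ ε y).re :=
    (Complex.reCLM.intervalIntegral_comp_comm (hc.intervalIntegrable _ _)).symm
  have h2 : ∫ _ in (0 : ℝ)..ε, -C * ε ≤ ∫ y in (0 : ℝ)..ε, (layer κ ε y).re :=
    intervalIntegral.integral_mono_on hε.le (by simp)
      ((Complex.continuous_re.comp hc).intervalIntegrable _ _)
      fun y hy => re_layer_ge hκ hε hz₀ hC hy
  rw [intervalIntegral.integral_const, sub_zero, smul_eq_mul] at h2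
  rw [h1]
  nlinarith

lemma norm_selfLayer_le {κ ε C K : ℝ} (hκ : 0 < κ) (hε : 0 < ε) (hκε : κ * ε ≤ 1) (hK : 0 < K)
    (hC : ∀ z ∈ Set.Ioc (0 : ℝ) 1, ‖hankelMoment 0 z‖ ≤ C - K * Real.log z) :
    ‖selfLayer κ ε‖ ≤ ε ^ 2 * (C + 2 * K - K * Real.log (κ * ε)) := by
  have h := intervalIntegral.norm_integral_le_of_norm_le_const (a := 0) (b := ε)
    (f := layer κ ε) (C := ε * (C + 2 * K - K * Real.log (κ * ε))) fun y hy => by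
      rw [Set.uIoc_of_le hε.le] at hy
      exact norm_layer_le hκ hε hκε hK hC ⟨hy.1.le, hy.2⟩
  rw [sub_zero, abs_of_pos hε] at h
  exact h.trans (le_of_eq (by ring))

/-- The mean of the incident wave over the aperture, times `ε`. -/
def apertureWave (κ θ ε : ℝ) : ℂ :=
  ∫ t in (0 : ℝ)..ε, Complex.exp (((κ * Real.sin θ * t : ℝ) : ℂ) * Complex.I)

lemma norm_apertureWave_le (κ θ : ℝ) {ε : ℝ} (hε : 0 < ε) : ‖apertureWave κ θ ε‖ ≤ ε := by
  have h := intervalIntegral.norm_integral_le_of_norm_le_const (a := 0) (b := ε)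
    (f := fun t : ℝ => Complex.exp (((κ * Real.sin θ * t : ℝ) : ℂ) * Complex.I)) (C := 1)
    fun t _ => (Complex.norm_exp_ofReal_mul_I _).le
  rwa [sub_zero, abs_of_pos hε, one_mul] at h

/-- The phase is at most κε ≤ 1 in modulus whatever θ is, so the cosine is at least 1/2 and no
cancellation occurs. -/
lemma half_le_norm_apertureWave {κ θ ε : ℝ} (hκ : 0 < κ) (hε : 0 < ε) (hκε : κ * ε ≤ 1) :
    ε / 2 ≤ ‖apertureWave κ θ ε‖ := by
  have hc : Continuous fun t : ℝ => Complex.exp (((κ * Real.sin θ * t : ℝ) : ℂ) * Complex.I) := by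
    fun_prop
  have h1 : (apertureWave κ θ ε).re = ∫ t in (0 : ℝ)..ε,
      (Complex.exp (((κ * Real.sin θ * t : ℝ) : ℂ) * Complex.I)).re :=
    (Complex.reCLM.intervalIntegral_comp_comm (hc.intervalIntegrable _ _)).symm
  have h2 : ∫ _ in (0 : ℝ)..ε, (1 / 2 : ℝ) ≤ ∫ t in (0 : ℝ)..ε,
      (Complex.exp (((κ * Real.sin θ * t : ℝ) : ℂ) * Complex.I)).re := by
    refine intervalIntegral.integral_mono_on hε.le (by simp)
      ((Complex.continuous_re.comp hc).intervalIntegrable _ _) fun t ht => ?_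
    rw [Complex.exp_ofReal_mul_I_re]
    have h3 := Real.one_sub_sq_div_two_le_cos (x := κ * Real.sin θ * t)
    have h4 : |κ * Real.sin θ * t| ≤ 1 := by
      rw [abs_mul, abs_mul, abs_of_pos hκ, abs_of_nonneg ht.1]
      calc κ * |Real.sin θ| * t ≤ κ * 1 * ε := by
            gcongr
            · exact ht.1
            · exact Real.abs_sin_le_one θ
            · exact ht.2
        _ ≤ 1 := by linarith
    have h5 := (sq_le_one_iff_abs_le_one _).2 h4
    linarith
  rw [intervalIntegral.integral_const, sub_zero, smul_eq_mul] at h2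
  have h6 := Complex.re_le_norm (apertureWave κ θ ε)
  linarith

/-! ### The cavity mode and the equation for the aperture coefficient -/

lemma exp_two_mul (x : ℝ) :
    Complex.exp (Complex.I * 2 * x) = Complex.exp (Complex.I * x) ^ 2 := by
  rw [← Complex.exp_nat_mul]; congr 1; push_cast; ring

lemma cos_eq_exp_add (x : ℝ) : (Real.cos x : ℂ) =
    (Complex.exp (Complex.I * x) + (Complex.exp (Complex.I * x))⁻¹) / 2 := by
  rw [Complex.ofReal_cos, Complex.cos, ← Complex.exp_neg]
  ring_nf

lemma sin_eq_exp_sub (x : ℝ) : (Real.sin x : ℂ) =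
    ((Complex.exp (Complex.I * x))⁻¹ - Complex.exp (Complex.I * x)) * Complex.I / 2 := by
  rw [Complex.ofReal_sin, Complex.sin, ← Complex.exp_neg]
  ring_nf

lemma exp_sq_sub_one_ne_zero {x : ℝ} (hx : Real.sin x ≠ 0) :
    Complex.exp (Complex.I * x) ^ 2 - 1 ≠ 0 := by
  intro h
  apply hx
  have h1 := sin_eq_exp_sub x
  have h2 : Complex.exp (Complex.I * x) ≠ 0 := Complex.exp_ne_zero _
  have h3 : (Complex.exp (Complex.I * x))⁻¹ - Complex.exp (Complex.I * x) = 0 := by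
    field_simp
    linear_combination -h
  rw [h3, zero_mul, zero_div] at h1
  exact_mod_cast h1

/-- The quotient of exponentials is -i cot(κd). That the factor is real lets a lower bound on the
real part of the layer integral control the linear equation. -/
lemma dtn_factor_eq {κ d : ℝ} (h : Real.sin (κ * d) ≠ 0) :
    Complex.I * κ * ((Complex.exp (Complex.I * 2 * κ * d) + 1) /
      (Complex.exp (Complex.I * 2 * κ * d) - 1)) =
      ((κ * Real.cos (κ * d) / Real.sin (κ * d) : ℝ) : ℂ) := by
  have h1 : Complex.exp (Complex.I * 2 * κ * d) = Complex.exp (Complex.I * (κ * d : ℝ)) ^ 2 := by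
    rw [← exp_two_mul]; push_cast; ring_nf
  have h2 := exp_sq_sub_one_ne_zero h
  have h3 : (Real.sin (κ * d) : ℂ) ≠ 0 := by exact_mod_cast h
  rw [h1, Complex.ofReal_div, Complex.ofReal_mul κ (Real.cos _)]
  have h4 := cos_eq_exp_add (κ * d)
  have h5 := sin_eq_exp_sub (κ * d)
  have h6 : Complex.exp (Complex.I * (κ * d : ℝ)) ≠ 0 := Complex.exp_ne_zero _
  rw [mul_div_assoc', div_eq_div_iff h2 h3, h4, h5]
  generalize Complex.exp (Complex.I * (κ * d : ℝ)) = E at *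
  field_simp
  linear_combination ((κ : ℂ) * (E ^ 2 + 1) * (1 - E ^ 2)) * Complex.I_sq

/-- The mode in the cavity, given its value `a` at the aperture. -/
lemma mode_eq {κ d : ℝ} (h : Real.sin (κ * d) ≠ 0) (a : ℂ) (t : ℝ) :
    (Complex.exp (Complex.I * κ * d) * 0 - a) / (Complex.exp (Complex.I * 2 * κ * d) - 1) *
        Complex.exp (-Complex.I * κ * t) +
      (Complex.exp (Complex.I * κ * d) * a - 0) / (Complex.exp (Complex.I * 2 * κ * d) - 1) *
        Complex.exp (Complex.I * κ * (t + d)) =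
      a * ((Real.sin (κ * (t + d)) / Real.sin (κ * d) : ℝ) : ℂ) := by
  have h1 : Complex.exp (Complex.I * 2 * κ * d) = Complex.exp (Complex.I * (κ * d : ℝ)) ^ 2 := by
    rw [← exp_two_mul]; push_cast; ring_nf
  have h1' : Complex.exp (Complex.I * κ * d) = Complex.exp (Complex.I * (κ * d : ℝ)) := by
    push_cast; ring_nf
  have h2 := exp_sq_sub_one_ne_zero h
  have h3 : (Real.sin (κ * d) : ℂ) ≠ 0 := by exact_mod_cast h
  have h5 := sin_eq_exp_sub (κ * d)
  have h7 := sin_eq_exp_sub (κ * (t + d))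
  have h8 : Complex.exp (Complex.I * (κ * (t + d) : ℝ)) =
      Complex.exp (Complex.I * (κ * t : ℝ)) * Complex.exp (Complex.I * (κ * d : ℝ)) := by
    rw [← Complex.exp_add]; push_cast; ring_nf
  have h9 : Complex.exp (-Complex.I * κ * t) = (Complex.exp (Complex.I * (κ * t : ℝ)))⁻¹ := by
    rw [← Complex.exp_neg]; push_cast; ring_nf
  have h10 : Complex.exp (Complex.I * κ * (t + d)) =
      Complex.exp (Complex.I * (κ * (t + d) : ℝ)) := by
    push_cast; ring_nf
  have h6 : Complex.exp (Complex.I * (κ * d : ℝ)) ≠ 0 := Complex.exp_ne_zero _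
  have h11 : Complex.exp (Complex.I * (κ * t : ℝ)) ≠ 0 := Complex.exp_ne_zero _
  rw [h10, h9, h1, h1', Complex.ofReal_div, ← mul_div_assoc, eq_div_iff h3, h7, h5, h8]
  generalize Complex.exp (Complex.I * (κ * d : ℝ)) = E at *
  generalize Complex.exp (Complex.I * (κ * t : ℝ)) = A at *
  field_simp
  ring

lemma uTot_boundary (κ θ t : ℝ) : uTot κ θ (toPlane (t, 0)) =
    2 * Complex.exp (((κ * Real.sin θ * t : ℝ) : ℂ) * Complex.I) := by
  rw [uTot, uInc_toPlane, uRef_toPlane, planeWave, planeWave]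
  push_cast
  simp only [mul_zero, add_zero]
  ring_nf

/-- The linear equation for the aperture coefficient of a solution. -/
lemma IsApproxSolution.coeff0_eq {κ θ ε d : ℝ} {v : Plane → ℂ} (hκ : 0 < κ) (hε : 0 < ε)
    (hv : IsApproxSolution κ θ ε d v) (hsin : Real.sin (κ * d) ≠ 0) :
    coeff0 ε 0 v * (1 + ((κ * Real.cos (κ * d) / Real.sin (κ * d) / (Real.pi * ε) : ℝ) : ℂ) *
      selfLayer κ ε) = 2 * phi0 ε * apertureWave κ θ ε := by
  set c := dtn0 κ ε d v with hc
  have hpi : (Real.pi : ℂ) ≠ 0 := by exact_mod_cast Real.pi_ne_zero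
  -- On the boundary the incident and reflected waves coincide, hence the factor 2; the rest is the
  -- representation formula for the scattered field.
  have htrace : ∀ y ∈ Set.Ioo 0 ε, v !₂[y, 0] = -(c / Real.pi) * layer κ ε y +
      2 * Complex.exp (((κ * Real.sin θ * y : ℝ) : ℂ) * Complex.I) := by
    intro y hy
    have h1 := hv.isApertureField.trace_eq hκ hε hy
    have h2 : scattered κ θ v (toPlane (y, 0)) = v !₂[y, 0] - uTot κ θ (toPlane (y, 0)) := rfl
    rw [h2, uTot_boundary, ← hc] at h1
    change c * layer κ ε y + _ = 0 at h1
    field_simp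
    linear_combination h1
  have hconj : starRingEnd ℂ (phi0 ε) = phi0 ε := by rw [phi0, Complex.conj_ofReal]
  have hcoeff : coeff0 ε 0 v = (-(c / Real.pi) * selfLayer κ ε + 2 * apertureWave κ θ ε) * phi0 ε := by
    rw [coeff0, hconj, intervalIntegral.integral_mul_const]
    congr 1
    have hcw : Continuous fun t : ℝ => Complex.exp (((κ * Real.sin θ * t : ℝ) : ℂ) * Complex.I) := by
      fun_prop
    rw [selfLayer, apertureWave, ← intervalIntegral.integral_const_mul,
      ← intervalIntegral.integral_const_mul, ← intervalIntegral.integral_add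
        (((continuous_layer hκ ε).intervalIntegrable _ _).const_mul _)
        ((hcw.intervalIntegrable _ _).const_mul _),
      intervalIntegral.integral_of_le hε.le, intervalIntegral.integral_of_le hε.le,
      integral_Ioc_eq_integral_Ioo, integral_Ioc_eq_integral_Ioo]
    exact setIntegral_congr_fun measurableSet_Ioo htrace
  have hc' : c = ((κ * Real.cos (κ * d) / Real.sin (κ * d) : ℝ) : ℂ) * coeff0 ε 0 v * phi0 ε := by
    rw [hc, dtn0, dtn_factor_eq hsin]
  have hphi : phi0 ε ^ 2 = (ε : ℂ)⁻¹ := by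
    rw [phi0, ← Complex.ofReal_pow, div_pow, Real.sq_sqrt hε.le, one_pow, one_div,
      Complex.ofReal_inv]
  rw [hc'] at hcoeff
  have hε0 : (ε : ℂ) ≠ 0 := by exact_mod_cast hε.ne'
  set τ := κ * Real.cos (κ * d) / Real.sin (κ * d)
  set a := coeff0 ε 0 v
  -- One φ₀ comes from the Neumann datum and one from the averaging; their product is 1/ε.
  have h3 : ((τ / (Real.pi * ε) : ℝ) : ℂ) = τ / Real.pi * phi0 ε ^ 2 := by
    rw [hphi]; push_cast; field_simp
  rw [h3]
  linear_combination hcoeff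

/-! ### The energy in the cavity -/

lemma half_le_cos {x : ℝ} (hx : |x| ≤ 1) : 1 / 2 ≤ Real.cos x := by
  have h1 := Real.one_sub_sq_div_two_le_cos (x := x)
  have h2 := (sq_le_one_iff_abs_le_one _).2 hx
  linarith

/-- This is x ≤ tan x; at x = κd it gives κ cot(κd) ≤ 1/d. -/
lemma mul_cos_le_sin {x : ℝ} (hx : 0 < x) (hx1 : x ≤ 1) : x * Real.cos x ≤ Real.sin x := by
  have hc : 0 < Real.cos x := by
    have := half_le_cos (x := x) (by rw [abs_of_pos hx]; exact hx1)
    linarith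
  have h := Real.lt_tan hx (by linarith [Real.pi_gt_three])
  rw [Real.tan_eq_sin_div_cos, lt_div_iff₀ hc] at h
  exact h.le

lemma half_mul_le_sin {x : ℝ} (hx : 0 < x) (hx1 : x ≤ 1) : x / 2 ≤ Real.sin x := by
  have h1 := half_le_cos (x := x) (by rw [abs_of_pos hx]; exact hx1)
  have h2 := mul_cos_le_sin hx hx1
  nlinarith

lemma isOpen_cavity (ε d : ℝ) : IsOpen (cavity ε d) := by
  have h0 : Continuous fun x : Plane => x 0 := by fun_prop
  have h1 : Continuous fun x : Plane => x 1 := by fun_prop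
  exact (isOpen_lt continuous_const h0).inter ((isOpen_lt h0 continuous_const).inter
    ((isOpen_lt continuous_const h1).inter (isOpen_lt h1 continuous_const)))

lemma volume_cavity (ε d : ℝ) : volume (cavity ε d) = ENNReal.ofReal ε * ENNReal.ofReal d := by
  have h1 : toPlane ⁻¹' cavity ε d = Set.Ioo 0 ε ×ˢ Set.Ioo (-d) 0 := by
    ext p
    simp only [Set.mem_preimage, cavity, Set.mem_ofPred_eq, toPlane_zero, toPlane_one, Set.mem_prod,
      Set.mem_Ioo]
    tauto
  rw [← measurePreserving_toPlane.measure_preimage_emb measurableEmbedding_toPlane, h1,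
    Measure.volume_eq_prod, Measure.prod_prod, Real.volume_Ioo, Real.volume_Ioo]
  simp

/-- The bottom condition makes v₀⁻ vanish, so the mode is a sine profile in x₂ alone and only its
x₂-derivative contributes. -/
lemma IsApproxSolution.gradSq_cavity {κ θ ε d : ℝ} {v : Plane → ℂ} (hε : 0 < ε)
    (hv : IsApproxSolution κ θ ε d v) (hsin : Real.sin (κ * d) ≠ 0) {x : Plane}
    (hx : x ∈ cavity ε d) :
    gradSq v x = ‖coeff0 ε 0 v‖ ^ 2 / ε *
      (κ * Real.cos (κ * (x 1 + d)) / Real.sin (κ * d)) ^ 2 := by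
  have hbot : coeff0 ε (-d) v = 0 := by
    rw [coeff0, intervalIntegral.integral_of_le hε.le, integral_Ioc_eq_integral_Ioo,
      setIntegral_congr_fun (g := fun _ => 0) measurableSet_Ioo fun t ht => by
        simp only [hv.bottom t ht, zero_mul]]
    simp
  set a := coeff0 ε 0 v with ha
  set F : ℝ → ℂ := fun t => a * ((Real.sin (κ * (t + d)) / Real.sin (κ * d) : ℝ) : ℂ) * phi0 ε
    with hF
  have hveq : v =ᶠ[𝓝 x] fun z : Plane => F (z 1) := by
    filter_upwards [(isOpen_cavity ε d).mem_nhds hx] with z hz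
    rw [hv.mode z hz, alphaPlus, alphaMinus, hbot, ← ha, mode_eq hsin]
  set F' : ℂ := a * ((κ * Real.cos (κ * (x 1 + d)) / Real.sin (κ * d) : ℝ) : ℂ) * phi0 ε with hF'
  have hder : HasDerivAt F F' (x 1) := by
    have h1 : HasDerivAt (fun t : ℝ => κ * (t + d)) κ (x 1) := by
      simpa using ((hasDerivAt_id (x 1)).add_const d).const_mul κ
    have h2 := (h1.sin.div_const (Real.sin (κ * d))).ofReal_comp
    refine ((h2.const_mul a).mul_const (phi0 ε)).congr_deriv ?_
    rw [hF', mul_comm (Real.cos _) κ]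
  have hfd : HasFDerivAt v ((EuclideanSpace.proj 1 : Plane →L[ℝ] ℝ).smulRight F') x := by
    refine HasFDerivAt.congr_of_eventuallyEq ?_ hveq
    have h := hder.hasFDerivAt.comp x (EuclideanSpace.proj (𝕜 := ℝ) (1 : Fin 2)).hasFDerivAt
    refine h.congr_fderiv ?_
    ext z
    simp
  have h0 : partialDeriv 0 v x = 0 := by
    rw [partialDeriv, hfd.fderiv]; simp
  have h1 : partialDeriv 1 v x = F' := by
    rw [partialDeriv, hfd.fderiv]; simp
  have hs : √ε ≠ 0 := (Real.sqrt_pos.2 hε).ne'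
  rw [gradSq, h0, h1, hF', norm_mul, norm_mul, Complex.norm_real, phi0, Complex.norm_real, norm_zero,
    mul_pow, mul_pow, Real.norm_eq_abs, Real.norm_eq_abs, sq_abs, sq_abs, div_pow 1, Real.sq_sqrt hε.le]
  ring

/-- The energy in the cavity is comparable to `‖v₀⁺‖² / d`. -/
lemma IsApproxSolution.integral_gradSq_bounds {κ θ ε d : ℝ} {v : Plane → ℂ} (hκ : 0 < κ)
    (hε : 0 < ε) (hd : 0 < d) (hκd : κ * d ≤ 1) (hv : IsApproxSolution κ θ ε d v) :
    ‖coeff0 ε 0 v‖ ^ 2 / (4 * d) ≤ ∫ x in cavity ε d, gradSq v x ∧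
      ∫ x in cavity ε d, gradSq v x ≤ 4 * ‖coeff0 ε 0 v‖ ^ 2 / d := by
  have hx : 0 < κ * d := by positivity
  have hs1 := half_mul_le_sin hx hκd
  have hs2 : Real.sin (κ * d) ≤ κ * d := Real.sin_le hx.le
  have hsp : 0 < Real.sin (κ * d) := by linarith
  set a := coeff0 ε 0 v with ha
  set f : Plane → ℝ := fun x => ‖a‖ ^ 2 / ε *
    (κ * Real.cos (κ * (x 1 + d)) / Real.sin (κ * d)) ^ 2 with hf
  have hm := (isOpen_cavity ε d).measurableSet
  have hfin : volume (cavity ε d) < ⊤ := by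
    rw [volume_cavity]; exact ENNReal.mul_lt_top ENNReal.ofReal_lt_top ENNReal.ofReal_lt_top
  have hvol : volume.real (cavity ε d) = ε * d := by
    rw [Measure.real, volume_cavity, ENNReal.toReal_mul, ENNReal.toReal_ofReal hε.le,
      ENNReal.toReal_ofReal hd.le]
  rw [setIntegral_congr_fun hm fun x hx => hv.gradSq_cavity hε hsp.ne' hx, ← ha]
  have hpt : ∀ x ∈ cavity ε d, ‖a‖ ^ 2 / ε * (1 / (4 * d ^ 2)) ≤ f x ∧
      f x ≤ ‖a‖ ^ 2 / ε * (4 / d ^ 2) := by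
    rintro x ⟨-, -, h3, h4⟩
    have hu0 : 0 < κ * (x 1 + d) := mul_pos hκ (by linarith)
    have hu1 : κ * (x 1 + d) ≤ 1 := by nlinarith
    have hc1 := half_le_cos (x := κ * (x 1 + d)) (by rw [abs_of_pos hu0]; exact hu1)
    have hc2 := Real.cos_le_one (κ * (x 1 + d))
    -- Both this bound and the next use x/2 ≤ sin x ≤ x and 1/2 ≤ cos ≤ 1 on (0, 1]; their squares
    -- are then integrated over area εd.
    have hlow : 1 / (2 * d) ≤ κ * Real.cos (κ * (x 1 + d)) / Real.sin (κ * d) := by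
      rw [div_le_div_iff₀ (by positivity) hsp]
      nlinarith
    have hup : κ * Real.cos (κ * (x 1 + d)) / Real.sin (κ * d) ≤ 2 / d := by
      rw [div_le_div_iff₀ hsp hd]
      nlinarith
    have h5 : 0 < 1 / (2 * d) := by positivity
    have e1 : 1 / (4 * d ^ 2) = (1 / (2 * d)) ^ 2 := by field_simp; norm_num
    have e2 : 4 / d ^ 2 = (2 / d) ^ 2 := by field_simp; norm_num
    rw [e1, e2]
    constructor
    · simp only [hf]; gcongr
    · have h6 := h5.trans_le hlow
      simp only [hf]; gcongr
  have hfc : Continuous f := by simp only [hf]; fun_prop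
  have hfi : IntegrableOn f (cavity ε d) := by
    refine (integrableOn_const (C := ‖a‖ ^ 2 / ε * (4 / d ^ 2)) (hs := hfin.ne)).mono'
      hfc.aestronglyMeasurable ?_
    filter_upwards [ae_restrict_mem hm] with x hx
    rw [Real.norm_of_nonneg (by simp only [hf]; positivity)]
    exact (hpt x hx).2
  constructor
  · have h := setIntegral_mono_on (integrableOn_const (C := ‖a‖ ^ 2 / ε * (1 / (4 * d ^ 2)))
      (hs := hfin.ne)) hfi hm fun x hx => (hpt x hx).1
    rw [setIntegral_const, hvol, smul_eq_mul] at h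
    refine le_trans (le_of_eq ?_) h
    field_simp
  · have h := setIntegral_mono_on hfi (integrableOn_const (C := ‖a‖ ^ 2 / ε * (4 / d ^ 2))
      (hs := hfin.ne)) hm fun x hx => (hpt x hx).2
    rw [setIntegral_const, hvol, smul_eq_mul] at h
    refine h.trans (le_of_eq ?_)
    field_simp

/-- The term q|J| splits into (ε/d)(C + 2K) and K times ε|log(κε)|/d. The first is at most C + 2K
because ε ≤ d, and the second at most K by the logarithmic condition. -/
lemma norm_one_add_selfLayer_le {κ ε d C K q : ℝ} (hκ : 0 < κ) (hε : 0 < ε) (hd : 0 < d)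
    (hκε1 : κ * ε ≤ 1) (hεd : ε / d ≤ 1) (hC : 0 < C) (hK : 0 < K)
    (hlog : ∀ z ∈ Set.Ioc (0 : ℝ) 1, ‖hankelMoment 0 z‖ ≤ C - K * Real.log z)
    (hq : 0 ≤ q) (hq1 : q * ε ^ 2 ≤ ε / d)
    (hcond : ε * Real.log (wavelength κ / ε) ≤ d) :
    ‖1 + (q : ℂ) * selfLayer κ ε‖ ≤ 1 + C + 3 * K := by
  have hpi3 := Real.pi_gt_three
  set J := selfLayer κ ε
  have h1 := norm_selfLayer_le hκ hε hκε1 hK hlog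
  have h2 : -(ε * Real.log (κ * ε)) ≤ d := by
    -- Since λ/ε = 2π/(κε), the two logarithms differ by log 2π ≥ 0, which may be dropped.
    refine le_trans ?_ hcond
    rw [wavelength, div_div, Real.log_div (by positivity) (by positivity)]
    have h3 : 0 ≤ Real.log (2 * Real.pi) := Real.log_nonneg (by linarith)
    nlinarith
  have h3 : 0 ≤ C + 2 * K - K * Real.log (κ * ε) := by
    have := Real.log_nonpos (by positivity) hκε1
    nlinarith
  have h4 : q * ‖J‖ ≤ ε / d * (C + 2 * K - K * Real.log (κ * ε)) := by
    calc q * ‖J‖ ≤ q * (ε ^ 2 * (C + 2 * K - K * Real.log (κ * ε))) := by gcongr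
      _ = q * ε ^ 2 * (C + 2 * K - K * Real.log (κ * ε)) := by ring
      _ ≤ _ := by gcongr
  have h5 : ε / d * (C + 2 * K - K * Real.log (κ * ε)) =
      ε / d * (C + 2 * K) + K * (-(ε * Real.log (κ * ε)) / d) := by field_simp; ring
  have h6 : -(ε * Real.log (κ * ε)) / d ≤ 1 := by rwa [div_le_one hd]
  have h7 : ε / d * (C + 2 * K) ≤ 1 * (C + 2 * K) := by gcongr
  have h8 : K * (-(ε * Real.log (κ * ε)) / d) ≤ K * 1 := by gcongr
  refine (norm_add_le _ _).trans ?_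
  rw [norm_one, norm_mul, Complex.norm_real, Real.norm_of_nonneg hq]
  linarith

end

end PECPMC

/-! ### The two-sided estimate -/

theorem theorem2p1 :
    ∃ δ C₁ C₂ : ℝ, 0 < δ ∧ 0 < C₁ ∧ 0 < C₂ ∧
      ∀ κ θ ε d : ℝ, 0 < κ → θ ∈ Set.Ioo (-(Real.pi / 2)) (Real.pi / 2) → 0 < ε → 0 < d →
        ε ≤ δ * d → d ≤ δ * PECPMC.wavelength κ →
        ∀ v : PECPMC.Plane → ℂ, PECPMC.IsApproxSolution κ θ ε d v →
          (ε * Real.log (PECPMC.wavelength κ / ε) ≤ d →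
            C₁ * Real.sqrt (ε / d) ≤ PECPMC.gradL2Norm v (PECPMC.cavity ε d)) ∧
          PECPMC.gradL2Norm v (PECPMC.cavity ε d) ≤ C₂ * Real.sqrt (ε / d) := by
  obtain ⟨z₀, C₀, hz₀, hC₀, hre⟩ := PECPMC.exists_re_hankelMoment_zero_ge
  obtain ⟨C, K, hC, hK, hlog⟩ := PECPMC.exists_norm_hankelMoment_zero_le_log
  set C₄ := 1 + C + 3 * K with hC₄
  have hC₄p : 0 < C₄ := by positivity
  -- 1/10 gives κd ≤ 2πδ ≤ 1; z₀/2 keeps κε below z₀; 1/(2C₀) leaves the real part of 1 + qJ at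
  -- least 1/2.
  set δ := min (1 / 10) (min (z₀ / 2) (1 / (2 * C₀))) with hδ
  have hδp : 0 < δ := by positivity
  have hδ1 : δ ≤ 1 / 10 := min_le_left _ _
  have hδ2 : δ ≤ z₀ / 2 := (min_le_right _ _).trans (min_le_left _ _)
  have hδ3 : δ * C₀ ≤ 1 / 2 := by
    have : δ ≤ 1 / (2 * C₀) := (min_le_right _ _).trans (min_le_right _ _)
    calc δ * C₀ ≤ 1 / (2 * C₀) * C₀ := by gcongr
      _ = 1 / 2 := by field_simp
  -- From √ε/C₄ ≤ |v₀⁺| ≤ 4√ε and energy between |v₀⁺|²/(4d) and 4|v₀⁺|²/d, where the left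
  -- inequality needs the logarithmic condition.
  refine ⟨δ, 1 / (2 * C₄), 8, hδp, by positivity, by norm_num, ?_⟩
  intro κ θ ε d hκ _ hε hd hεd hdl v hv
  have hpi3 := Real.pi_gt_three
  have hpi4 := Real.pi_le_four
  have hκd : κ * d ≤ 1 := by
    rw [PECPMC.wavelength] at hdl
    calc κ * d ≤ κ * (δ * (2 * Real.pi / κ)) := by gcongr
      _ = δ * (2 * Real.pi) := by field_simp
      _ ≤ 1 / 10 * (2 * Real.pi) := by gcongr
      _ ≤ 1 := by linarith
  have hκε : κ * ε ≤ δ := by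
    calc κ * ε ≤ κ * (δ * d) := by gcongr
      _ = δ * (κ * d) := by ring
      _ ≤ δ * 1 := by gcongr
      _ = δ := mul_one _
  have hκε1 : κ * ε ≤ 1 := by linarith
  have hκdp : 0 < κ * d := by positivity
  have hsin : 0 < Real.sin (κ * d) := by
    have := PECPMC.half_mul_le_sin hκdp hκd
    linarith
  have hcos : 0 < Real.cos (κ * d) := by
    have := PECPMC.half_le_cos (x := κ * d) (by rw [abs_of_pos hκdp]; exact hκd)
    linarith
  set τ := κ * Real.cos (κ * d) / Real.sin (κ * d) with hτ
  have hτp : 0 < τ := by positivity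
  have hτd : τ ≤ 1 / d := by
    rw [hτ, div_le_div_iff₀ hsin hd]
    have := PECPMC.mul_cos_le_sin hκdp hκd
    linarith
  set a := PECPMC.coeff0 ε 0 v with ha
  set J := PECPMC.selfLayer κ ε with hJ
  set q := τ / (Real.pi * ε) with hq
  have hqp : 0 < q := by positivity
  have hq1 : q * ε ^ 2 ≤ ε / d := by
    calc q * ε ^ 2 = τ * ε / Real.pi := by rw [hq]; field_simp
      _ ≤ τ * ε / 1 := by gcongr; linarith
      _ ≤ 1 / d * ε := by rw [div_one]; gcongr
      _ = ε / d := by ring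
  have hεδ : ε / d ≤ δ := by rwa [div_le_iff₀ hd]
  have heq := hv.coeff0_eq hκ hε hsin.ne'
  -- Because q is positive, the lower bound for Re J alone rules out cancellation, with no control
  -- of Im J.
  have hre1 : 1 / 2 ≤ ‖1 + (q : ℂ) * J‖ := by
    refine le_trans ?_ (Complex.re_le_norm _)
    rw [Complex.add_re, Complex.one_re, Complex.re_ofReal_mul]
    have h1 := PECPMC.re_selfLayer_ge hκ hε (z₀ := z₀) (by linarith) hre
    have h2 := mul_le_mul_of_nonneg_left h1 hqp.le
    have h3 : C₀ * (q * ε ^ 2) ≤ C₀ * δ := by gcongr; exact hq1.trans hεδ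
    linarith
  have hn := congrArg norm heq
  have hphi : ‖PECPMC.phi0 ε‖ = 1 / √ε := by
    rw [PECPMC.phi0, Complex.norm_real, Real.norm_of_nonneg (by positivity)]
  rw [norm_mul, norm_mul, norm_mul, hphi, Complex.norm_ofNat] at hn
  have hsε : 0 < √ε := Real.sqrt_pos.2 hε
  have hdiv : ε / √ε = √ε := Real.div_sqrt
  have hXup := PECPMC.norm_apertureWave_le κ θ hε
  have hXlow := PECPMC.half_le_norm_apertureWave (θ := θ) hκ hε hκε1
  obtain ⟨hI1, hI2⟩ := hv.integral_gradSq_bounds hκ hε hd hκd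
  constructor
  · intro hcond
    have hup : ‖1 + (q : ℂ) * J‖ ≤ C₄ :=
      PECPMC.norm_one_add_selfLayer_le hκ hε hd hκε1 (by linarith) hC hK hlog hqp.le hq1 hcond
    have halow : √ε / C₄ ≤ ‖a‖ := by
      rw [div_le_iff₀ hC₄p]
      calc √ε = 2 * (1 / √ε) * (ε / 2) := by linear_combination -hdiv
        _ ≤ 2 * (1 / √ε) * ‖PECPMC.apertureWave κ θ ε‖ := by gcongr
        _ = ‖a‖ * ‖1 + (q : ℂ) * J‖ := hn.symm
        _ ≤ ‖a‖ * C₄ := by gcongr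
    rw [PECPMC.gradL2Norm]
    apply Real.le_sqrt_of_sq_le
    refine le_trans ?_ hI1
    rw [mul_pow, Real.sq_sqrt (by positivity)]
    calc (1 / (2 * C₄)) ^ 2 * (ε / d) = (√ε / C₄) ^ 2 / (4 * d) := by
          rw [div_pow √ε, Real.sq_sqrt hε.le]; field_simp; norm_num
      _ ≤ ‖a‖ ^ 2 / (4 * d) := by gcongr
  · have haup : ‖a‖ ≤ 4 * √ε := by
      have h1 : ‖a‖ * (1 / 2) ≤ 2 * √ε := by
        calc ‖a‖ * (1 / 2) ≤ ‖a‖ * ‖1 + (q : ℂ) * J‖ := by gcongr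
          _ = 2 * (1 / √ε) * ‖PECPMC.apertureWave κ θ ε‖ := hn
          _ ≤ 2 * (1 / √ε) * ε := by gcongr
          _ = 2 * √ε := by linear_combination 2 * hdiv
      linarith
    rw [PECPMC.gradL2Norm, Real.sqrt_le_left (by positivity)]
    refine hI2.trans ?_
    rw [mul_pow, Real.sq_sqrt (by positivity)]
    calc 4 * ‖a‖ ^ 2 / d ≤ 4 * (4 * √ε) ^ 2 / d := by gcongr
      _ = 8 ^ 2 * (ε / d) := by rw [mul_pow, Real.sq_sqrt hε.le]; ring
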